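/- A labeled graph $G$ on $n$ vertices is a complete graph on the vertex set $\{0,\dots,n-1\}$ each of whose edges is labeled $+$ or $-$; $G^+$ is the subgraph of its $+$ edges. A clustering is a partition of the vertices. Its cost is the number of disagreements, that is, the number of $+$ edges between different clusters plus the number of $-$ edges inside clusters. A clustering is an $\alpha$-approximation if its cost is at most $\alpha$ times the cost of every clustering of $G$. Algorithms are randomized word-RAM programs with words of $O(\log n)$ bits that are given $n$ and have access to an adjacency list of $G^+$, in which the neighbors of each vertex are listed once each, in an arbitrary fixed order. Unit-cost operations include degree queries (what is the degree of $v$ in $G^+$?), neighbor queries (what is the $i$-th neighbor of $v$ in $G^+$?), and drawing a uniformly random integer from $\{0,\dots,m\}$ for a given word $m$. Theorem. There is an absolute constant $\alpha$ such that for every $k\in\mathbb{N}$ there are a single program (the same for all $n$), with words of $O_k(\log n)$ bits, and a constant $C$, depending only on $k$, with the following property. For every $n\ge 2$, every labeled graph $G$ on $n$ vertices and every adjacency list of $G^+$, every run of the program on this input makes at most $C\,n\log n$ queries and halts within $C\,n\log^2 n$ steps, and with probability at least $1-n^{-k}$ the clustering that it outputs is an $\alpha$-approximation for $G$. -/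

import Mathlib

open scoped ENNReal

noncomputable section

namespace CorrClust

/-! ### Correlation clustering -/

/-- A labeled graph on the vertices `0, …, n-1`: the complete graph with every edge labeled
`+1` or `-1`.  (The values `label v v` are not used anywhere.) -/
structure LabeledGraph (n : ℕ) where
  label : Fin n → Fin n → ℤˣ
  symm : ∀ u v, label u v = label v u

/-- The subgraph of the edges labeled `+1`. -/
def LabeledGraph.pos {n : ℕ} (G : LabeledGraph n) : SimpleGraph (Fin n) where
  Adj u v := u ≠ v ∧ G.label u v = 1
  symm := ⟨fun u v h => ⟨h.1.symm, by rw [G.symm]; exact h.2⟩⟩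
  loopless := ⟨fun _ h => h.1 rfl⟩

/-- The subgraph of the edges labeled `-1`. -/
def LabeledGraph.neg {n : ℕ} (G : LabeledGraph n) : SimpleGraph (Fin n) where
  Adj u v := u ≠ v ∧ G.label u v = -1
  symm := ⟨fun u v h => ⟨h.1.symm, by rw [G.symm]; exact h.2⟩⟩
  loopless := ⟨fun _ h => h.1 rfl⟩

/-- A clustering is a partition of the vertices into disjoint clusters, given as an equivalence
relation: `C u v` says that `u` and `v` lie in the same cluster. -/
abbrev Clustering (n : ℕ) := Setoid (Fin n)

open Classical in
/-- The cost of the edge `uv` in the clustering `C`. -/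
def edgeCost {n : ℕ} (G : LabeledGraph n) (C : Clustering n) (u v : Fin n) : ℕ :=
  if G.pos.Adj u v ∧ ¬ C u v then 1
  else if G.neg.Adj u v ∧ C u v then 1
  else 0

/-- The total cost (number of disagreements); every edge is counted once. -/
def cost {n : ℕ} (G : LabeledGraph n) (C : Clustering n) : ℕ :=
  ∑ p ∈ (Finset.univ : Finset (Fin n × Fin n)) with p.1 < p.2, edgeCost G C p.1 p.2

/-- `C` is an `α`-approximate minimum-disagreement clustering of `G`. -/
def IsApprox {n : ℕ} (α : ℝ) (G : LabeledGraph n) (C : Clustering n) : Prop :=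
  ∀ C' : Clustering n, (cost G C : ℝ) ≤ α * (cost G C' : ℝ)

/-! ### Adjacency-list access -/

/-- An adjacency list of a graph: the neighbors of every vertex, each once, in some order. -/
structure AdjList {n : ℕ} (H : SimpleGraph (Fin n)) where
  nbrs : Fin n → List (Fin n)
  nodup : ∀ v, (nbrs v).Nodup
  mem_nbrs : ∀ v u, u ∈ nbrs v ↔ H.Adj v u

/-- The answer to a degree query (`0` if `v` is not a vertex). -/
def AdjList.degAnswer {n : ℕ} {H : SimpleGraph (Fin n)} (A : AdjList H) (v : ℕ) : ℕ :=
  if h : v < n then (A.nbrs ⟨v, h⟩).length else 0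

/-- The answer to a neighbor query: the entry with index `i` (counted from `0`) in the list of
`v`, and `0` if there is no such entry. -/
def AdjList.nbrAnswer {n : ℕ} {H : SimpleGraph (Fin n)} (A : AdjList H) (v i : ℕ) : ℕ :=
  if h : v < n then ((A.nbrs ⟨v, h⟩).map Fin.val).getD i 0 else 0

/-! ### Randomized word-RAM programs with adjacency-list access

A program is a fixed finite text over named registers and named arrays, all of which hold machine
words.  With word size `w` the words are the natural numbers below `2 ^ w`. -/

/-- Arithmetic operations on words. -/
inductive Op where
  | add | sub | mul | div | mod | lt | eq

/-- The operations on words below `W`.  Results are reduced modulo `W`; subtraction is truncated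
at `0`; `a / 0 = 0` and `a % 0 = a`; comparisons return `1` (true) or `0` (false). -/
def Op.eval (W : ℕ) : Op → ℕ → ℕ → ℕ
  | .add, a, b => (a + b) % W
  | .sub, a, b => (a - b) % W
  | .mul, a, b => (a * b) % W
  | .div, a, b => (a / b) % W
  | .mod, a, b => (a % b) % W
  | .lt, a, b => (if a < b then 1 else 0) % W
  | .eq, a, b => (if a = b then 1 else 0) % W

/-- Expressions: constants, registers, array entries (`get a i` is entry `i` of the array named
`a`), and operations. -/
inductive Expr where
  | lit (c : ℕ)
  | reg (x : ℕ)
  | get (a : ℕ) (i : Expr)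
  | bin (o : Op) (e₁ e₂ : Expr)

/-- Programs.  `deg x v` and `nbr x v i` are the two queries, with the answer put in register `x`;
`rand x m` puts into register `x` a fresh uniformly random number from `{0, …, m}`;
`set x e` and `put a i e` assign to a register and to an array entry. -/
inductive Prog where
  | skip
  | set (x : ℕ) (e : Expr)
  | put (a : ℕ) (i e : Expr)
  | deg (x : ℕ) (v : Expr)
  | nbr (x : ℕ) (v i : Expr)
  | rand (x : ℕ) (m : Expr)
  | seq (p q : Prog)
  | ite (e : Expr) (p q : Prog)
  | loop (e : Expr) (p : Prog)

/-- The memory of a machine: registers, arrays. -/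
structure Store where
  reg : ℕ → ℕ
  arr : ℕ → ℕ → ℕ

/-- Assignment of a word to a register. -/
def Store.setReg (W : ℕ) (s : Store) (x v : ℕ) : Store :=
  { s with reg := Function.update s.reg x (v % W) }

/-- Assignment of a word to the entry `i` of the array `a`. -/
def Store.setArr (W : ℕ) (s : Store) (a i v : ℕ) : Store :=
  { s with arr := Function.update s.arr a (Function.update (s.arr a) i (v % W)) }

/-- The value of an expression. -/
def Expr.eval (W : ℕ) (s : Store) : Expr → ℕ
  | .lit c => c % W
  | .reg x => s.reg x
  | .get a i => s.arr a (i.eval W s)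
  | .bin o e₁ e₂ => o.eval W (e₁.eval W s) (e₂.eval W s)

/-- A configuration: the programs still to be executed (first one first), the memory, and the
number of queries made so far. -/
structure Config where
  todo : List Prog
  store : Store
  queries : ℕ

/-- The distribution of the configuration after one step.  A step is the execution of one
assignment, query or random draw, or the evaluation of one test, or the unfolding of one `seq` or
`skip`.  (As the program text is fixed, each step takes a bounded number of word operations.)
A configuration with nothing left to do is halted and stays as it is. -/
def step {n : ℕ} {H : SimpleGraph (Fin n)} (W : ℕ) (A : AdjList H) : Config → PMF Config
  | ⟨[], s, q⟩ => PMF.pure ⟨[], s, q⟩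
  | ⟨.skip :: K, s, q⟩ => PMF.pure ⟨K, s, q⟩
  | ⟨.set x e :: K, s, q⟩ => PMF.pure ⟨K, s.setReg W x (e.eval W s), q⟩
  | ⟨.put a i e :: K, s, q⟩ => PMF.pure ⟨K, s.setArr W a (i.eval W s) (e.eval W s), q⟩
  | ⟨.deg x v :: K, s, q⟩ =>
      PMF.pure ⟨K, s.setReg W x (A.degAnswer (v.eval W s)), q + 1⟩
  | ⟨.nbr x v i :: K, s, q⟩ =>
      PMF.pure ⟨K, s.setReg W x (A.nbrAnswer (v.eval W s) (i.eval W s)), q + 1⟩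
  | ⟨.rand x m :: K, s, q⟩ =>
      (PMF.uniformOfFintype (Fin (m.eval W s + 1))).map fun r => ⟨K, s.setReg W x r, q⟩
  | ⟨.seq p₁ p₂ :: K, s, q⟩ => PMF.pure ⟨p₁ :: p₂ :: K, s, q⟩
  | ⟨.ite e p₁ p₂ :: K, s, q⟩ =>
      PMF.pure ⟨(if e.eval W s ≠ 0 then p₁ else p₂) :: K, s, q⟩
  | ⟨.loop e p :: K, s, q⟩ =>
      PMF.pure ⟨if e.eval W s ≠ 0 then p :: .loop e p :: K else K, s, q⟩

/-- The distribution of the configuration after `T` steps. -/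
def runFrom {n : ℕ} {H : SimpleGraph (Fin n)} (W : ℕ) (A : AdjList H) (c : Config) :
    ℕ → PMF Config
  | 0 => PMF.pure c
  | T + 1 => (step W A c).bind fun c' => runFrom W A c' T

/-- The number of words of size `κ` times the number of binary digits of `n`. -/
def wordBound (κ n : ℕ) : ℕ := 2 ^ (κ * Nat.size n)

/-- The initial configuration: register `0` holds `n`, everything else is `0`. -/
def initial (κ n : ℕ) (P : Prog) : Config where
  todo := [P]
  store :=
    { reg := Function.update (fun _ => 0) 0 (n % wordBound κ n)
      arr := fun _ _ => 0 }
  queries := 0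

/-- The distribution of the configuration of the program `P` after `T` steps, with words of
`κ * Nat.size n` bits and access to the adjacency list `A`. -/
def run {n : ℕ} {H : SimpleGraph (Fin n)} (κ : ℕ) (P : Prog) (A : AdjList H) (T : ℕ) :
    PMF Config :=
  runFrom (wordBound κ n) A (initial κ n P) T

/-- Nothing is left to be executed. -/
def Config.Halted (c : Config) : Prop := c.todo = []

/-- The clustering that a halted machine outputs: array `0` holds at index `v` the name of the
cluster of the vertex `v`. -/
abbrev Config.output (c : Config) (n : ℕ) : Clustering n :=
  Setoid.ker fun v : Fin n => c.store.arr 0 v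

end CorrClust

end

/-! Let `N v` be the closed positive neighborhood of `v`, and fix an optimal clustering `C`, used
only in the analysis. A vertex is good if `N v` differs from its class in at most |N v|/200
elements, and regular if moreover at most 1/200 of its class is not good. The sizes |N v| of the
irregular vertices add up to O(cost of `C`): a vertex that is not good pays with its own
disagreements, a good one in a class with many bad vertices pays with the average over the class
(`sum_card_not_regular_le`). A constant factor follows once the output agrees with `C` on regular
vertices and gives every `v` a cluster of size O(|N v|) (`cost_le_of_tagFacts`).

If `w` is a regular vertex, `N w` is nearly its class. So random centers `w` are tried. A center is
accepted if nine tenths of `N w` are untagged vertices passing a strict test (neighborhood nearly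
contained in `N w`, sizes comparable). It then tags every untagged vertex of `N w` that passes a
looser test. The gap between the tests rules out conflicts: the strict core of an accepted center
contains more than half of the class it meets and more than half of `N w`, so two centers cannot
share a regular class (`tag_eq`), nor can two such classes share a center (`rel_of_tag`). Some good
vertex of every regular class gets tagged, because a good center of the class is either accepted or
obstructed by tags already on the class (`exists_tag`). Finally `v` joins the center whose tag is
carried by at least three quarters of the samples from `N v`. All good members of a regular class
join the same center (`exists_joins`), and a double count bounds the clusters (`card_cluster_le`).

Every vertex is represented by L = 20b = O(log n) samples, queried once and reused in all tests, so
a test takes O(L) steps and no query. Each `w` has L independent trials to become a center, with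
success probability 1/|N w|. The total size of the centers then has expectation nL, and yet every
regular class is likely to contain a good center. This gives O(nL) queries and O(nL²) steps. A hard
budget 3nL makes the bounds hold on every run and is rarely exhausted.

All random numbers are drawn in advance onto a tape whose ranges depend only on the degrees. For a
fixed tape the program is deterministic and computes `finalTag` and `Joins`, so its failure
probability is at most the average over tapes of the indicator of an atypical tape
(`clusterProg_halts`). Exponential moments bound each atypical event by (3/4)^b, and a union bound
finishes (`prob_not_typicalTape_le`, `failure_le`). -/

noncomputable section

namespace CorrClust

/-! ### Neighborhoods compared with a reference clustering -/

section Reference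

variable {V : Type*}

theorem card_sdiff_triangle [DecidableEq V] (A B C : Finset V) :
    (A \ C).card ≤ (A \ B).card + (B \ C).card := by
  refine le_trans (Finset.card_le_card ?_) (Finset.card_union_le _ _)
  intro x
  simp only [Finset.mem_sdiff, Finset.mem_union]
  tauto

theorem card_le_sdiff_add [DecidableEq V] (A B : Finset V) :
    A.card ≤ (A \ B).card + B.card := by
  have := Finset.card_sdiff_add_card_inter A B
  have := Finset.card_le_card (Finset.inter_subset_right (s₁ := A) (s₂ := B))
  omega

theorem card_sdiff_inter_le [DecidableEq V] (A B C : Finset V) :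
    (A \ (B ∩ C)).card ≤ (A \ B).card + (A \ C).card := by
  refine le_trans (Finset.card_le_card ?_) (Finset.card_union_le _ _)
  intro x
  simp only [Finset.mem_sdiff, Finset.mem_union, Finset.mem_inter]
  tauto

variable [Fintype V]

open Classical in
/-- The class of `v` in the partition `C`. -/
def cls (C : Setoid V) (v : V) : Finset V := {u | C v u}

theorem mem_cls {C : Setoid V} {v u : V} : u ∈ cls C v ↔ C v u := by
  simp [cls]

theorem cls_congr {C : Setoid V} {v u : V} (h : C v u) : cls C v = cls C u := by
  ext x
  simp only [mem_cls]
  exact ⟨fun hx => C.trans (C.symm h) hx, fun hx => C.trans h hx⟩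

theorem card_cls_pos (C : Setoid V) (v : V) : 0 < (cls C v).card :=
  Finset.card_pos.2 ⟨v, mem_cls.2 (C.refl v)⟩

/-- Double counting: `f b` is met once for each member of the class of `b`, each time with weight
one over the size of that class. Charging to class averages therefore loses nothing globally. -/
theorem sum_sum_cls (C : Setoid V) (f : V → ℝ) :
    ∑ v, (∑ b ∈ cls C v, f b) / ((cls C v).card : ℝ) = ∑ b, f b := by
  classical
  have h1 : ∀ v, (∑ b ∈ cls C v, f b) / ((cls C v).card : ℝ)
      = ∑ b, if C v b then f b / ((cls C b).card : ℝ) else 0 := by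
    intro v
    rw [Finset.sum_div, cls, Finset.sum_filter]
    refine Finset.sum_congr rfl fun b _ => ?_
    split_ifs with h
    · rw [← cls_congr h]; rfl
    · rfl
  simp_rw [h1]
  rw [Finset.sum_comm]
  refine Finset.sum_congr rfl fun b _ => ?_
  rw [← Finset.sum_filter, Finset.sum_const]
  have h2 : (Finset.univ.filter fun v => C v b) = cls C b := by
    ext v
    simp only [Finset.mem_filter, Finset.mem_univ, true_and, mem_cls]
    exact ⟨C.symm, C.symm⟩
  rw [h2, nsmul_eq_mul]
  have := card_cls_pos C b
  field_simp

variable [DecidableEq V]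

/-- The number of disagreements of `C` at `v`, when `N v` is the closed neighborhood of `v`. -/
def dev (N : V → Finset V) (C : Setoid V) (v : V) : ℕ :=
  (N v \ cls C v).card + (cls C v \ N v).card

/-- The neighborhood of `v` is close to its class. -/
def GoodVertex (N : V → Finset V) (C : Setoid V) (v : V) : Prop :=
  200 * dev N C v ≤ (N v).card

open Classical in
/-- The good members of the class of `v`. -/
def goodPart (N : V → Finset V) (C : Setoid V) (v : V) : Finset V :=
  {u ∈ cls C v | GoodVertex N C u}

open Classical in
/-- The members of the class of `v` that are not good. -/
def badPart (N : V → Finset V) (C : Setoid V) (v : V) : Finset V :=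
  {u ∈ cls C v | ¬ GoodVertex N C u}

/-- A regular vertex is a good vertex of a class with few bad vertices. -/
def Regular (N : V → Finset V) (C : Setoid V) (v : V) : Prop :=
  GoodVertex N C v ∧ 200 * (badPart N C v).card ≤ (cls C v).card

theorem badPart_congr {N : V → Finset V} {C : Setoid V} {v u : V} (h : C v u) :
    badPart N C v = badPart N C u := by
  simp only [badPart, cls_congr h]

theorem goodPart_congr {N : V → Finset V} {C : Setoid V} {v u : V} (h : C v u) :
    goodPart N C v = goodPart N C u := by
  simp only [goodPart, cls_congr h]

theorem mem_goodPart {N : V → Finset V} {C : Setoid V} {v u : V} :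
    u ∈ goodPart N C v ↔ C v u ∧ GoodVertex N C u := by
  simp [goodPart, mem_cls]

theorem cls_sdiff_goodPart (N : V → Finset V) (C : Setoid V) (v : V) :
    cls C v \ goodPart N C v = badPart N C v := by
  ext x
  simp only [Finset.mem_sdiff, mem_goodPart, badPart, Finset.mem_filter, mem_cls]
  tauto

open Classical in
/-- The degrees of the vertices that are not regular are paid for by the disagreements. -/
theorem sum_card_not_regular_le (N : V → Finset V) (C : Setoid V) :
    ∑ v with ¬ Regular N C v, ((N v).card : ℝ) ≤ 50000 * ∑ v, (dev N C v : ℝ) := by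
  -- The first term pays for vertices that are not good, the second for good vertices in classes
  -- with many bad ones. The constant 41000 exceeds 200·200·201/199.
  have key : ∀ v, ¬ Regular N C v → ((N v).card : ℝ) ≤
      200 * (dev N C v : ℝ) +
        41000 * ((∑ b ∈ cls C v, (dev N C b : ℝ)) / ((cls C v).card : ℝ)) := by
    intro v hv
    have hnn : 0 ≤ (∑ b ∈ cls C v, (dev N C b : ℝ)) / ((cls C v).card : ℝ) := by positivity
    by_cases hg : GoodVertex N C v
    · have hf : ¬ 200 * (badPart N C v).card ≤ (cls C v).card := fun h => hv ⟨hg, h⟩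
      push Not at hf
      have hs := card_cls_pos C v
      -- A bad vertex has |N b| < 200 dev, and its class has size at most |N b| + dev.
      have hb : ∀ b ∈ badPart N C v, ((cls C v).card : ℝ) / 201 ≤ (dev N C b : ℝ) := by
        intro b hb
        simp only [badPart, Finset.mem_filter, mem_cls] at hb
        have h1 := card_le_sdiff_add (cls C b) (N b)
        have h2 : ¬ 200 * dev N C b ≤ (N b).card := hb.2
        rw [cls_congr hb.1]
        have h3 : (cls C b).card ≤ 201 * dev N C b := by
          unfold dev at *; omega
        have h4 : ((cls C b).card : ℝ) ≤ 201 * (dev N C b : ℝ) := by exact_mod_cast h3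
        linarith
      have hsum : ((badPart N C v).card : ℝ) * (((cls C v).card : ℝ) / 201)
          ≤ ∑ b ∈ cls C v, (dev N C b : ℝ) := by
        calc ((badPart N C v).card : ℝ) * (((cls C v).card : ℝ) / 201)
            ≤ ∑ b ∈ badPart N C v, (dev N C b : ℝ) := by
              rw [← nsmul_eq_mul]
              exact Finset.card_nsmul_le_sum _ _ _ hb
          _ ≤ _ := Finset.sum_le_sum_of_subset_of_nonneg (Finset.filter_subset _ _)
              fun _ _ _ => Nat.cast_nonneg _
      have hq : ((badPart N C v).card : ℝ) / 201
          ≤ (∑ b ∈ cls C v, (dev N C b : ℝ)) / ((cls C v).card : ℝ) := by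
        have hs' : (0 : ℝ) < (cls C v).card := by exact_mod_cast hs
        rw [le_div_iff₀ hs']
        linarith
      have h5 := card_le_sdiff_add (N v) (cls C v)
      have h6 : 199 * (N v).card ≤ 200 * (200 * (badPart N C v).card) := by
        unfold GoodVertex dev at hg; omega
      have h7 : (199 : ℝ) * (N v).card ≤ 200 * (200 * (badPart N C v).card) := by
        exact_mod_cast h6
      have : (0 : ℝ) ≤ dev N C v := Nat.cast_nonneg _
      linarith
    · have h1 : (N v).card ≤ 200 * dev N C v := by unfold GoodVertex at hg; omega
      have h2 : ((N v).card : ℝ) ≤ 200 * dev N C v := by exact_mod_cast h1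
      linarith
  calc ∑ v with ¬ Regular N C v, ((N v).card : ℝ)
      ≤ ∑ v with ¬ Regular N C v, (200 * (dev N C v : ℝ) +
        41000 * ((∑ b ∈ cls C v, (dev N C b : ℝ)) / ((cls C v).card : ℝ))) :=
        Finset.sum_le_sum fun v hv => key v (Finset.mem_filter.1 hv).2
    _ ≤ ∑ v, (200 * (dev N C v : ℝ) +
        41000 * ((∑ b ∈ cls C v, (dev N C b : ℝ)) / ((cls C v).card : ℝ))) :=
        Finset.sum_le_sum_of_subset_of_nonneg (Finset.filter_subset _ _)
          fun _ _ _ => by positivity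
    _ = 41200 * ∑ v, (dev N C v : ℝ) := by
        rw [Finset.sum_add_distrib, ← Finset.mul_sum, ← Finset.mul_sum, sum_sum_cls]
        ring
    _ ≤ _ := by
        have : 0 ≤ ∑ v, (dev N C v : ℝ) := Finset.sum_nonneg fun _ _ => Nat.cast_nonneg _
        linarith

/-! ### Clusters grown from tagged vertices -/

/-- The outcome of the algorithm: `T u w` says that `u` carries the tag of the center `w`,
`ver w` that the center `w` has distributed its tag, `cen w` that `w` was processed as a center,
and `joins v w` that `v` is put into the cluster of `w`. -/
structure TagFacts (N : V → Finset V) (C : Setoid V) (strict loose T joins : V → V → Prop)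
    (cen ver : V → Prop) : Prop where
  -- The tests only estimate the fraction of `N u` outside `N w`, hence the gaps: the strict test
  -- accepts up to 1/80 and guarantees 1/10, the loose one accepts up to 3/20 and guarantees 2/5.
  -- The size comparisons are exact.
  strict_sound : ∀ u w, strict u w → 10 * (N u \ N w).card ≤ (N u).card ∧
    10 * (N w).card ≤ 11 * (N u).card
  strict_complete : ∀ u w, 80 * (N u \ N w).card ≤ (N u).card →
    10 * (N w).card ≤ 11 * (N u).card → strict u w
  loose_sound : ∀ u w, loose u w → 5 * (N u \ N w).card ≤ 2 * (N u).card ∧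
    10 * (N w).card ≤ 12 * (N u).card
  loose_complete : ∀ u w, 20 * (N u \ N w).card ≤ 3 * (N u).card →
    10 * (N w).card ≤ 12 * (N u).card → loose u w
  tag_unique : ∀ u w w', T u w → T u w' → w = w'
  tag_spec : ∀ u w, T u w → ver w ∧ u ∈ N w ∧ loose u w
  tag_total : ∀ u w, ver w → u ∈ N w → loose u w → ∃ w', T u w'
  ver_core : ∀ w, ver w → ∃ K ⊆ N w, 9 * (N w).card ≤ 10 * K.card ∧
    ∀ u ∈ K, strict u w ∧ T u w
  -- `T` describes the tags at the end. Tags are never removed, so a vertex untagged at the end was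
  -- untagged when `w` was processed.
  not_ver : ∀ w, cen w → ¬ ver w → ∀ K ⊆ N w, (∀ u ∈ K, strict u w ∧ ∀ w', ¬ T u w') →
    10 * K.card < 9 * (N w).card
  join_sound : ∀ v w, joins v w → ver w ∧ 5 * (N v \ N w).card ≤ 2 * (N v).card ∧
    10 * (N w).card ≤ 12 * (N v).card
  -- The hypothesis concerns the fixed set `N w ∩ goodPart N C v` and not the set of vertices with
  -- the tag of `w`: the latter depends on the samples, so concentration could not be applied to it.
  join_complete : ∀ v w, (∀ u ∈ N w ∩ goodPart N C v, T u w) →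
    20 * (N v \ (N w ∩ goodPart N C v)).card ≤ 3 * (N v).card →
    10 * (N w).card ≤ 12 * (N v).card → joins v w
  join_unique : ∀ v w w', joins v w → joins v w' → w = w'
  cover : ∀ v, Regular N C v → ∃ w ∈ goodPart N C v, cen w

namespace TagFacts

variable {N : V → Finset V} {C : Setoid V} {strict loose T joins : V → V → Prop}
  {cen ver : V → Prop}

theorem card_cls_le {v : V} (h : GoodVertex N C v) :
    200 * (cls C v).card ≤ 201 * (N v).card := by
  have := card_le_sdiff_add (cls C v) (N v)
  unfold GoodVertex dev at h
  omega

theorem card_le_cls {v : V} (h : GoodVertex N C v) :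
    199 * (N v).card ≤ 200 * (cls C v).card := by
  have := card_le_sdiff_add (N v) (cls C v)
  unfold GoodVertex dev at h
  omega

/-- A center with a tagged good vertex has a strictly close good vertex in the same class. -/
theorem exists_strict (hT : TagFacts N C strict loose T joins cen ver) {u w : V}
    (hu : Regular N C u) (h : T u w) : ∃ u', C u u' ∧ GoodVertex N C u' ∧ strict u' w := by
  by_contra! hno
  obtain ⟨hv, -, hl⟩ := hT.tag_spec u w h
  obtain ⟨hl1, hl2⟩ := hT.loose_sound u w hl
  obtain ⟨K, hK, hK9, hKs⟩ := hT.ver_core w hv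
  -- The core `K` fills nine tenths of `N w`, while looseness puts almost three fifths of `N u` into
  -- `N w ∩ goodPart N C u`. Since |N w| ≤ 1.2 |N u|, two such sets cannot be disjoint inside `N w`.
  have hdisj : Disjoint K (N w ∩ goodPart N C u) := by
    rw [Finset.disjoint_left]
    intro x hx hx'
    obtain ⟨h1, h2⟩ := mem_goodPart.1 (Finset.mem_inter.1 hx').2
    exact hno x h1 h2 (hKs x hx).1
  have h1 : K.card + (N w ∩ goodPart N C u).card ≤ (N w).card := by
    rw [← Finset.card_union_of_disjoint hdisj]
    exact Finset.card_le_card (Finset.union_subset hK Finset.inter_subset_left)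
  have h2 : (N u).card ≤ (N u \ (N w ∩ goodPart N C u)).card + (N w ∩ goodPart N C u).card :=
    card_le_sdiff_add _ _
  have h3 : (N u \ (N w ∩ goodPart N C u)).card ≤
      (N u \ N w).card + ((N u \ cls C u).card + (cls C u \ goodPart N C u).card) := by
    exact (card_sdiff_inter_le _ _ _).trans
      (Nat.add_le_add_left (card_sdiff_triangle _ _ _) _)
  rw [cls_sdiff_goodPart] at h3
  obtain ⟨hg, hb⟩ := hu
  have h4 := card_cls_le hg
  have h5 := card_cls_pos C u
  have h6 := card_le_cls hg
  unfold GoodVertex dev at hg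
  omega

/-- If a verified center has a strictly close good vertex, its neighborhood is close to the class
of that vertex. -/
theorem near (hT : TagFacts N C strict loose T joins cen ver) {u w : V}
    (hu : GoodVertex N C u) (hs : strict u w) :
    1000 * (cls C u \ N w).card ≤ 106 * (cls C u).card ∧
      1990 * (N w).card ≤ 2200 * (cls C u).card ∧
      (ver w → ∃ K ⊆ cls C u, K ⊆ N w ∧ (∀ x ∈ K, T x w) ∧
        (cls C u).card < 2 * K.card ∧ (N w).card < 2 * K.card) := by
  obtain ⟨h1, h2⟩ := hT.strict_sound u w hs
  have h3 := card_sdiff_triangle (cls C u) (N u) (N w)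
  have h4 := card_le_cls hu
  have h5 := card_cls_pos C u
  have ha : 1000 * (cls C u \ N w).card ≤ 106 * (cls C u).card := by
    unfold GoodVertex dev at hu
    omega
  refine ⟨ha, by omega, fun hv => ?_⟩
  obtain ⟨K, hK, hK9, hKs⟩ := hT.ver_core w hv
  refine ⟨K ∩ cls C u, Finset.inter_subset_right, fun x hx => hK (Finset.mem_inter.1 hx).1,
    fun x hx => (hKs x (Finset.mem_inter.1 hx).1).2, ?_⟩
  -- `N w` meets at least 0.894 of the class, and at most a tenth of `N w`, about 0.111 of the
  -- class, lies outside `K`. The remainder is more than half of the class and of `N w`.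
  have h6 := Finset.card_sdiff_add_card_inter (cls C u) (N w)
  have h7 : (cls C u ∩ N w).card ≤ (K ∩ cls C u).card + (N w \ K).card := by
    refine le_trans (Finset.card_le_card ?_) (Finset.card_union_le _ _)
    intro x
    simp only [Finset.mem_inter, Finset.mem_union, Finset.mem_sdiff]
    tauto
  have h8 := Finset.card_sdiff_add_card_eq_card hK
  omega

/-- All tagged good vertices of a class with few bad vertices carry the same tag. -/
theorem tag_eq (hT : TagFacts N C strict loose T joins cen ver) {u v w w' : V}
    (hu : Regular N C u) (hv : Regular N C v) (huv : C u v) (h : T u w) (h' : T v w') :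
    w = w' := by
  obtain ⟨x, hx1, hx2, hx3⟩ := hT.exists_strict hu h
  obtain ⟨y, hy1, hy2, hy3⟩ := hT.exists_strict hv h'
  obtain ⟨K, hK, -, hKT, hK2, -⟩ := (hT.near hx2 hx3).2.2 (hT.tag_spec u w h).1
  obtain ⟨K', hK', -, hKT', hK2', -⟩ := (hT.near hy2 hy3).2.2 (hT.tag_spec v w' h').1
  rw [← cls_congr hx1] at hK hK2
  rw [← cls_congr hy1, ← cls_congr huv] at hK' hK2'
  by_contra hne
  -- Both cores take more than half of the same class, yet vertices with different tags are
  -- different.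
  have hd : Disjoint K K' := by
    rw [Finset.disjoint_left]
    exact fun z hz hz' => hne (hT.tag_unique z w w' (hKT z hz) (hKT' z hz'))
  have h1 : K.card + K'.card ≤ (cls C u).card := by
    rw [← Finset.card_union_of_disjoint hd]
    exact Finset.card_le_card (Finset.union_subset hK hK')
  omega

/-- A tag is carried by good vertices of at most one class with few bad vertices. -/
theorem rel_of_tag (hT : TagFacts N C strict loose T joins cen ver) {u v w : V}
    (hu : Regular N C u) (hv : Regular N C v) (h : T u w) (h' : T v w) : C u v := by
  obtain ⟨x, hx1, hx2, hx3⟩ := hT.exists_strict hu h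
  obtain ⟨y, hy1, hy2, hy3⟩ := hT.exists_strict hv h'
  obtain ⟨K, hK, hKN, -, -, hK2⟩ := (hT.near hx2 hx3).2.2 (hT.tag_spec u w h).1
  obtain ⟨K', hK', hKN', -, -, hK2'⟩ := (hT.near hy2 hy3).2.2 (hT.tag_spec v w h').1
  rw [← cls_congr hx1] at hK
  rw [← cls_congr hy1] at hK'
  by_contra hne
  -- Dually, both cores take more than half of `N w`, yet different classes are disjoint.
  have hd : Disjoint K K' := by
    rw [Finset.disjoint_left]
    exact fun z hz hz' =>
      hne (C.trans (mem_cls.1 (hK hz)) (C.symm (mem_cls.1 (hK' hz'))))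
  have h1 : K.card + K'.card ≤ (N w).card := by
    rw [← Finset.card_union_of_disjoint hd]
    exact Finset.card_le_card (Finset.union_subset hKN hKN')
  omega

theorem regular_of_goodPart {v u : V} (hv : Regular N C v) (hu : u ∈ goodPart N C v) :
    Regular N C u := by
  obtain ⟨h1, h2⟩ := mem_goodPart.1 hu
  refine ⟨h2, ?_⟩
  rw [← badPart_congr h1, ← cls_congr h1]
  exact hv.2

/-- Every class with few bad vertices has a tagged good vertex. -/
theorem exists_tag (hT : TagFacts N C strict loose T joins cen ver) (hrefl : ∀ v, v ∈ N v)
    {v : V} (hv : Regular N C v) : ∃ u ∈ goodPart N C v, ∃ w, T u w := by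
  obtain ⟨w, hw, hc⟩ := hT.cover v hv
  have hwr := regular_of_goodPart hv hw
  rw [goodPart_congr (mem_goodPart.1 hw).1]
  have hw1 : w ∈ goodPart N C w := mem_goodPart.2 ⟨C.refl w, hwr.1⟩
  -- An accepted center passes its own loose test and so receives a tag. A rejected one, if no good
  -- vertex of its class were ever tagged, would have in `N w ∩ goodPart N C w` more than nine
  -- tenths of `N w` untagged and strictly close.
  by_cases hver : ver w
  · refine ⟨w, hw1, hT.tag_total w w hver (hrefl w) (hT.loose_complete w w ?_ ?_)⟩
    · simp
    · omega
  · by_contra! hno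
    have h1 := hT.not_ver w hc hver (N w ∩ goodPart N C w) Finset.inter_subset_left ?_
    · have h2 : (N w).card ≤ (N w \ (N w ∩ goodPart N C w)).card
          + (N w ∩ goodPart N C w).card := card_le_sdiff_add _ _
      rw [Finset.sdiff_inter_self_left] at h2
      have h3 := card_sdiff_triangle (N w) (cls C w) (goodPart N C w)
      rw [cls_sdiff_goodPart] at h3
      obtain ⟨hg, hb⟩ := hwr
      have h4 := card_cls_le hg
      unfold GoodVertex dev at hg
      have h5 := card_cls_pos C w
      omega
    · intro u hu
      have hu' := (Finset.mem_inter.1 hu).2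
      refine ⟨?_, fun w' => hno u hu' w'⟩
      obtain ⟨hr, hg⟩ := mem_goodPart.1 hu'
      have h3 := card_sdiff_triangle (N u) (cls C u) (N w)
      have h4 := card_cls_le hg
      have h5 := card_le_cls hwr.1
      obtain ⟨hg', hb⟩ := hwr
      rw [cls_congr hr] at h5
      unfold GoodVertex dev at hg hg'
      rw [cls_congr hr] at hg'
      apply hT.strict_complete <;> omega

/-- Regular vertices of one class all join the same cluster, whose center has tagged only one
class. -/
theorem exists_joins (hT : TagFacts N C strict loose T joins cen ver) (hrefl : ∀ v, v ∈ N v)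
    {v : V} (hv : Regular N C v) :
    ∃ w, (∃ u ∈ goodPart N C v, T u w) ∧ ∀ x ∈ goodPart N C v, joins x w := by
  obtain ⟨u, hu, w, hw⟩ := hT.exists_tag hrefl hv
  refine ⟨w, ⟨u, hu, hw⟩, fun x hx => ?_⟩
  have hur := regular_of_goodPart hv hu
  have hxr := regular_of_goodPart hv hx
  obtain ⟨y, hy1, hy2, hy3⟩ := hT.exists_strict hur hw
  obtain ⟨n1, n2, -⟩ := hT.near hy2 hy3
  have hvu := (mem_goodPart.1 hu).1
  have hvx := (mem_goodPart.1 hx).1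
  have e : cls C y = cls C x := by
    rw [← cls_congr hy1, ← cls_congr hvu, cls_congr hvx]
  rw [e] at n1 n2
  -- Each good member of the class inside `N w` passes the loose test and hence ends with some tag;
  -- by `tag_eq` it is that of `w`.
  have htag : ∀ z ∈ N w ∩ goodPart N C x, T z w := by
    intro z hz
    obtain ⟨hz1, hz2⟩ := Finset.mem_inter.1 hz
    have hzr := regular_of_goodPart hxr hz2
    have hxz := (mem_goodPart.1 hz2).1
    have h1 := card_sdiff_triangle (N z) (cls C z) (N w)
    have h2 := card_cls_le hzr.1
    have hzg := hzr.1
    unfold GoodVertex dev at hzg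
    rw [cls_congr hxz] at n1 n2
    have hl : loose z w := by apply hT.loose_complete <;> omega
    obtain ⟨w', hw'⟩ := hT.tag_total z w (hT.tag_spec u w hw).1 hz1 hl
    have huz : C u z := C.trans (C.symm hvu) (C.trans hvx hxz)
    rw [hT.tag_eq hur hzr huz hw hw']
    exact hw'
  -- The three losses are about 0.005, 0.107 and 0.005 of |N x|, together below the 3/20 required by
  -- `join_complete`.
  have h3 : (N x \ (N w ∩ goodPart N C x)).card ≤
      (N x \ cls C x).card + ((cls C x \ N w).card + (badPart N C x).card) := by
    refine (card_sdiff_triangle _ (cls C x) _).trans (Nat.add_le_add_left ?_ _)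
    rw [← cls_sdiff_goodPart]
    exact card_sdiff_inter_le _ _ _
  obtain ⟨hg, hb⟩ := hxr
  have h4 := card_cls_le hg
  unfold GoodVertex dev at hg
  apply hT.join_complete x w htag <;> omega

/-- On regular vertices the clusters are the classes of the reference clustering. -/
theorem joins_iff (hT : TagFacts N C strict loose T joins cen ver) (hrefl : ∀ v, v ∈ N v)
    {u v : V} (hu : Regular N C u) (hv : Regular N C v) :
    (∃ w, joins u w ∧ joins v w) ↔ C u v := by
  obtain ⟨a, ⟨u', hu', hua⟩, hja⟩ := hT.exists_joins hrefl hu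
  have huu : u ∈ goodPart N C u := mem_goodPart.2 ⟨C.refl u, hu.1⟩
  constructor
  · rintro ⟨w, h1, h2⟩
    obtain ⟨b, ⟨v', hv', hvb⟩, hjb⟩ := hT.exists_joins hrefl hv
    have hvv : v ∈ goodPart N C v := mem_goodPart.2 ⟨C.refl v, hv.1⟩
    have e1 := hT.join_unique u w a h1 (hja u huu)
    have e2 := hT.join_unique v w b h2 (hjb v hvv)
    subst e1; subst e2
    have := hT.rel_of_tag (regular_of_goodPart hu hu') (regular_of_goodPart hv hv') hua hvb
    exact C.trans (mem_goodPart.1 hu').1 (C.trans this (C.symm (mem_goodPart.1 hv').1))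
  · intro h
    exact ⟨a, hja u huu, hja v (mem_goodPart.2 ⟨h, hv.1⟩)⟩

open Classical in
/-- A cluster is not much larger than the neighborhoods of its members. -/
theorem card_cluster_le (hT : TagFacts N C strict loose T joins cen ver)
    (hrefl : ∀ v, v ∈ N v) (hsymm : ∀ u v, u ∈ N v → v ∈ N u) {v w : V} (h : joins v w) :
    (Finset.univ.filter fun u => joins u w).card ≤ 4 * (N v).card := by
  obtain ⟨hver, -, hd⟩ := hT.join_sound v w h
  obtain ⟨K, hK, hK9, hKs⟩ := hT.ver_core w hver
  have hpos : 0 < (N w).card := Finset.card_pos.2 ⟨w, hrefl w⟩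
  set F := Finset.univ.filter fun u => joins u w with hF
  -- In units of |N w|: at least 3/5 of |N u| ≥ 10/12 lies in `N w`, and at most 1/10 is lost
  -- outside `K`, which leaves 2/5.
  have h1 : ∀ u ∈ F, 4 * (N w).card ≤ 10 * (N u ∩ K).card := by
    intro u hu
    obtain ⟨-, h2, h3⟩ := hT.join_sound u w (Finset.mem_filter.1 hu).2
    have h4 := Finset.card_sdiff_add_card_inter (N u) K
    have h5 := card_sdiff_triangle (N u) (N w) K
    have h6 := Finset.card_sdiff_add_card_eq_card hK
    omega
  have h2 : ∀ x ∈ K, 9 * (N x).card ≤ 10 * (N w).card := by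
    intro x hx
    have h3 := (hT.strict_sound x w (hKs x hx).1).1
    have h4 := card_le_sdiff_add (N x) (N w)
    omega
  -- Double counting of the adjacent pairs between the cluster and the core. Core vertices have |N
  -- x| ≤ (10/9)|N w|, which limits the number of such pairs.
  have h3 : ∑ u ∈ F, (N u ∩ K).card ≤ ∑ x ∈ K, (N x).card := by
    calc ∑ u ∈ F, (N u ∩ K).card = ∑ u ∈ F, (K.bipartiteAbove (fun u x => x ∈ N u) u).card := by
          refine Finset.sum_congr rfl fun u _ => congrArg Finset.card ?_
          ext x
          simp only [Finset.mem_inter, Finset.bipartiteAbove, Finset.mem_filter]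
          tauto
      _ = ∑ x ∈ K, (F.bipartiteBelow (fun u x => x ∈ N u) x).card :=
          Finset.sum_card_bipartiteAbove_eq_sum_card_bipartiteBelow _
      _ ≤ _ := by
          refine Finset.sum_le_sum fun x _ => Finset.card_le_card fun u hu => ?_
          exact hsymm _ _ (Finset.mem_filter.1 hu).2
  have h4 : F.card * (4 * (N w).card) ≤ 10 * ∑ u ∈ F, (N u ∩ K).card := by
    rw [Finset.mul_sum, ← smul_eq_mul]
    exact Finset.card_nsmul_le_sum _ _ _ h1
  have h5 : 9 * ∑ x ∈ K, (N x).card ≤ K.card * (10 * (N w).card) := by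
    rw [Finset.mul_sum, ← smul_eq_mul K.card]
    exact Finset.sum_le_card_nsmul _ _ _ h2
  have h6 : K.card ≤ (N w).card := Finset.card_le_card hK
  have h7 : 9 * (F.card * (4 * (N w).card)) ≤ 10 * (K.card * (10 * (N w).card)) := by omega
  have h8 : (36 * F.card) * (N w).card ≤ (100 * K.card) * (N w).card := by linarith
  have h9 := Nat.le_of_mul_le_mul_right h8 hpos
  omega

end TagFacts

end Reference

/-! ### The cost of a clustering grown from tagged vertices -/

section Cost

variable {n : ℕ}

open Classical in
/-- The closed neighborhood of `v` in the subgraph of the positive edges. -/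
def closedNbhd (G : LabeledGraph n) (v : Fin n) : Finset (Fin n) := {u | u = v ∨ G.pos.Adj v u}

theorem mem_closedNbhd {G : LabeledGraph n} {u v : Fin n} :
    u ∈ closedNbhd G v ↔ u = v ∨ G.pos.Adj v u := by
  simp [closedNbhd]

theorem mem_closedNbhd_self (G : LabeledGraph n) (v : Fin n) : v ∈ closedNbhd G v :=
  mem_closedNbhd.2 (Or.inl rfl)

theorem mem_closedNbhd_symm {G : LabeledGraph n} {u v : Fin n} (h : u ∈ closedNbhd G v) :
    v ∈ closedNbhd G u := by
  rcases mem_closedNbhd.1 h with h | h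
  · exact mem_closedNbhd.2 (Or.inl h.symm)
  · exact mem_closedNbhd.2 (Or.inr h.symm)

open Classical in
-- Closed neighborhoods make the disagreements at `v` exactly the symmetric difference of `N v` and
-- the class; the diagonal contributes nothing because `v` lies in both.
theorem edgeCost_eq (G : LabeledGraph n) (C : Clustering n) (v u : Fin n) :
    edgeCost G C v u =
      if u ∈ (closedNbhd G v \ cls C v) ∪ (cls C v \ closedNbhd G v) then 1 else 0 := by
  simp only [edgeCost, Finset.mem_union, Finset.mem_sdiff, mem_closedNbhd, mem_cls]
  by_cases huv : u = v
  · subst huv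
    have h1 : ¬ G.pos.Adj u u := fun h => h.1 rfl
    simp
  · have hne : v ≠ u := fun h => huv h.symm
    rcases Int.units_eq_one_or (G.label v u) with h | h
    · have h1 : G.pos.Adj v u := ⟨hne, h⟩
      have h2 : ¬ G.neg.Adj v u := fun h' => absurd (h.symm.trans h'.2) (by decide)
      by_cases h3 : C v u <;> simp [huv, h1, h2, h3]
    · have h1 : ¬ G.pos.Adj v u := fun h' => absurd (h.symm.trans h'.2) (by decide)
      have h2 : G.neg.Adj v u := ⟨hne, h⟩
      by_cases h3 : C v u <;> simp [huv, h1, h2, h3]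

theorem sum_edgeCost (G : LabeledGraph n) (C : Clustering n) (v : Fin n) :
    ∑ u, edgeCost G C v u = dev (closedNbhd G) C v := by
  classical
  simp_rw [edgeCost_eq]
  rw [Finset.sum_ite_mem, Finset.univ_inter, Finset.sum_const, smul_eq_mul, mul_one, dev,
    Finset.card_union_of_disjoint]
  rw [Finset.disjoint_left]
  intro x
  simp only [Finset.mem_sdiff]
  tauto

theorem edgeCost_symm (G : LabeledGraph n) (C : Clustering n) (v u : Fin n) :
    edgeCost G C v u = edgeCost G C u v := by
  have h1 : C v u = C u v := propext ⟨C.symm, C.symm⟩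
  have h2 : G.pos.Adj v u = G.pos.Adj u v := propext (G.pos.adj_comm v u)
  have h3 : G.neg.Adj v u = G.neg.Adj u v := propext (G.neg.adj_comm v u)
  unfold edgeCost
  congr 1
  · rw [h1, h2]
  · congr 1
    rw [h1, h3]

theorem edgeCost_self (G : LabeledGraph n) (C : Clustering n) (v : Fin n) :
    edgeCost G C v v = 0 := by
  simp [edgeCost]

theorem two_mul_cost (G : LabeledGraph n) (C : Clustering n) :
    2 * cost G C = ∑ v, ∑ u, edgeCost G C v u := by
  classical
  rw [← Finset.sum_product', Finset.univ_product_univ]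
  have h1 : ∑ p : Fin n × Fin n, edgeCost G C p.1 p.2
      = ∑ p : Fin n × Fin n with p.1 < p.2, edgeCost G C p.1 p.2
        + ∑ p : Fin n × Fin n with p.2 < p.1, edgeCost G C p.1 p.2 := by
    rw [Finset.sum_filter, Finset.sum_filter, ← Finset.sum_add_distrib]
    refine Finset.sum_congr rfl fun p _ => ?_
    rcases lt_trichotomy p.1 p.2 with h | h | h
    · simp [h, h.not_gt]
    · simp [h, edgeCost_self]
    · simp [h, h.not_gt]
  have h2 : ∑ p : Fin n × Fin n with p.2 < p.1, edgeCost G C p.1 p.2 = cost G C := by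
    unfold cost
    refine Finset.sum_bij' (fun p _ => p.swap) (fun p _ => p.swap) ?_ ?_ ?_ ?_ ?_
    · simp
    · simp
    · simp
    · simp
    · intro p _
      exact edgeCost_symm G C p.1 p.2
  rw [h1, h2, two_mul]
  rfl

/-- Pairs of regular vertices are treated alike by `F` and `C`. Every other disagreement of `F` is
charged to an irregular endpoint `v`, which has at most 5|N v| of them: |N v| from positive edges
and 4|N v| from its cluster. With `sum_card_not_regular_le` the factor is at most 1 + 5·50000·2. -/
theorem cost_le_of_tagFacts {G : LabeledGraph n} {C F : Clustering n}
    {strict loose T joins : Fin n → Fin n → Prop} {cen ver : Fin n → Prop}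
    (hT : TagFacts (closedNbhd G) C strict loose T joins cen ver)
    (hF : ∀ u v, F u v ↔ u = v ∨ ∃ w, joins u w ∧ joins v w) :
    (cost G F : ℝ) ≤ 1000000 * cost G C := by
  classical
  have hrefl := mem_closedNbhd_self G
  have hdev : ∀ v, dev (closedNbhd G) F v ≤ 5 * (closedNbhd G v).card := by
    intro v
    have h1 : (cls F v).card ≤ 4 * (closedNbhd G v).card := by
      by_cases hv : ∃ w, joins v w
      · obtain ⟨w, hw⟩ := hv
        refine le_trans (Finset.card_le_card fun u hu => ?_)
          (hT.card_cluster_le hrefl (fun _ _ => mem_closedNbhd_symm) hw)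
        rcases (hF v u).1 (mem_cls.1 hu) with rfl | ⟨w', h1, h2⟩
        · simpa using hw
        · rw [hT.join_unique v w w' hw h1]
          simpa using h2
      · have h1 : cls F v ⊆ {v} := by
          intro u hu
          rcases (hF v u).1 (mem_cls.1 hu) with rfl | ⟨w', h1, h2⟩
          · simp
          · exact absurd ⟨w', h1⟩ hv
        have h2 := Finset.card_le_card h1
        have h3 : 0 < (closedNbhd G v).card := Finset.card_pos.2 ⟨v, hrefl v⟩
        rw [Finset.card_singleton] at h2
        omega
    have h2 := Finset.card_le_card (Finset.sdiff_subset (s := closedNbhd G v) (t := cls F v))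
    have h3 := Finset.card_le_card (Finset.sdiff_subset (s := cls F v) (t := closedNbhd G v))
    unfold dev
    omega
  set R := Regular (closedNbhd G) C with hR
  have hpt : ∀ v u, edgeCost G F v u ≤ edgeCost G C v u +
      ((if ¬ R v then edgeCost G F v u else 0) + (if ¬ R u then edgeCost G F u v else 0)) := by
    intro v u
    by_cases h1 : R v
    · by_cases h2 : R u
      · have h3 : F v u ↔ C v u := by
          rw [hF, ← hT.joins_iff hrefl h1 h2]
          constructor
          · rintro (rfl | h)
            · exact (hT.joins_iff hrefl h1 h1).2 (C.refl v)
            · exact h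
          · exact Or.inr
        have h4 : edgeCost G F v u = edgeCost G C v u := by
          simp only [edgeCost, h3]
        omega
      · rw [if_pos h2, edgeCost_symm G F v u]
        omega
    · rw [if_pos h1]
      omega
  have hs : ∑ v, ∑ u, edgeCost G F v u ≤ ∑ v, ∑ u, edgeCost G C v u +
      2 * ∑ v with ¬ R v, dev (closedNbhd G) F v := by
    have e1 : ∑ v, ∑ u, (if ¬ R v then edgeCost G F v u else 0)
        = ∑ v with ¬ R v, dev (closedNbhd G) F v := by
      rw [Finset.sum_filter]
      refine Finset.sum_congr rfl fun v _ => ?_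
      split_ifs
      · simp
      · exact sum_edgeCost G F v
    have e2 : ∑ v, ∑ u, (if ¬ R u then edgeCost G F u v else 0)
        = ∑ v with ¬ R v, dev (closedNbhd G) F v := by
      rw [Finset.sum_comm, e1]
    calc ∑ v, ∑ u, edgeCost G F v u
        ≤ ∑ v, ∑ u, (edgeCost G C v u + ((if ¬ R v then edgeCost G F v u else 0)
            + (if ¬ R u then edgeCost G F u v else 0))) :=
          Finset.sum_le_sum fun v _ => Finset.sum_le_sum fun u _ => hpt v u
      _ = _ := by
          simp only [Finset.sum_add_distrib]
          rw [e1, e2, two_mul]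
  rw [← two_mul_cost, ← two_mul_cost] at hs
  have h5 : ∑ v with ¬ R v, dev (closedNbhd G) F v
      ≤ 5 * ∑ v with ¬ R v, (closedNbhd G v).card := by
    rw [Finset.mul_sum]
    exact Finset.sum_le_sum fun v _ => hdev v
  have h6 := sum_card_not_regular_le (closedNbhd G) C
  have h7 : ∑ v, (dev (closedNbhd G) C v : ℝ) = 2 * cost G C := by
    have : ∑ v, dev (closedNbhd G) C v = 2 * cost G C := by
      rw [two_mul_cost]
      exact Finset.sum_congr rfl fun v _ => (sum_edgeCost G C v).symm
    exact_mod_cast this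
  have h8 : (2 : ℝ) * cost G F ≤ 2 * cost G C +
      2 * ((∑ v with ¬ R v, dev (closedNbhd G) F v : ℕ) : ℝ) := by exact_mod_cast hs
  have h9 : ((∑ v with ¬ R v, dev (closedNbhd G) F v : ℕ) : ℝ)
      ≤ 5 * ((∑ v with ¬ R v, (closedNbhd G v).card : ℕ) : ℝ) := by exact_mod_cast h5
  have h10 : ((∑ v with ¬ R v, (closedNbhd G v).card : ℕ) : ℝ)
      = ∑ v with ¬ R v, ((closedNbhd G v).card : ℝ) := by push_cast; rfl
  have h11 : (0 : ℝ) ≤ cost G C := Nat.cast_nonneg _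
  rw [h7] at h6
  rw [h10] at h9
  linarith

/-- There is a clustering of minimum cost. -/
theorem exists_min_cost (G : LabeledGraph n) : ∃ C : Clustering n, ∀ C', cost G C ≤ cost G C' := by
  have : Nonempty (Clustering n) := ⟨⊥⟩
  exact ⟨Function.argmin (cost G), fun C' => Function.argmin_le (cost G) C'⟩

theorem isApprox_of_cost_le {G : LabeledGraph n} {C F : Clustering n} {α : ℝ} (hα : 0 ≤ α)
    (hC : ∀ C', cost G C ≤ cost G C') (h : (cost G F : ℝ) ≤ α * cost G C) : IsApprox α G F :=
  fun C' => h.trans (mul_le_mul_of_nonneg_left (by exact_mod_cast hC C') hα)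

end Cost

/-! ### Averages over tapes of independent uniform numbers -/

section Tape

/-- The average of `φ` over the tapes that agree with `ω` except for the entries
`j, …, j + k - 1`, where entry `i` is uniform on `{0, …, m i}`. -/
def avg (m : ℕ → ℕ) (φ : (ℕ → ℕ) → ℝ) : ℕ → ℕ → (ℕ → ℕ) → ℝ
  | 0, _, ω => φ ω
  | k + 1, j, ω =>
      (∑ r ∈ Finset.range (m j + 1), avg m φ k (j + 1) (Function.update ω j r)) / (m j + 1 : ℕ)

variable {m : ℕ → ℕ}

theorem avg_mono {φ ψ : (ℕ → ℕ) → ℝ} (h : ∀ ω, φ ω ≤ ψ ω) (k j : ℕ) (ω : ℕ → ℕ) :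
    avg m φ k j ω ≤ avg m ψ k j ω := by
  induction k generalizing j ω with
  | zero => exact h ω
  | succ k ih =>
    exact div_le_div_of_nonneg_right (Finset.sum_le_sum fun r _ => ih _ _) (Nat.cast_nonneg _)

theorem avg_nonneg {φ : (ℕ → ℕ) → ℝ} (h : ∀ ω, 0 ≤ φ ω) (k j : ℕ) (ω : ℕ → ℕ) :
    0 ≤ avg m φ k j ω := by
  induction k generalizing j ω with
  | zero => exact h ω
  | succ k ih => exact div_nonneg (Finset.sum_nonneg fun r _ => ih _ _) (Nat.cast_nonneg _)

theorem avg_sum {ι : Type*} (s : Finset ι) (φ : ι → (ℕ → ℕ) → ℝ) (k j : ℕ) (ω : ℕ → ℕ) :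
    avg m (fun ω => ∑ i ∈ s, φ i ω) k j ω = ∑ i ∈ s, avg m (φ i) k j ω := by
  induction k generalizing j ω with
  | zero => rfl
  | succ k ih =>
    simp only [avg, ih]
    rw [Finset.sum_comm, Finset.sum_div]

theorem avg_add (φ ψ : (ℕ → ℕ) → ℝ) (k j : ℕ) (ω : ℕ → ℕ) :
    avg m (fun ω => φ ω + ψ ω) k j ω = avg m φ k j ω + avg m ψ k j ω := by
  induction k generalizing j ω with
  | zero => rfl
  | succ k ih =>
    simp only [avg, ih]
    rw [Finset.sum_add_distrib, add_div]

theorem avg_mul_const (φ : (ℕ → ℕ) → ℝ) (c : ℝ) (k j : ℕ) (ω : ℕ → ℕ) :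
    avg m (fun ω => φ ω * c) k j ω = avg m φ k j ω * c := by
  induction k generalizing j ω with
  | zero => rfl
  | succ k ih =>
    simp only [avg, ih]
    rw [← Finset.sum_mul]
    ring

/-- Independence of the entries. Entries before `j` are fixed and come out as constants; drawing
entry `j` affects only its own factor. -/
theorem avg_prod_aux (g : ℕ → ℕ → ℝ) (N k j : ℕ) (hN : j + k = N) (ω : ℕ → ℕ) :
    avg m (fun ω => ∏ i ∈ Finset.range N, g i (ω i)) k j ω =
      (∏ i ∈ Finset.range j, g i (ω i)) *
        ∏ i ∈ Finset.Ico j N, (∑ r ∈ Finset.range (m i + 1), g i r) / (m i + 1 : ℕ) := by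
  induction k generalizing j ω with
  | zero =>
    simp only [add_zero] at hN
    subst hN
    simp [avg]
  | succ k ih =>
    have hj : j < N := by omega
    simp only [avg]
    rw [Finset.prod_eq_prod_Ico_succ_bot hj]
    have h1 : ∀ r, avg m (fun ω => ∏ i ∈ Finset.range N, g i (ω i)) k (j + 1)
        (Function.update ω j r) = g j r * ((∏ i ∈ Finset.range j, g i (ω i)) *
          ∏ i ∈ Finset.Ico (j + 1) N,
            (∑ r ∈ Finset.range (m i + 1), g i r) / (m i + 1 : ℕ)) := by
      intro r
      rw [ih (j + 1) (by omega), Finset.prod_range_succ, Function.update_self]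
      have h2 : ∏ i ∈ Finset.range j, g i (Function.update ω j r i)
          = ∏ i ∈ Finset.range j, g i (ω i) :=
        Finset.prod_congr rfl fun i hi => by
          rw [Function.update_of_ne (Finset.mem_range.1 hi).ne]
      rw [h2]
      ring
    simp_rw [h1]
    rw [← Finset.sum_mul]
    ring

/-- The average of a product of functions of different entries. -/
theorem avg_prod (g : ℕ → ℕ → ℝ) {N : ℕ} {I : Finset ℕ} (hI : I ⊆ Finset.range N)
    (ω : ℕ → ℕ) :
    avg m (fun ω => ∏ i ∈ I, g i (ω i)) N 0 ω =
      ∏ i ∈ I, (∑ r ∈ Finset.range (m i + 1), g i r) / (m i + 1 : ℕ) := by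
  have h1 : ∀ f : ℕ → ℝ, ∏ i ∈ I, f i = ∏ i ∈ Finset.range N, if i ∈ I then f i else 1 := by
    intro f
    rw [Finset.prod_ite_mem, Finset.inter_eq_right.2 hI]
  simp_rw [h1]
  have := avg_prod_aux (m := m) (fun i r => if i ∈ I then g i r else 1) N N 0 (zero_add N) ω
  rw [this]
  simp only [Finset.range_zero, Finset.prod_empty, one_mul, Nat.Ico_zero_eq_range]
  refine Finset.prod_congr rfl fun i _ => ?_
  by_cases hi : i ∈ I
  · simp [hi]
  · have : ((m i : ℝ) + 1) ≠ 0 := by positivity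
    simp [hi, this]

open Classical in
/-- The number of `t < L` for which entry `a + t` of the tape violates `Q`. -/
def failures (Q : ℕ → Prop) (a L : ℕ) (ω : ℕ → ℕ) : ℕ :=
  {t ∈ Finset.range L | ¬ Q (ω (a + t))}.card

open Classical in
-- The moment generating function of a binomial variable: `z ^ failures` has one factor for each
-- sample. Values `z > 1` serve for the upper tail, `z = 1/2` for the lower tail.
theorem avg_pow_failures (Q : ℕ → Prop) {a L D N : ℕ} (z : ℝ)
    (hm : ∀ t < L, m (a + t) + 1 = D) (hN : a + L ≤ N) (hD : 0 < D) (ω : ℕ → ℕ) :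
    avg m (fun ω => z ^ failures Q a L ω) N 0 ω =
      (1 + (z - 1) * (({r ∈ Finset.range D | ¬ Q r}.card : ℝ) / D)) ^ L := by
  have h1 : (fun ω : ℕ → ℕ => z ^ failures Q a L ω) =
      fun ω => ∏ i ∈ Finset.Ico a (a + L), if Q (ω i) then 1 else z := by
    funext ω
    rw [Finset.prod_Ico_eq_prod_range, Nat.add_sub_cancel_left, Finset.prod_ite,
      Finset.prod_const_one, one_mul, Finset.prod_const]
    rfl
  have hI : Finset.Ico a (a + L) ⊆ Finset.range N := fun i hi => by
    rw [Finset.mem_Ico] at hi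
    exact Finset.mem_range.2 (by omega)
  rw [h1, avg_prod (fun _ r => if Q r then 1 else z) hI]
  have h2 : ∀ i ∈ Finset.Ico a (a + L),
      (∑ r ∈ Finset.range (m i + 1), if Q r then (1 : ℝ) else z) / (m i + 1 : ℕ)
        = 1 + (z - 1) * (({r ∈ Finset.range D | ¬ Q r}.card : ℝ) / D) := by
    intro i hi
    rw [Finset.mem_Ico] at hi
    have h3 : m i + 1 = D := by
      have := hm (i - a) (by omega)
      rwa [Nat.add_sub_cancel' hi.1] at this
    rw [h3, Finset.sum_ite, Finset.sum_const, Finset.sum_const, nsmul_eq_mul, nsmul_eq_mul]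
    have h4 := Finset.card_filter_add_card_filter_not (s := Finset.range D) Q
    rw [Finset.card_range] at h4
    have h5 : ({r ∈ Finset.range D | Q r}.card : ℝ)
        = D - ({r ∈ Finset.range D | ¬ Q r}.card : ℝ) := by
      rw [eq_sub_iff_add_eq]; exact_mod_cast h4
    rw [h5]
    have : (D : ℝ) ≠ 0 := by exact_mod_cast hD.ne'
    field_simp
    ring
  rw [Finset.prod_congr rfl h2, Finset.prod_const, Nat.card_Ico, Nat.add_sub_cancel_left]

open Classical in
/-- The probability that more than `b` of the `L` samples violate `Q`. -/
theorem avg_failures_gt_le (Q : ℕ → Prop) {a L D N b : ℕ} {z p : ℝ} (hz : 1 ≤ z)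
    (hm : ∀ t < L, m (a + t) + 1 = D) (hN : a + L ≤ N) (hD : 0 < D)
    (hp : ({r ∈ Finset.range D | ¬ Q r}.card : ℝ) ≤ p * D) (ω : ℕ → ℕ) :
    avg m (fun ω => if b < failures Q a L ω then 1 else 0) N 0 ω ≤
      (1 + (z - 1) * p) ^ L * (z ^ b)⁻¹ := by
  have hz0 : 0 < z := by linarith
  -- Markov's inequality for `z ^ failures`.
  calc avg m (fun ω => if b < failures Q a L ω then 1 else 0) N 0 ω
      ≤ avg m (fun ω => z ^ failures Q a L ω * (z ^ b)⁻¹) N 0 ω := by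
        refine avg_mono (fun ω => ?_) _ _ _
        split_ifs with h
        · rw [← div_eq_mul_inv, one_le_div (by positivity)]
          exact pow_le_pow_right₀ hz h.le
        · positivity
    _ ≤ _ := by
        rw [avg_mul_const, avg_pow_failures Q z hm hN hD]
        have hD' : (0 : ℝ) < D := by exact_mod_cast hD
        have h1 : ({r ∈ Finset.range D | ¬ Q r}.card : ℝ) / D ≤ p := by
          rwa [div_le_iff₀ hD']
        have h2 : (0 : ℝ) ≤ ({r ∈ Finset.range D | ¬ Q r}.card : ℝ) / D := by positivity
        have h3 : 0 ≤ z - 1 := by linarith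
        refine mul_le_mul_of_nonneg_right (pow_le_pow_left₀ (by positivity) ?_ _) (by positivity)
        nlinarith

open Classical in
/-- The probability that at most `b` of the `L` samples violate `Q`. -/
theorem avg_failures_le_le (Q : ℕ → Prop) {a L D N b : ℕ} {p : ℝ}
    (hm : ∀ t < L, m (a + t) + 1 = D) (hN : a + L ≤ N) (hD : 0 < D)
    (hp : p * D ≤ ({r ∈ Finset.range D | ¬ Q r}.card : ℝ)) (ω : ℕ → ℕ) :
    avg m (fun ω => if failures Q a L ω ≤ b then 1 else 0) N 0 ω ≤
      (1 - p / 2) ^ L * 2 ^ b := by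
  calc avg m (fun ω => if failures Q a L ω ≤ b then 1 else 0) N 0 ω
      ≤ avg m (fun ω => (1 / 2 : ℝ) ^ failures Q a L ω * 2 ^ b) N 0 ω := by
        refine avg_mono (fun ω => ?_) _ _ _
        split_ifs with h
        · rw [one_div, inv_pow, ← div_eq_inv_mul, one_le_div (by positivity)]
          exact pow_le_pow_right₀ one_le_two h
        · positivity
    _ ≤ _ := by
        rw [avg_mul_const, avg_pow_failures Q _ hm hN hD]
        have hD' : (0 : ℝ) < D := by exact_mod_cast hD
        have h1 : p ≤ ({r ∈ Finset.range D | ¬ Q r}.card : ℝ) / D := by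
          rwa [le_div_iff₀ hD']
        have h2 : ({r ∈ Finset.range D | ¬ Q r}.card : ℝ) / D ≤ 1 := by
          rw [div_le_one hD']
          have := Finset.card_filter_le (Finset.range D) fun r => ¬ Q r
          rw [Finset.card_range] at this
          exact_mod_cast this
        refine mul_le_mul_of_nonneg_right (pow_le_pow_left₀ (by linarith) (by linarith) _)
          (by positivity)

open Classical in
/-- The probability that no entry from `I` is zero. -/
theorem avg_forall_ne_zero_le {N c D : ℕ} {I : Finset ℕ} (hI : I ⊆ Finset.range N)
    (hD : 0 < D) (hm : ∀ i ∈ I, m i + 1 ≤ D) (hc : c * D ≤ 2 * I.card) (ω : ℕ → ℕ) :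
    avg m (fun ω => if ∀ i ∈ I, ω i ≠ 0 then 1 else 0) N 0 ω ≤ Real.exp (-(c / 2)) := by
  have h1 : (fun ω : ℕ → ℕ => if ∀ i ∈ I, ω i ≠ 0 then (1 : ℝ) else 0) =
      fun ω => ∏ i ∈ I, if ω i ≠ 0 then 1 else 0 := by
    funext ω
    rw [Finset.prod_ite_zero]
    simp
  rw [h1, avg_prod (fun _ r => if r ≠ 0 then 1 else 0) hI]
  -- An entry is nonzero with probability 1 − 1/(m i + 1) ≤ exp(−1/D).
  have h2 : ∀ i ∈ I, (∑ r ∈ Finset.range (m i + 1), if r ≠ 0 then (1 : ℝ) else 0)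
      / (m i + 1 : ℕ) ≤ Real.exp (-(1 / D)) := by
    intro i hi
    have h3 : (∑ r ∈ Finset.range (m i + 1), if r ≠ 0 then (1 : ℝ) else 0) = m i := by
      rw [Finset.sum_range_succ']
      simp
    rw [h3]
    have h4 : (0 : ℝ) < (m i + 1 : ℕ) := by positivity
    have h5 : ((m i + 1 : ℕ) : ℝ) ≤ D := by exact_mod_cast hm i hi
    have h6 : (m i : ℝ) / (m i + 1 : ℕ) = 1 - 1 / (m i + 1 : ℕ) := by
      push_cast
      field_simp
      ring
    have h7 : (1 : ℝ) / D ≤ 1 / (m i + 1 : ℕ) := one_div_le_one_div_of_le h4 h5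
    have h8 := Real.add_one_le_exp (-(1 / (D : ℝ)))
    linarith
  calc _ ≤ ∏ _i ∈ I, Real.exp (-(1 / D)) :=
        Finset.prod_le_prod (fun i _ => by positivity) h2
    _ = Real.exp (-(I.card / D)) := by
        rw [Finset.prod_const, ← Real.exp_nat_mul]
        congr 1
        ring
    _ ≤ _ := by
        rw [Real.exp_le_exp, neg_le_neg_iff]
        have hD' : (0 : ℝ) < D := by exact_mod_cast hD
        rw [le_div_iff₀ hD']
        have : (c * D : ℝ) ≤ 2 * I.card := by exact_mod_cast hc
        linarith

open Classical in
/-- The probability that the weights `m i + 1 ≤ n` of the zero entries have a large sum. -/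
theorem avg_sum_gt_le {N n c b : ℕ} (hn : 0 < n) (hN : b + n * c ≤ N)
    (hm : ∀ j < n * c, m (b + j) + 1 ≤ n) (ω : ℕ → ℕ) :
    avg m (fun ω => if 3 * (n * c) <
      ∑ j ∈ Finset.range (n * c), (if ω (b + j) = 0 then m (b + j) + 1 else 0) then 1 else 0)
        N 0 ω ≤ (3 / 8) ^ c := by
  set I := Finset.Ico b (b + n * c) with hIdef
  have hI : I ⊆ Finset.range N := fun i hi => by
    rw [Finset.mem_Ico] at hi
    exact Finset.mem_range.2 (by omega)
  have hn' : (0 : ℝ) < n := by exact_mod_cast hn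
  -- Exponential moment with base 2 of the sum divided by `n`; the division brings every weight
  -- below 1 and turns the threshold 3nc into 8^c.
  set g : ℕ → ℕ → ℝ := fun i r => if r = 0 then (2 : ℝ) ^ (((m i + 1 : ℕ) : ℝ) / n) else 1
  have hg : ∀ ω : ℕ → ℕ, ∏ i ∈ I, g i (ω i) = (2 : ℝ) ^
      ((∑ j ∈ Finset.range (n * c), (if ω (b + j) = 0 then m (b + j) + 1 else 0) : ℕ) / n : ℝ) := by
    intro ω
    rw [hIdef, Finset.prod_Ico_eq_prod_range, Nat.add_sub_cancel_left]
    push_cast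
    rw [Finset.sum_div, Real.rpow_sum_of_pos two_pos]
    refine Finset.prod_congr rfl fun j _ => ?_
    simp only [g]
    split_ifs <;> simp
  calc _ ≤ avg m (fun ω => (∏ i ∈ I, g i (ω i)) * ((8 : ℝ) ^ c)⁻¹) N 0 ω := by
        refine avg_mono (fun ω => ?_) _ _ _
        rw [hg]
        split_ifs with h
        · rw [← div_eq_mul_inv, one_le_div (by positivity)]
          have h8 : (8 : ℝ) ^ c = (2 : ℝ) ^ ((3 * c : ℕ) : ℝ) := by
            rw [Real.rpow_natCast, pow_mul]; norm_num
          rw [h8]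
          refine Real.rpow_le_rpow_of_exponent_le one_le_two ?_
          rw [le_div_iff₀ hn']
          have : ((3 * (n * c) : ℕ) : ℝ) ≤ (∑ j ∈ Finset.range (n * c),
            (if ω (b + j) = 0 then m (b + j) + 1 else 0) : ℕ) := by exact_mod_cast h.le
          refine le_trans (le_of_eq ?_) this
          push_cast
          ring
        · positivity
    _ = (∏ i ∈ I, (∑ r ∈ Finset.range (m i + 1), g i r) / (m i + 1 : ℕ)) * ((8 : ℝ) ^ c)⁻¹ := by
        rw [avg_mul_const, avg_prod g hI]
    _ ≤ (∏ _i ∈ I, Real.exp (1 / n)) * ((8 : ℝ) ^ c)⁻¹ := by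
        refine mul_le_mul_of_nonneg_right (Finset.prod_le_prod ?_ ?_) (by positivity)
        · intro i _
          refine div_nonneg (Finset.sum_nonneg fun r _ => ?_) (Nat.cast_nonneg _)
          simp only [g]
          split_ifs <;> positivity
        · intro i hi
          rw [Finset.mem_Ico] at hi
          have h1 := hm (i - b) (by omega)
          rw [Nat.add_sub_cancel' hi.1] at h1
          have h2 : (((m i + 1 : ℕ) : ℝ)) / n ≤ 1 := by
            rw [div_le_one hn']; exact_mod_cast h1
          -- On [0,1] one has 2^x ≤ 1 + x. The weight m i + 1 occurs with probability 1/(m i + 1),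
          -- so every factor is at most 1 + 1/n whatever `m i` is, and the nc factors together give
          -- e^c.
          have h3 := rpow_one_add_le_one_add_mul_self (s := 1) (by norm_num)
            (p := ((m i + 1 : ℕ) : ℝ) / n) (by positivity) h2
          have h4 : ∑ r ∈ Finset.range (m i + 1), g i r
              = m i + (2 : ℝ) ^ (((m i + 1 : ℕ) : ℝ) / n) := by
            rw [Finset.sum_range_succ']
            simp [g]
          rw [h4]
          norm_num at h3
          have h5 : (0 : ℝ) < m i + 1 := by positivity
          have h6 := Real.add_one_le_exp (1 / (n : ℝ))
          refine le_trans ?_ h6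
          push_cast
          rw [div_le_iff₀ h5]
          have h7 : (1 / (n : ℝ) + 1) * (m i + 1) = ((m i : ℝ) + 1) / n + m i + 1 := by
            field_simp
            ring
          rw [h7]
          linarith
    _ = (Real.exp 1 / 8) ^ c := by
        rw [Finset.prod_const, Nat.card_Ico, Nat.add_sub_cancel_left, ← Real.exp_nat_mul,
          div_pow, ← Real.exp_nat_mul, div_eq_mul_inv]
        congr 2
        push_cast
        field_simp
    _ ≤ _ := by
        refine pow_le_pow_left₀ (by positivity) ?_ _
        have := Real.exp_one_lt_d9
        linarith

end Tape

/-! ### Reasoning about programs -/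

section Logic

variable {n : ℕ} {H : SimpleGraph (Fin n)} {W : ℕ} {A : AdjList H}

theorem runFrom_succ_of_pure {c c' : Config} (h : step W A c = PMF.pure c') (T : ℕ) :
    runFrom W A c (T + 1) = runFrom W A c' T := by
  rw [runFrom, h, PMF.pure_bind]

theorem runFrom_add (c : Config) (a b : ℕ) :
    runFrom W A c (a + b) = (runFrom W A c a).bind fun c' => runFrom W A c' b := by
  induction a generalizing c with
  | zero => simp [runFrom]
  | succ a ih =>
    rw [Nat.add_right_comm, runFrom, runFrom, PMF.bind_bind]
    simp_rw [ih]

/-- Started in `s`, the program `P` runs without random choices for at most `T` steps, makes at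
most `Q` queries, and ends in a store that satisfies `R`. -/
def Exec (W : ℕ) (A : AdjList H) (P : Prog) (s : Store) (T Q : ℕ) (R : Store → Prop) : Prop :=
  ∃ t ≤ T, ∃ q' ≤ Q, ∃ s', R s' ∧
    ∀ K q, runFrom W A ⟨P :: K, s, q⟩ t = PMF.pure ⟨K, s', q + q'⟩

variable {P P₁ P₂ : Prog} {s : Store} {T T₁ T₂ Q Q₁ Q₂ : ℕ} {R : Store → Prop}

theorem Exec.mono {R' : Store → Prop} (h : Exec W A P s T₁ Q₁ R') (hT : T₁ ≤ T) (hQ : Q₁ ≤ Q)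
    (hR : ∀ s', R' s' → R s') : Exec W A P s T Q R := by
  obtain ⟨t, ht, q, hq, s', hs', hrun⟩ := h
  exact ⟨t, ht.trans hT, q, hq.trans hQ, s', hR s' hs', hrun⟩

theorem Exec.of_step {s' : Store} {q' : ℕ} (hs : R s') (hT : 1 ≤ T) (hQ : q' ≤ Q)
    (h : ∀ K q, step W A ⟨P :: K, s, q⟩ = PMF.pure ⟨K, s', q + q'⟩) : Exec W A P s T Q R :=
  ⟨1, hT, q', hQ, s', hs, fun K q => by rw [runFrom_succ_of_pure (h K q)]; rfl⟩

theorem Exec.seq (h : Exec W A P₁ s T₁ Q₁ fun s₁ => Exec W A P₂ s₁ T₂ Q₂ R)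
    (hT : T₁ + T₂ + 1 ≤ T) (hQ : Q₁ + Q₂ ≤ Q) : Exec W A (.seq P₁ P₂) s T Q R := by
  obtain ⟨t, ht, q, hq, s₁, ⟨t', ht', q', hq', s₂, hs₂, h₂⟩, h₁⟩ := h
  refine ⟨t + t' + 1, by omega, q + q', by omega, s₂, hs₂, fun K k => ?_⟩
  rw [runFrom_succ_of_pure (c' := ⟨P₁ :: P₂ :: K, s, k⟩) rfl, runFrom_add, h₁, PMF.pure_bind, h₂,
    add_assoc]

theorem Exec.ite {e : Expr} (h₁ : e.eval W s ≠ 0 → Exec W A P₁ s T₁ Q R)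
    (h₂ : e.eval W s = 0 → Exec W A P₂ s T₁ Q R) (hT : T₁ + 1 ≤ T) :
    Exec W A (.ite e P₁ P₂) s T Q R := by
  by_cases he : e.eval W s = 0
  · obtain ⟨t, ht, q, hq, s', hs', h⟩ := h₂ he
    refine ⟨t + 1, by omega, q, hq, s', hs', fun K k => ?_⟩
    rw [runFrom_succ_of_pure (c' := ⟨P₂ :: K, s, k⟩) (by simp [step, he]), h]
  · obtain ⟨t, ht, q, hq, s', hs', h⟩ := h₁ he
    refine ⟨t + 1, by omega, q, hq, s', hs', fun K k => ?_⟩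
    rw [runFrom_succ_of_pure (c' := ⟨P₁ :: K, s, k⟩) (by simp [step, he]), h]

/-- Loops: `I i t q s` says that after `i` iterations, which took at most `t` steps and `q`
queries, the store is `s`. -/
theorem Exec.loop {e : Expr} (N : ℕ) (I : ℕ → ℕ → ℕ → Store → Prop)
    (hstep : ∀ i < N, ∀ t q s, I i t q s → e.eval W s ≠ 0 ∧
      ∃ T' Q', Exec W A P s T' Q' fun s' => I (i + 1) (t + T' + 1) (q + Q') s')
    (hend : ∀ t q s, I N t q s → e.eval W s = 0 ∧ t + 1 ≤ T ∧ q ≤ Q ∧ R s)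
    (h0 : I 0 0 0 s) : Exec W A (.loop e P) s T Q R := by
  have key : ∀ k i, i + k = N → ∀ t q s, I i t q s → ∃ t', t + t' ≤ T ∧ ∃ q', q + q' ≤ Q ∧
      ∃ s', R s' ∧
        ∀ K j, runFrom W A ⟨.loop e P :: K, s, j⟩ t' = PMF.pure ⟨K, s', j + q'⟩ := by
    intro k
    induction k with
    | zero =>
      intro i hi t q s hI
      rw [add_zero] at hi
      subst hi
      obtain ⟨he, ht, hq, hR⟩ := hend t q s hI
      refine ⟨1, ht, 0, hq, s, hR, fun K j => ?_⟩
      rw [runFrom_succ_of_pure (c' := ⟨K, s, j⟩) (by simp [step, he])]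
      rfl
    | succ k ih =>
      intro i hi t q s hI
      obtain ⟨he, T', Q', t₁, ht₁, q₁, hq₁, s₁, hI₁, h₁⟩ := hstep i (by omega) t q s hI
      obtain ⟨t₂, ht₂, q₂, hq₂, s₂, hR, h₂⟩ := ih (i + 1) (by omega) _ _ s₁ hI₁
      refine ⟨t₁ + t₂ + 1, by omega, q₁ + q₂, by omega, s₂, hR, fun K j => ?_⟩
      rw [runFrom_succ_of_pure (c' := ⟨P :: .loop e P :: K, s, j⟩) (by simp [step, he]),
        runFrom_add, h₁, PMF.pure_bind, h₂, add_assoc]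
  obtain ⟨t, ht, q, hq, s', hs', h⟩ := key N 0 (by omega) 0 0 s h0
  exact ⟨t, by omega, q, by omega, s', hs', h⟩

/-- Loops whose iterations all have the same cost bounds. -/
theorem Exec.for {e : Expr} (N T₀ Q₀ : ℕ) (I : ℕ → Store → Prop)
    (hstep : ∀ i < N, ∀ s, I i s → e.eval W s ≠ 0 ∧ Exec W A P s T₀ Q₀ (I (i + 1)))
    (hend : ∀ s, I N s → e.eval W s = 0 ∧ R s) (h0 : I 0 s)
    (hT : N * (T₀ + 1) + 1 ≤ T) (hQ : N * Q₀ ≤ Q) : Exec W A (.loop e P) s T Q R := by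
  refine Exec.loop N (fun i t q s => t = i * (T₀ + 1) ∧ q = i * Q₀ ∧ I i s) ?_ ?_ ?_
  · rintro i hi t q s ⟨rfl, rfl, h⟩
    obtain ⟨h1, h2⟩ := hstep i hi s h
    exact ⟨h1, T₀, Q₀, h2.mono le_rfl le_rfl fun s' h' => ⟨by ring, by ring, h'⟩⟩
  · rintro t q s ⟨rfl, rfl, h⟩
    exact ⟨(hend s h).1, hT, hQ, (hend s h).2⟩
  · exact ⟨by simp, by simp, h0⟩

/-! ### Loop-free deterministic programs -/

/-- The program has no loops and makes no random choices. -/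
def Prog.simple : Prog → Bool
  | .seq p q => p.simple && q.simple
  | .ite _ p q => p.simple && q.simple
  | .rand _ _ => false
  | .loop _ _ => false
  | _ => true

/-- The effect of a simple program. -/
def Prog.den (W : ℕ) (A : AdjList H) : Prog → Store → Store
  | .skip, s => s
  | .set x e, s => s.setReg W x (e.eval W s)
  | .put a i e, s => s.setArr W a (i.eval W s) (e.eval W s)
  | .deg x v, s => s.setReg W x (A.degAnswer (v.eval W s))
  | .nbr x v i, s => s.setReg W x (A.nbrAnswer (v.eval W s) (i.eval W s))
  | .rand _ _, s => s
  | .seq p q, s => q.den W A (p.den W A s)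
  | .ite e p q, s => if e.eval W s ≠ 0 then p.den W A s else q.den W A s
  | .loop _ _, s => s

/-- A bound for the number of steps of a simple program. -/
def Prog.time : Prog → ℕ
  | .seq p q => p.time + q.time + 1
  | .ite _ p q => max p.time q.time + 1
  | _ => 1

/-- A bound for the number of queries of a simple program. -/
def Prog.asks : Prog → ℕ
  | .seq p q => p.asks + q.asks
  | .ite _ p q => max p.asks q.asks
  | .deg _ _ => 1
  | .nbr _ _ _ => 1
  | _ => 0

theorem Exec.simple (hP : P.simple = true) (hR : R (P.den W A s)) (hT : P.time ≤ T)
    (hQ : P.asks ≤ Q) : Exec W A P s T Q R := by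
  induction P generalizing s T Q R with
  | skip => exact Exec.of_step hR hT hQ fun K q => rfl
  | set x e => exact Exec.of_step hR hT hQ fun K q => rfl
  | put a i e => exact Exec.of_step hR hT hQ fun K q => rfl
  | deg x v => exact Exec.of_step hR hT hQ fun K q => rfl
  | nbr x v i => exact Exec.of_step hR hT hQ fun K q => rfl
  | rand x m => simp [Prog.simple] at hP
  | seq p q ihp ihq =>
    simp only [Prog.simple, Bool.and_eq_true] at hP
    exact Exec.seq (ihp hP.1 (ihq hP.2 hR le_rfl le_rfl) le_rfl le_rfl) hT hQ
  | ite e p q ihp ihq =>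
    simp only [Prog.simple, Bool.and_eq_true] at hP
    simp only [Prog.time, Prog.asks] at hT hQ
    refine Exec.ite (T₁ := max p.time q.time) (fun he => ?_) (fun he => ?_) hT
    · refine ihp hP.1 ?_ (le_max_left _ _) (by omega)
      simpa [Prog.den, he] using hR
    · refine ihq hP.2 ?_ (le_max_right _ _) (by omega)
      simpa [Prog.den, he] using hR
  | loop e p => simp [Prog.simple] at hP

/-! ### Frame conditions and evaluation of expressions -/

/-- `s'` differs from `s` at most in the registers `rs` and the arrays `as`. -/
def Store.Same (rs as : List ℕ) (s s' : Store) : Prop :=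
  (∀ x, x ∉ rs → s'.reg x = s.reg x) ∧ ∀ a, a ∉ as → s'.arr a = s.arr a

theorem Store.Same.refl (rs as : List ℕ) (s : Store) : Store.Same rs as s s :=
  ⟨fun _ _ => rfl, fun _ _ => rfl⟩

theorem Store.Same.trans {rs as : List ℕ} {s s' s'' : Store} (h : Store.Same rs as s s')
    (h' : Store.Same rs as s' s'') : Store.Same rs as s s'' :=
  ⟨fun x hx => (h'.1 x hx).trans (h.1 x hx), fun a ha => (h'.2 a ha).trans (h.2 a ha)⟩

theorem Store.Same.mono {rs as rs' as' : List ℕ} {s s' : Store} (h : Store.Same rs as s s')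
    (hr : ∀ x ∈ rs, x ∈ rs') (ha : ∀ x ∈ as, x ∈ as') : Store.Same rs' as' s s' :=
  ⟨fun x hx => h.1 x fun h' => hx (hr x h'), fun a hx => h.2 a fun h' => hx (ha a h')⟩

theorem Store.Same.setReg {rs as : List ℕ} {s s' : Store} (h : Store.Same rs as s s') (W : ℕ)
    {x : ℕ} (v : ℕ) (hx : x ∈ rs := by decide) : Store.Same rs as s (s'.setReg W x v) :=
  ⟨fun y hy => by
    rw [← h.1 y hy]
    exact Function.update_of_ne (fun e => hy (by rwa [e])) _ _, h.2⟩

theorem Store.Same.setArr {rs as : List ℕ} {s s' : Store} (h : Store.Same rs as s s') (W : ℕ)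
    {a : ℕ} (i v : ℕ) (ha : a ∈ as := by decide) : Store.Same rs as s (s'.setArr W a i v) :=
  ⟨h.1, fun y hy => by
    rw [← h.2 y hy]
    exact Function.update_of_ne (fun e => hy (by rwa [e])) _ _⟩

theorem Store.setReg_reg_self (W : ℕ) (s : Store) (x : ℕ) {v : ℕ} (hv : v < W) :
    (s.setReg W x v).reg x = v := by
  simp [Store.setReg, Nat.mod_eq_of_lt hv]

theorem Store.setReg_reg_of_ne (W : ℕ) (s : Store) (v : ℕ) {x y : ℕ} (h : y ≠ x := by decide) :
    (s.setReg W x v).reg y = s.reg y := by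
  simp [Store.setReg, h]

@[simp]
theorem Store.setReg_arr (W : ℕ) (s : Store) (x v : ℕ) : (s.setReg W x v).arr = s.arr := rfl

theorem Store.setArr_arr_self (W : ℕ) (s : Store) (a i : ℕ) {v : ℕ} (hv : v < W) :
    (s.setArr W a i v).arr a = Function.update (s.arr a) i v := by
  simp [Store.setArr, Nat.mod_eq_of_lt hv]

theorem Store.setArr_arr_of_ne (W : ℕ) (s : Store) (i v : ℕ) {a c : ℕ}
    (h : c ≠ a := by decide) : (s.setArr W a i v).arr c = s.arr c := by
  simp [Store.setArr, h]

theorem Expr.eval_reg {x v : ℕ} (h : s.reg x = v) : (Expr.reg x).eval W s = v := h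

theorem Expr.eval_lit {c : ℕ} (h : c < W) : (Expr.lit c).eval W s = c := Nat.mod_eq_of_lt h

theorem Expr.eval_add {e₁ e₂ : Expr} {a b : ℕ} (h₁ : e₁.eval W s = a) (h₂ : e₂.eval W s = b)
    (h : a + b < W) : (Expr.bin .add e₁ e₂).eval W s = a + b := by
  subst h₁ h₂
  exact Nat.mod_eq_of_lt h

theorem Expr.eval_sub {e₁ e₂ : Expr} {a b : ℕ} (h₁ : e₁.eval W s = a) (h₂ : e₂.eval W s = b)
    (h : a < W) : (Expr.bin .sub e₁ e₂).eval W s = a - b := by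
  subst h₁ h₂
  exact Nat.mod_eq_of_lt (lt_of_le_of_lt (Nat.sub_le _ _) h)

theorem Expr.eval_mul {e₁ e₂ : Expr} {a b : ℕ} (h₁ : e₁.eval W s = a) (h₂ : e₂.eval W s = b)
    (h : a * b < W) : (Expr.bin .mul e₁ e₂).eval W s = a * b := by
  subst h₁ h₂
  exact Nat.mod_eq_of_lt h

theorem Expr.eval_div {e₁ e₂ : Expr} {a b : ℕ} (h₁ : e₁.eval W s = a) (h₂ : e₂.eval W s = b)
    (h : a < W) : (Expr.bin .div e₁ e₂).eval W s = a / b := by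
  subst h₁ h₂
  exact Nat.mod_eq_of_lt (lt_of_le_of_lt (Nat.div_le_self _ _) h)

theorem Expr.eval_mod {e₁ e₂ : Expr} {a b : ℕ} (h₁ : e₁.eval W s = a) (h₂ : e₂.eval W s = b)
    (h : a < W) : (Expr.bin .mod e₁ e₂).eval W s = a % b := by
  subst h₁ h₂
  exact Nat.mod_eq_of_lt (lt_of_le_of_lt (Nat.mod_le _ _) h)

theorem Expr.eval_lt {e₁ e₂ : Expr} {a b : ℕ} (h₁ : e₁.eval W s = a) (h₂ : e₂.eval W s = b)
    (hW : 1 < W) : (Expr.bin .lt e₁ e₂).eval W s = if a < b then 1 else 0 := by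
  subst h₁ h₂
  refine Nat.mod_eq_of_lt ?_
  split_ifs <;> omega

theorem Expr.lt_ne_zero {e₁ e₂ : Expr} {a b : ℕ} (h₁ : e₁.eval W s = a) (h₂ : e₂.eval W s = b)
    (hW : 1 < W) (h : a < b) : (Expr.bin .lt e₁ e₂).eval W s ≠ 0 := by
  rw [Expr.eval_lt h₁ h₂ hW, if_pos h]
  exact one_ne_zero

theorem Expr.lt_eq_zero {e₁ e₂ : Expr} {a b : ℕ} (h₁ : e₁.eval W s = a) (h₂ : e₂.eval W s = b)
    (hW : 1 < W) (h : b ≤ a) : (Expr.bin .lt e₁ e₂).eval W s = 0 := by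
  rw [Expr.eval_lt h₁ h₂ hW, if_neg (Nat.not_lt.2 h)]

theorem Expr.eval_eq {e₁ e₂ : Expr} {a b : ℕ} (h₁ : e₁.eval W s = a) (h₂ : e₂.eval W s = b)
    (hW : 1 < W) : (Expr.bin .eq e₁ e₂).eval W s = if a = b then 1 else 0 := by
  subst h₁ h₂
  refine Nat.mod_eq_of_lt ?_
  split_ifs <;> omega

theorem Expr.eval_get {e : Expr} {a i : ℕ} (h : e.eval W s = i) :
    (Expr.get a e).eval W s = s.arr a i := by
  subst h
  rfl

/-- Products of truth values. -/
theorem Expr.eval_and {e₁ e₂ : Expr} {p₁ p₂ : Prop} [Decidable p₁] [Decidable p₂]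
    (h₁ : e₁.eval W s = if p₁ then 1 else 0)
    (h₂ : e₂.eval W s = if p₂ then 1 else 0) (hW : 1 < W) :
    (Expr.bin .mul e₁ e₂).eval W s = if p₁ ∧ p₂ then 1 else 0 := by
  rw [Expr.eval_mul h₁ h₂ (by split_ifs <;> omega)]
  by_cases p₁ <;> by_cases p₂ <;> simp [*]

theorem Exec.skip (hR : R s) (hT : 1 ≤ T) : Exec W A .skip s T Q R :=
  Exec.simple rfl hR hT (Nat.zero_le _)

theorem Exec.set {x v : ℕ} {e : Expr} (he : e.eval W s = v) (hR : R (s.setReg W x v))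
    (hT : 1 ≤ T) : Exec W A (.set x e) s T Q R := by
  subst he
  exact Exec.simple rfl hR hT (Nat.zero_le _)

theorem Exec.put {a i v : ℕ} {e e' : Expr} (hi : e.eval W s = i) (he : e'.eval W s = v)
    (hR : R (s.setArr W a i v)) (hT : 1 ≤ T) : Exec W A (.put a e e') s T Q R := by
  subst he hi
  exact Exec.simple rfl hR hT (Nat.zero_le _)

/-! ### Halting and failure probability of random runs -/

/-- From `c` on, every run halts within `B` steps with at most `Q` queries altogether, and with
probability at most `p` it ends in a store outside `S`. -/
def Halts (W : ℕ) (A : AdjList H) (S : Set Store) (Q : ℕ) (c : Config) (B : ℕ) (p : ℝ) : Prop :=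
  ∀ T ≥ B, (∀ c' ∈ (runFrom W A c T).support, c'.Halted ∧ c'.queries ≤ Q) ∧
    (runFrom W A c T).toOuterMeasure {c' | c'.store ∉ S} ≤ ENNReal.ofReal p

variable {S : Set Store} {B : ℕ} {p : ℝ} {K : List Prog} {q : ℕ}

/-- At the end the bound `p` plays the role of an indicator: it has to be at least 1 only if the
final store has failed. -/
theorem Halts.nil (hq : q ≤ Q) (hp : s ∉ S → 1 ≤ p) : Halts W A S Q ⟨[], s, q⟩ B p := by
  intro T _
  clear! B
  have h1 : runFrom W A ⟨[], s, q⟩ T = PMF.pure ⟨[], s, q⟩ := by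
    induction T with
    | zero => rfl
    | succ T ih => rw [runFrom_succ_of_pure (c' := ⟨[], s, q⟩) rfl]; exact ih
  rw [h1]
  refine ⟨fun c' hc' => ?_, ?_⟩
  · rw [PMF.mem_support_pure_iff] at hc'
    subst hc'
    exact ⟨rfl, hq⟩
  · rw [PMF.toOuterMeasure_pure_apply]
    split_ifs with h
    · rw [← ENNReal.ofReal_one]
      exact ENNReal.ofReal_le_ofReal (hp h)
    · exact zero_le

theorem Halts.of_pure {c c' : Config} {t : ℕ} (h : runFrom W A c t = PMF.pure c')
    (h' : Halts W A S Q c' B p) {B' : ℕ} (hB : B + t ≤ B') : Halts W A S Q c B' p := by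
  intro T hT
  have h1 : runFrom W A c T = runFrom W A c' (T - t) := by
    rw [show T = t + (T - t) by omega, runFrom_add, h, PMF.pure_bind]
    simp
  rw [h1]
  exact h' _ (by omega)

theorem Halts.exec {B' : ℕ} (h : Exec W A P s T Q₁ R)
    (h' : ∀ s' q', R s' → q' ≤ q + Q₁ → Halts W A S Q ⟨K, s', q'⟩ B p) (hB : B + T ≤ B') :
    Halts W A S Q ⟨P :: K, s, q⟩ B' p := by
  obtain ⟨t, ht, q', hq', s', hs', hrun⟩ := h
  exact Halts.of_pure (hrun K q) (h' s' _ hs' (by omega)) (by omega)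

theorem Halts.seq (h : Halts W A S Q ⟨P₁ :: P₂ :: K, s, q⟩ B p) :
    Halts W A S Q ⟨.seq P₁ P₂ :: K, s, q⟩ (B + 1) p :=
  Halts.of_pure (t := 1) (by rw [runFrom_succ_of_pure (c' := ⟨P₁ :: P₂ :: K, s, q⟩) rfl]; rfl) h
    le_rfl

/-- Conditioning on the drawn number replaces the bounds `f r` by their mean, which is one layer of
`avg`. -/
theorem Halts.rand {x : ℕ} {e : Expr} {M : ℕ} {f : ℕ → ℝ} (he : e.eval W s = M)
    (hf : ∀ r, 0 ≤ f r)
    (h : ∀ r ≤ M, Halts W A S Q ⟨K, s.setReg W x r, q⟩ B (f r)) :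
    Halts W A S Q ⟨.rand x e :: K, s, q⟩ (B + 1)
      ((∑ r ∈ Finset.range (M + 1), f r) / (M + 1 : ℕ)) := by
  subst he
  intro T hT
  obtain ⟨T, rfl⟩ : ∃ T', T = T' + 1 := ⟨T - 1, by omega⟩
  have h1 : runFrom W A ⟨.rand x e :: K, s, q⟩ (T + 1) =
      (PMF.uniformOfFintype (Fin (e.eval W s + 1))).bind fun r =>
        runFrom W A ⟨K, s.setReg W x r, q⟩ T := by
    rw [runFrom, step, PMF.bind_map]
    exact (PMF.bind_bind _ _ _).trans (congrArg _ (funext fun r => PMF.pure_bind _ _))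
  rw [h1]
  have h2 : ∀ r : Fin (e.eval W s + 1), _ := fun r => h r (by omega) T (by omega)
  refine ⟨fun c' hc' => ?_, ?_⟩
  · rw [PMF.mem_support_bind_iff] at hc'
    obtain ⟨r, -, hr⟩ := hc'
    exact (h2 r).1 c' hr
  · rw [PMF.toOuterMeasure_bind_apply, tsum_fintype, ← Fin.sum_univ_eq_sum_range,
      Finset.sum_div,
      ENNReal.ofReal_sum_of_nonneg fun r _ => div_nonneg (hf _) (Nat.cast_nonneg _)]
    refine Finset.sum_le_sum fun r _ => ?_
    rw [PMF.uniformOfFintype_apply, Fintype.card_fin, div_eq_inv_mul,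
      ENNReal.ofReal_mul (by positivity), ENNReal.ofReal_inv_of_pos (by positivity),
      ENNReal.ofReal_natCast]
    exact mul_le_mul_right (h2 r).2 _

/-- A loop that fills a tape with random numbers. -/
theorem Halts.rand_loop {x : ℕ} {e e' : Expr} {N : ℕ} {m : ℕ → ℕ} {φ : (ℕ → ℕ) → ℝ}
    (hφ : ∀ ω, 0 ≤ φ ω) (I : ℕ → (ℕ → ℕ) → Store → Prop)
    (hstep : ∀ j < N, ∀ ω s, I j ω s → e.eval W s ≠ 0 ∧ e'.eval W s = m j ∧
      ∀ r ≤ m j, Exec W A P (s.setReg W x r) T 0 (I (j + 1) (Function.update ω j r)))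
    (hend : ∀ ω s, I N ω s → e.eval W s = 0 ∧ ∀ q' ≤ q, Halts W A S Q ⟨K, s, q'⟩ B (φ ω))
    (k j : ℕ) (hj : j + k = N) (ω : ℕ → ℕ) (s : Store) (hI : I j ω s) (q' : ℕ) (hq : q' ≤ q) :
    Halts W A S Q ⟨.loop e (.seq (.rand x e') P) :: K, s, q'⟩ (B + 1 + k * (T + 3))
      (avg m φ k j ω) := by
  induction k generalizing j ω s q' with
  | zero =>
    rw [add_zero] at hj
    subst hj
    obtain ⟨he, h⟩ := hend ω s hI
    refine Halts.of_pure (t := 1) (c' := ⟨K, s, q'⟩) ?_ (h q' hq) (by omega)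
    rw [runFrom_succ_of_pure (c' := ⟨K, s, q'⟩) (by simp [step, he])]
    rfl
  | succ k ih =>
    obtain ⟨he, hm, hr⟩ := hstep j (by omega) ω s hI
    -- Each draw costs the loop test, the unfolding of `seq` and the draw itself, on top of the `T`
    -- steps of the body.
    refine Halts.of_pure (t := 1) (B := B + 1 + k * (T + 3) + T + 1 + 1)
      (c' := ⟨.seq (.rand x e') P :: .loop e (.seq (.rand x e') P) :: K, s, q'⟩) ?_
      (Halts.seq (Halts.rand hm (fun r => avg_nonneg hφ _ _ _) (fun r hrm => ?_))) ?_
    · rw [runFrom_succ_of_pure (c' := ⟨.seq (.rand x e') P ::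
        .loop e (.seq (.rand x e') P) :: K, s, q'⟩) (by simp [step, he])]
      rfl
    · exact Halts.exec (hr r hrm) (fun s' q₁ hs' hq₁ =>
        ih (j + 1) (by omega) _ s' hs' q₁ (by omega)) le_rfl
    · have : (k + 1) * (T + 3) = k * (T + 3) + (T + 3) := by ring
      omega

end Logic

/-! ### The program

Registers: `0` the number `n` of vertices, `1` the threshold `b`, `2` the number `L = 20 b` of
samples per vertex, `3` the product `n L`, `4` outer loop index, `5` budget for reading lists of
centers, `6` current center, `7`, `8` inner loop indices, `9` number of failures, `10` number of
strictly close vertices, `11` current vertex, `12` current tag.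

Arrays: `0` output, `1` sizes of closed neighborhoods, `2` random numbers, `3` samples,
`4` marks for the neighborhood of the current center, `5` tags, `6` numbers of failures. -/

section Program

/-- `fetch` puts entry `reg 7` of the closed neighborhood of `reg 6` into register `11`. -/
def fetch : Prog :=
  .seq (.nbr 11 (.reg 6) (.reg 7))
    (.ite (.bin .eq (.bin .add (.reg 7) (.lit 1)) (.get 1 (.reg 6))) (.set 11 (.reg 6)) .skip)

/-- Count the samples of the vertex `reg 11` whose entry in the array `a` is not `reg 12`. -/
def countLoop (a : ℕ) : Prog :=
  .seq (.set 9 (.lit 0)) <| .seq (.set 8 (.lit 0)) <|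
    .loop (.bin .lt (.reg 8) (.reg 2)) <|
      .seq
        (.ite (.bin .eq (.get a (.get 3 (.bin .add (.bin .mul (.reg 11) (.reg 2)) (.reg 8))))
          (.reg 12)) .skip (.set 9 (.bin .add (.reg 9) (.lit 1))))
        (.set 8 (.bin .add (.reg 8) (.lit 1)))

/-- Run through the closed neighborhood of `reg 6`. -/
def forNbrs (p : Prog) : Prog :=
  .seq (.set 7 (.lit 0)) <|
    .loop (.bin .lt (.reg 7) (.get 1 (.reg 6))) <|
      .seq fetch <| .seq p <| .set 7 (.bin .add (.reg 7) (.lit 1))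

/-- The test that `reg 11` is untagged, that the number of failures is at most `e` and that
`10` times the size of `reg 6` is at most `c` times the size of `reg 11`. -/
def closeTest (f e : Expr) (c : ℕ) : Expr :=
  .bin .mul (.bin .eq (.get 5 (.reg 11)) (.lit 0))
    (.bin .mul (.bin .lt f (.bin .add e (.lit 1)))
      (.bin .lt (.bin .mul (.lit 10) (.get 1 (.reg 6)))
        (.bin .add (.bin .mul (.lit c) (.get 1 (.reg 11))) (.lit 1))))

/-- Mark the closed neighborhood of the center. -/
def markPass : Prog := forNbrs (.put 4 (.reg 11) (.reg 12))

/-- Count the untagged strictly close vertices of the closed neighborhood of the center. -/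
def countPass : Prog :=
  .seq (.set 10 (.lit 0)) <| forNbrs <|
    .seq (countLoop 4) <| .seq (.put 6 (.reg 11) (.reg 9)) <|
      .ite (closeTest (.get 6 (.reg 11)) (.reg 1) 11) (.set 10 (.bin .add (.reg 10) (.lit 1))) .skip

/-- Tag the untagged loosely close vertices of the closed neighborhood of the center. -/
def tagPass : Prog :=
  forNbrs <| .ite (closeTest (.get 6 (.reg 11)) (.bin .mul (.lit 5) (.reg 1)) 12)
    (.put 5 (.reg 11) (.reg 12)) .skip

/-- Process the center `reg 6`. -/
def processCenter : Prog :=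
  .seq (.set 12 (.bin .add (.reg 0) (.reg 6))) <| .seq markPass <| .seq countPass <|
    .ite (.bin .lt (.bin .mul (.lit 10) (.reg 10)) (.bin .mul (.lit 9) (.get 1 (.reg 6))))
      .skip tagPass

end Program

/-! ### The functional description of the algorithm -/

section Model

variable {n : ℕ} {H : SimpleGraph (Fin n)}

/-- The size of the closed neighborhood. -/
def AdjList.size (A : AdjList H) (v : ℕ) : ℕ := A.degAnswer v + 1

/-- The entries of the closed neighborhood; the vertex itself is the last one. -/
def AdjList.entry (A : AdjList H) (v i : ℕ) : ℕ :=
  if i + 1 = A.size v then v else A.nbrAnswer v i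

/-- `x` is in the closed neighborhood of `w`. -/
def AdjList.near (A : AdjList H) (w x : ℕ) : Prop := ∃ i < A.size w, A.entry w i = x

theorem AdjList.size_le (A : AdjList H) {v : ℕ} (hv : v < n) : A.size v ≤ n := by
  have h1 : ((A.nbrs ⟨v, hv⟩).length) < n := by
    have h2 : (⟨v, hv⟩ :: A.nbrs ⟨v, hv⟩).Nodup := by
      rw [List.nodup_cons]
      refine ⟨fun h => ?_, A.nodup _⟩
      exact H.loopless.irrefl _ ((A.mem_nbrs _ _).1 h)
    have h3 := h2.length_le_card
    rw [Fintype.card_fin, List.length_cons] at h3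
    exact h3
  simp only [AdjList.size, AdjList.degAnswer, hv, dif_pos]
  exact h1

theorem AdjList.entry_lt (A : AdjList H) {v : ℕ} (hv : v < n) (i : ℕ) : A.entry v i < n := by
  unfold AdjList.entry AdjList.nbrAnswer
  split_ifs with h
  · exact hv
  · rw [List.getD_eq_getElem?_getD]
    rcases h2 : ((A.nbrs ⟨v, hv⟩).map Fin.val)[i]? with _ | a
    · simpa using by omega
    · have := List.mem_of_getElem? h2
      rw [List.mem_map] at this
      obtain ⟨y, -, rfl⟩ := this
      simp

theorem AdjList.near_lt (A : AdjList H) {w x : ℕ} (hw : w < n) (h : A.near w x) : x < n := by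
  obtain ⟨i, -, rfl⟩ := h
  exact A.entry_lt hw i

theorem AdjList.entry_inj (A : AdjList H) {v i j : ℕ} (hv : v < n) (hi : i < A.size v)
    (hj : j < A.size v) (h : A.entry v i = A.entry v j) : i = j := by
  have hl : A.size v = (A.nbrs ⟨v, hv⟩).length + 1 := by
    simp only [AdjList.size, AdjList.degAnswer, hv, dif_pos]
  have e : ∀ i, i < (A.nbrs ⟨v, hv⟩).length → ∃ h : i < (A.nbrs ⟨v, hv⟩).length,
      A.entry v i = ((A.nbrs ⟨v, hv⟩)[i] : ℕ) := by
    intro i h'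
    refine ⟨h', ?_⟩
    have h1 : ¬ i + 1 = A.size v := by omega
    simp only [AdjList.entry, h1, if_false, AdjList.nbrAnswer, hv, dif_pos]
    rw [List.getD_eq_getElem _ _ (by simpa using h')]
    simp
  have hne : ∀ i (h' : i < (A.nbrs ⟨v, hv⟩).length), ((A.nbrs ⟨v, hv⟩)[i] : ℕ) ≠ v := by
    intro i h' heq
    have h1 : (A.nbrs ⟨v, hv⟩)[i] ∈ A.nbrs ⟨v, hv⟩ := List.getElem_mem h'
    have h2 : (A.nbrs ⟨v, hv⟩)[i] = ⟨v, hv⟩ := Fin.ext heq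
    rw [h2] at h1
    exact H.loopless.irrefl _ ((A.mem_nbrs _ _).1 h1)
  have hlast : ∀ i, i + 1 = A.size v → A.entry v i = v := fun i h => by
    simp [AdjList.entry, h]
  by_cases h1 : i + 1 = A.size v
  · by_cases h2 : j + 1 = A.size v
    · omega
    · obtain ⟨h3, h4⟩ := e j (by omega)
      rw [hlast i h1, h4] at h
      exact absurd h.symm (hne j h3)
  · obtain ⟨h3, h4⟩ := e i (by omega)
    by_cases h2 : j + 1 = A.size v
    · rw [hlast j h2, h4] at h
      exact absurd h (hne i h3)
    · obtain ⟨h5, h6⟩ := e j (by omega)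
      rw [h4, h6] at h
      exact (A.nodup _).getElem_inj_iff.1 (Fin.ext h)

variable (A : AdjList H) (b L : ℕ) (ω : ℕ → ℕ)

/-- The number of samples of `u` outside the closed neighborhood of `w`. -/
def missCount (w u : ℕ) : ℕ := failures (fun r => A.near w (A.entry u r)) (u * L) L ω

/-- The samples suggest that the neighborhood of `u` is nearly contained in that of `w`. -/
def Strict (u w : ℕ) : Prop := missCount A L ω w u ≤ b ∧ 10 * A.size w ≤ 11 * A.size u

/-- The samples suggest that the neighborhood of `u` is roughly contained in that of `w`. -/
def Loose (u w : ℕ) : Prop := missCount A L ω w u ≤ 5 * b ∧ 10 * A.size w ≤ 12 * A.size u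

open Classical in
/-- The number of untagged strictly close vertices in the closed neighborhood of `w`. -/
def strictCount (tag : ℕ → ℕ) (w k : ℕ) : ℕ :=
  {i ∈ Finset.range k | tag (A.entry w i) = 0 ∧ Strict A b L ω (A.entry w i) w}.card

open Classical in
/-- The tags after the center `w` has been processed. -/
def tagStep (tag : ℕ → ℕ) (w : ℕ) : ℕ → ℕ :=
  if 9 * A.size w ≤ 10 * strictCount A b L ω tag w (A.size w) then
    -- The tag `n + w` is nonzero, so 0 can mean untagged, and it is not a vertex number, so it
    -- cannot collide with the initial name of a singleton cluster.
    fun x => if A.near w x ∧ tag x = 0 ∧ Loose A b L ω x w then n + w else tag x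
  else tag

/-- The tags and the remaining budget after the first `j` possible centers. -/
def tagRun : ℕ → (ℕ → ℕ) × ℕ
  -- Index `j` is one of the L trials of the vertex `j / L`. A trial succeeds with probability one
  -- over the size of the closed neighborhood, so the total size of the centers has expectation nL,
  -- a third of the budget.
  | 0 => (fun _ => 0, 3 * (n * L))
  | j + 1 =>
    if ω (n * L + j) = 0 ∧ A.size (j / L) ≤ (tagRun j).2 then
      (tagStep A b L ω (tagRun j).1 (j / L), (tagRun j).2 - A.size (j / L))
    else tagRun j

/-- The final tags. -/
def finalTag : ℕ → ℕ := (tagRun A b L ω (n * L)).1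

open Classical in
/-- The vertex `v` joins the cluster with tag `c`. -/
def Joins (v c : ℕ) : Prop :=
  c ≠ 0 ∧ failures (fun r => finalTag A b L ω (A.entry v r) = c) (v * L) L ω ≤ 5 * b ∧
    10 * A.size (c - n) ≤ 12 * A.size v

/-- The specification of the output. -/
def OutputSpec (out : ℕ → ℕ) : Prop :=
  ∀ v < n, (out v = v ∧ ∀ c, ¬ Joins A b L ω v c) ∨ Joins A b L ω v (out v)

end Model

/-! ### Verification of the subprograms -/

section Verify

variable {n : ℕ} {H : SimpleGraph (Fin n)} {W : ℕ} {A : AdjList H} {b L : ℕ} {ω : ℕ → ℕ}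

/-- The numbers in use and the word bound. -/
structure Params (n b L W : ℕ) : Prop where
  two_le : 2 ≤ n
  one_le : 1 ≤ b
  hL : L = 20 * b
  hW : 100 * (n * L) < W

theorem Params.L_le (hp : Params n b L W) : L ≤ n * L :=
  Nat.le_mul_of_pos_left _ (by have := hp.two_le; omega)

theorem Params.n_le (hp : Params n b L W) : 20 * n ≤ n * L := by
  have := hp.one_le
  rw [hp.hL, mul_comm]
  exact Nat.mul_le_mul_left _ (by omega)

theorem mul_add_le {n x : ℕ} (L : ℕ) (hx : x < n) : x * L + L ≤ n * L := by
  rw [← Nat.succ_mul]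
  exact Nat.mul_le_mul_right _ hx

theorem Params.L_pos (hp : Params n b L W) : 0 < L := by
  have := hp.one_le
  rw [hp.hL]; omega

/-- The global values in the store. -/
structure Ctx (A : AdjList H) (b L : ℕ) (s : Store) : Prop where
  r0 : s.reg 0 = n
  r1 : s.reg 1 = b
  r2 : s.reg 2 = L
  r3 : s.reg 3 = n * L
  d : ∀ v < n, s.arr 1 v = A.size v

theorem Ctx.same {s s' : Store} {rs as : List ℕ} (h : Ctx A b L s) (hs : Store.Same rs as s s')
    (h0 : 0 ∉ rs := by decide) (h1 : 1 ∉ rs := by decide) (h2 : 2 ∉ rs := by decide)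
    (h3 : 3 ∉ rs := by decide) (ha : 1 ∉ as := by decide) : Ctx A b L s' :=
  ⟨(hs.1 0 h0).trans h.r0, (hs.1 1 h1).trans h.r1, (hs.1 2 h2).trans h.r2,
    (hs.1 3 h3).trans h.r3, fun v hv => by rw [hs.2 1 ha]; exact h.d v hv⟩

theorem fetch_den (hp : Params n b L W) {s : Store} (hc : Ctx A b L s) (hw : s.reg 6 < n)
    (hi : s.reg 7 < n) :
    fetch.den W A s = s.setReg W 11 (A.entry (s.reg 6) (s.reg 7)) := by
  have h1 := hp.n_le
  have h2 := hp.hW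
  have h3 := hc.d _ hw
  have e := Expr.eval_eq (W := W) (s := s.setReg W 11 (A.nbrAnswer (s.reg 6) (s.reg 7)))
    (Expr.eval_add (e₁ := .reg 7) (e₂ := .lit 1) (a := s.reg 7)
      (Store.setReg_reg_of_ne _ _ _) (Expr.eval_lit (by omega)) (by omega))
    (Expr.eval_get (a := 1) (e := .reg 6) (Store.setReg_reg_of_ne _ _ _)) (by omega)
  rw [Store.setReg_arr, h3] at e
  simp only [fetch, Prog.den, AdjList.entry]
  split_ifs <;> simp_all [Expr.eval, Store.setReg]

theorem countLoop_exec (hp : Params n b L W) (a : ℕ) {s : Store} (hc : Ctx A b L s)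
    (hx : s.reg 11 < n) :
    Exec W A (countLoop a) s (5 * L + 5) 0 fun s' => Store.Same [8, 9] [] s s' ∧
      s'.reg 9 = {t ∈ Finset.range L | ¬ s.arr a (s.arr 3 (s.reg 11 * L + t)) = s.reg 12}.card := by
  have h1 := hp.L_le
  have h2 := hp.hW
  have h3 := mul_add_le L hx
  have h4 := hp.L_pos
  set P : ℕ → Prop := fun t => ¬ s.arr a (s.arr 3 (s.reg 11 * L + t)) = s.reg 12 with hP
  refine Exec.seq (T₁ := 1) (T₂ := 5 * L + 3) (Q₁ := 0) (Q₂ := 0)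
    (Exec.set (Expr.eval_lit (by omega)) ?_ le_rfl) (by omega) (by omega)
  refine Exec.seq (T₁ := 1) (T₂ := 5 * L + 1) (Q₁ := 0) (Q₂ := 0)
    (Exec.set (Expr.eval_lit (by omega)) ?_ le_rfl) (by omega) (by omega)
  refine Exec.for L 4 0 (fun i s' => Store.Same [8, 9] [] s s' ∧ s'.reg 8 = i ∧
    s'.reg 9 = {t ∈ Finset.range i | P t}.card) ?_ ?_ ?_ (by omega) (by omega)
  · rintro i hi s' ⟨hs, h8, h9⟩
    have hc' := hc.same hs
    have ea : s'.arr = s.arr := funext fun x => hs.2 x (by simp)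
    have hcard : {t ∈ Finset.range i | P t}.card ≤ i := by
      simpa using Finset.card_filter_le (Finset.range i) P
    refine ⟨Expr.lt_ne_zero h8 hc'.r2 (by omega) hi, ?_⟩
    have e1 : (Expr.bin .add (.bin .mul (.reg 11) (.reg 2)) (.reg 8)).eval W s'
        = s.reg 11 * L + i :=
      Expr.eval_add (Expr.eval_mul (hs.1 11 (by decide)) hc'.r2 (by omega)) h8 (by omega)
    have e2 := Expr.eval_eq (Expr.eval_get (a := a) (Expr.eval_get (a := 3) e1))
      (e₂ := .reg 12) (hs.1 12 (by decide)) (show 1 < W by omega)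
    rw [ea] at e2
    rw [Finset.range_add_one, Finset.filter_insert]
    refine Exec.seq (T₁ := 2) (T₂ := 1) (Q₁ := 0) (Q₂ := 0) (Exec.ite (T₁ := 1)
      (fun he => Exec.skip ?_ le_rfl) (fun he => Exec.set (Expr.eval_add (a := _) h9
      (Expr.eval_lit (by omega)) (by omega)) ?_ le_rfl) le_rfl) le_rfl le_rfl
    · have hPi : ¬ P i := fun h => he (by rw [e2, if_neg h])
      refine Exec.set (Expr.eval_add h8 (Expr.eval_lit (by omega)) (by omega)) ?_ le_rfl
      rw [if_neg hPi]
      exact ⟨hs.setReg W _, Store.setReg_reg_self _ _ _ (by omega),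
        (Store.setReg_reg_of_ne _ _ _).trans h9⟩
    · have hPi : P i := fun h => by rw [e2, if_pos h] at he; omega
      refine Exec.set (Expr.eval_add (a := i) ((Store.setReg_reg_of_ne _ _ _).trans h8)
        (Expr.eval_lit (by omega)) (by omega)) ?_ le_rfl
      rw [if_pos hPi, Finset.card_insert_of_notMem (by simp)]
      exact ⟨(hs.setReg W _).setReg W _, Store.setReg_reg_self _ _ _ (by omega),
        (Store.setReg_reg_of_ne _ _ _).trans (Store.setReg_reg_self _ _ _ (by omega))⟩
  · rintro s' ⟨hs, h8, h9⟩
    have hc' := hc.same hs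
    exact ⟨Expr.lt_eq_zero h8 hc'.r2 (by omega) le_rfl, hs, h9⟩
  · exact ⟨((Store.Same.refl _ _ _).setReg W _).setReg W _,
      Store.setReg_reg_self _ _ _ (by omega), (Store.setReg_reg_of_ne _ _ _).trans
        (Store.setReg_reg_self _ _ _ (by omega))⟩

end Verify

/-! ### Passes over the neighborhood of a center -/

section Verify

variable {n : ℕ} {H : SimpleGraph (Fin n)} {W : ℕ} {A : AdjList H} {b L : ℕ} {ω : ℕ → ℕ}

theorem AdjList.size_pos (A : AdjList H) (v : ℕ) : 0 < A.size v := Nat.succ_pos _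

/-- Registers 7 and 11 are overwritten by the loop itself, so the invariant has to be insensitive to
them; their values are handed to the body separately. Reading an entry accounts for one query beyond
those of the body. -/
theorem forNbrs_exec (hp : Params n b L W) {P : Prog} {T₀ Q₀ w : ℕ} {s : Store} (hw : w < n)
    (I : ℕ → Store → Prop) (hctx : ∀ i s', I i s' → Ctx A b L s' ∧ s'.reg 6 = w)
    (h7 : ∀ i s' v, I i s' → I i (s'.setReg W 7 v))
    (h11 : ∀ i s' v, I i s' → I i (s'.setReg W 11 v))
    (hstep : ∀ i < A.size w, ∀ s', I i s' → s'.reg 7 = i → s'.reg 11 = A.entry w i →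
      Exec W A P s' T₀ Q₀ fun s'' => I (i + 1) s'' ∧ s''.reg 7 = i)
    (h0 : I 0 s) :
    Exec W A (forNbrs P) s (A.size w * (T₀ + 8) + 3) (A.size w * (1 + Q₀)) (I (A.size w)) := by
  have h1 := hp.n_le
  have h2 := hp.hW
  have h3 := A.size_le hw
  refine Exec.seq (T₁ := 1) (T₂ := A.size w * (T₀ + 8) + 1) (Q₁ := 0)
    (Exec.set (Expr.eval_lit (by omega)) ?_ le_rfl) (by omega) (zero_add _).le
  refine Exec.for (A.size w) (T₀ + 7) (1 + Q₀) (fun i s' => I i s' ∧ s'.reg 7 = i) ?_ ?_ ?_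
    le_rfl le_rfl
  · rintro i hi s' ⟨hI, hs7⟩
    obtain ⟨hc, h6⟩ := hctx i s' hI
    have e1 : s'.arr 1 (s'.reg 6) = A.size w := by rw [h6]; exact hc.d w hw
    refine ⟨Expr.lt_ne_zero hs7 e1 (by omega) hi, ?_⟩
    refine Exec.seq (T₁ := 4) (T₂ := T₀ + 2) (Q₁ := 1) (Q₂ := Q₀)
      (Exec.simple rfl ?_ (by decide) (by decide)) (by omega) le_rfl
    rw [fetch_den hp hc (by omega) (by omega), h6, hs7]
    have e2 := A.entry_lt hw i
    refine Exec.seq (T₁ := T₀) (T₂ := 1) (Q₁ := Q₀) (Q₂ := 0) ((hstep i hi _ (h11 _ _ _ hI)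
      ((Store.setReg_reg_of_ne _ _ _).trans hs7) (Store.setReg_reg_self _ _ _ (by omega))).mono
      le_rfl le_rfl ?_) le_rfl le_rfl
    rintro s'' ⟨hI', hs7'⟩
    exact Exec.set (Expr.eval_add hs7' (Expr.eval_lit (by omega)) (by omega))
      ⟨h7 _ _ _ hI', Store.setReg_reg_self _ _ _ (by omega)⟩ le_rfl
  · rintro s' ⟨hI, hs7⟩
    obtain ⟨hc, h6⟩ := hctx _ s' hI
    have e1 : s'.arr 1 (s'.reg 6) = A.size w := by rw [h6]; exact hc.d w hw
    exact ⟨Expr.lt_eq_zero hs7 e1 (by omega) le_rfl, hI⟩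
  · exact ⟨h7 _ _ _ h0, Store.setReg_reg_self _ _ _ (by omega)⟩

theorem markPass_exec (hp : Params n b L W) {s : Store} {w c : ℕ} (hc : Ctx A b L s) (hw : w < n)
    (h6 : s.reg 6 = w) (h12 : s.reg 12 = c) (hcW : c < W) :
    Exec W A markPass s (A.size w * 9 + 3) (A.size w) fun s' => Store.Same [7, 11] [4] s s' ∧
      (∀ x, A.near w x → s'.arr 4 x = c) ∧ ∀ x, ¬ A.near w x → s'.arr 4 x = s.arr 4 x := by
  refine (forNbrs_exec hp (T₀ := 1) (Q₀ := 0) hw (fun i s' => Store.Same [7, 11] [4] s s' ∧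
    (∀ x, (∃ i' < i, A.entry w i' = x) → s'.arr 4 x = c) ∧
      ∀ x, ¬ (∃ i' < i, A.entry w i' = x) → s'.arr 4 x = s.arr 4 x) ?_ ?_ ?_ ?_ ?_).mono le_rfl
    (by omega) fun s' hs' => hs'
  · rintro i s' ⟨hs, -⟩
    exact ⟨hc.same hs, (hs.1 6 (by decide)).trans h6⟩
  · rintro i s' v ⟨hs, h⟩
    exact ⟨hs.setReg W v, h⟩
  · rintro i s' v ⟨hs, h⟩
    exact ⟨hs.setReg W v, h⟩
  · rintro i hi s' ⟨hs, ha, hb⟩ h7 h11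
    refine Exec.put h11 ((hs.1 12 (by decide)).trans h12) ⟨⟨hs.setArr W _ _, ?_, ?_⟩, h7⟩ le_rfl
    · rintro x ⟨i', hi', rfl⟩
      rw [Store.setArr_arr_self _ _ _ _ hcW, Function.update_apply]
      split_ifs with h
      · rfl
      · refine ha _ ⟨i', ?_, rfl⟩
        have : i' ≠ i := fun e => h (by rw [e])
        omega
    · intro x hx
      rw [Store.setArr_arr_self _ _ _ _ hcW, Function.update_apply, if_neg]
      · exact hb x fun ⟨i', hi', h⟩ => hx ⟨i', by omega, h⟩
      · exact fun h => hx ⟨i, by omega, h.symm⟩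
  · exact ⟨Store.Same.refl _ _ _, by simp, by simp⟩

theorem closeTest_eval (hp : Params n b L W) {s : Store} {w u m t c : ℕ} {f e : Expr}
    (hc : Ctx A b L s) (hw : w < n) (hu : u < n) (h6 : s.reg 6 = w) (h11 : s.reg 11 = u)
    (hf : f.eval W s = m) (he : e.eval W s = t) (ht : t ≤ L) (hcle : c ≤ 12) :
    (closeTest f e c).eval W s =
      if s.arr 5 u = 0 ∧ m ≤ t ∧ 10 * A.size w ≤ c * A.size u then 1 else 0 := by
  classical
  have h1 := hp.n_le
  have h2 := hp.hW
  have h3 := hp.L_le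
  have h4 := A.size_le hw
  have h5 := A.size_le hu
  have ew : (Expr.get 1 (.reg 6)).eval W s = A.size w := by
    rw [Expr.eval_get (Expr.eval_reg h6), hc.d w hw]
  have eu : (Expr.get 1 (.reg 11)).eval W s = A.size u := by
    rw [Expr.eval_get (Expr.eval_reg h11), hc.d u hu]
  have h8 : c * A.size u ≤ 12 * n := Nat.mul_le_mul hcle h5
  have h7 : c < W := by have := hp.two_le; omega
  have e10 : (Expr.bin .mul (.lit 10) (.get 1 (.reg 6))).eval W s = 10 * A.size w :=
    Expr.eval_mul (Expr.eval_lit (by omega)) ew (by omega)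
  have ec : (Expr.bin .add (.bin .mul (.lit c) (.get 1 (.reg 11))) (.lit 1)).eval W s =
      c * A.size u + 1 :=
    Expr.eval_add (Expr.eval_mul (Expr.eval_lit h7) eu (by omega)) (Expr.eval_lit (by omega))
      (by omega)
  have hW1 : 1 < W := by omega
  have e0 : (Expr.lit 0).eval W s = 0 := Expr.eval_lit (by omega)
  have et : (Expr.bin .add e (.lit 1)).eval W s = t + 1 :=
    Expr.eval_add he (Expr.eval_lit (by omega)) (by omega)
  rw [closeTest, Expr.eval_and (Expr.eval_eq (Expr.eval_get (Expr.eval_reg h11)) e0 hW1)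
    (Expr.eval_and (Expr.eval_lt hf et hW1) (Expr.eval_lt e10 ec hW1) hW1) hW1]
  simp only [Nat.lt_succ_iff]

theorem missCount_eq {w u c : ℕ} {f g : ℕ → ℕ} (hL : 0 < L) (hu : u < n)
    (hf : ∀ x, f x = c ↔ A.near w x) (hg : ∀ j < n * L, g j = A.entry (j / L) (ω j)) :
    {t ∈ Finset.range L | ¬ f (g (u * L + t)) = c}.card = missCount A L ω w u := by
  classical
  unfold missCount failures
  refine congrArg Finset.card (Finset.filter_congr fun t ht => not_congr ?_)
  have h1 := mul_add_le L hu
  have h2 := Finset.mem_range.1 ht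
  rw [hf, hg _ (by omega)]
  have h3 : (u * L + t) / L = u := by
    rw [mul_comm, Nat.mul_add_div hL, Nat.div_eq_of_lt h2, add_zero]
  rw [h3]

theorem failures_le (Q : ℕ → Prop) (a L : ℕ) (ω : ℕ → ℕ) : failures Q a L ω ≤ L := by
  classical
  unfold failures
  simpa using Finset.card_filter_le (Finset.range L) fun t => ¬ Q (ω (a + t))

theorem strictCount_le (tag : ℕ → ℕ) (w k : ℕ) : strictCount A b L ω tag w k ≤ k := by
  classical
  unfold strictCount
  simpa using Finset.card_filter_le (Finset.range k)
    fun i => tag (A.entry w i) = 0 ∧ Strict A b L ω (A.entry w i) w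

theorem countPass_exec (hp : Params n b L W) {s : Store} {w c : ℕ} {tag : ℕ → ℕ}
    (hc : Ctx A b L s) (hw : w < n) (h6 : s.reg 6 = w) (h12 : s.reg 12 = c)
    (h3 : ∀ j < n * L, s.arr 3 j = A.entry (j / L) (ω j))
    (h4 : ∀ x, s.arr 4 x = c ↔ A.near w x) (h5 : s.arr 5 = tag) :
    Exec W A countPass s (A.size w * (5 * L + 20) + 5) (A.size w) fun s' =>
      Store.Same [7, 8, 9, 10, 11] [6] s s' ∧
        s'.reg 10 = strictCount A b L ω tag w (A.size w) ∧
        ∀ x, A.near w x → s'.arr 6 x = missCount A L ω w x := by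
  classical
  have g1 := hp.n_le
  have g2 := hp.hW
  have g3 := hp.L_le
  have g4 := A.size_le hw
  refine Exec.seq (T₁ := 1) (T₂ := A.size w * (5 * L + 20) + 3) (Q₁ := 0)
    (Exec.set (Expr.eval_lit (by omega)) ?_ le_rfl) (by omega) (zero_add _).le
  refine (forNbrs_exec hp (T₀ := 5 * L + 10) (Q₀ := 0) hw (fun i s' =>
    Store.Same [7, 8, 9, 10, 11] [6] s s' ∧ s'.reg 10 = strictCount A b L ω tag w i ∧
      ∀ i' < i, s'.arr 6 (A.entry w i') = missCount A L ω w (A.entry w i'))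
    ?_ ?_ ?_ ?_ ?_).mono
    (Nat.add_le_add_right (Nat.mul_le_mul_left _ (by omega)) _) (by omega) ?_
  · rintro i s' ⟨hs, -⟩
    exact ⟨hc.same hs, (hs.1 6 (by decide)).trans h6⟩
  · rintro i s' v ⟨hs, h, h'⟩
    exact ⟨hs.setReg W v, (Store.setReg_reg_of_ne _ _ _).trans h, h'⟩
  · rintro i s' v ⟨hs, h, h'⟩
    exact ⟨hs.setReg W v, (Store.setReg_reg_of_ne _ _ _).trans h, h'⟩
  · rintro i hi s' ⟨hs, h10, ha⟩ h7 h11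
    have hu := A.entry_lt hw i
    set u := A.entry w i with hudef
    have hc' := hc.same hs
    refine Exec.seq (T₁ := 5 * L + 5) (T₂ := 4) (Q₁ := 0) (Q₂ := 0)
      ((countLoop_exec hp 4 hc' (by omega)).mono le_rfl le_rfl ?_) (by omega) le_rfl
    rintro s₁ ⟨hs₁, h9⟩
    have hm : s₁.reg 9 = missCount A L ω w u := by
      rw [h9, h11, hs.1 12 (by decide), h12, hs.2 4 (by decide), hs.2 3 (by decide)]
      exact missCount_eq hp.L_pos hu h4 h3
    have hmL : missCount A L ω w u ≤ L := failures_le _ _ _ _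
    have hss : Store.Same [7, 8, 9, 10, 11] [6] s s₁ :=
      hs.trans (hs₁.mono (by decide) (by decide))
    have h11' : s₁.reg 11 = u := (hs₁.1 11 (by decide)).trans h11
    have h7' : s₁.reg 7 = i := (hs₁.1 7 (by decide)).trans h7
    have h10' : s₁.reg 10 = strictCount A b L ω tag w i := (hs₁.1 10 (by decide)).trans h10
    refine Exec.seq (T₁ := 1) (T₂ := 2) (Q₁ := 0) (Q₂ := 0) (Exec.put h11' hm ?_ le_rfl) le_rfl
      le_rfl
    set s₂ := s₁.setArr W 6 u (missCount A L ω w u) with hs₂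
    have hss₂ : Store.Same [7, 8, 9, 10, 11] [6] s s₂ := hss.setArr W _ _
    have ha₂ : ∀ i' < i + 1, s₂.arr 6 (A.entry w i') = missCount A L ω w (A.entry w i') := by
      intro i' hi'
      rw [hs₂, Store.setArr_arr_self _ _ _ _ (by omega), Function.update_apply]
      split_ifs with h
      · rw [h]
      · have : i' ≠ i := fun e => h (by rw [e])
        rw [hs₁.2 6 (by simp)]
        exact ha i' (by omega)
    have hc₂ := hc.same hss₂
    have e6 : (Expr.get 6 (.reg 11)).eval W s₂ = missCount A L ω w u :=
      (Expr.eval_get (Expr.eval_reg (show s₂.reg 11 = u from h11'))).trans (ha₂ i (by omega))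
    have hb : b ≤ L := by have := hp.hL; omega
    have htest := closeTest_eval (c := 11) hp hc₂ hw hu ((hss₂.1 6 (by decide)).trans h6) h11' e6
      (e := .reg 1) hc₂.r1 hb (by omega)
    rw [hss₂.2 5 (by decide), h5] at htest
    have hle := strictCount_le (A := A) (b := b) (L := L) (ω := ω) tag w i
    have hsucc : strictCount A b L ω tag w (i + 1) = strictCount A b L ω tag w i +
        if tag u = 0 ∧ Strict A b L ω u w then 1 else 0 := by
      unfold strictCount
      rw [Finset.range_add_one, Finset.filter_insert]
      split_ifs
      · rw [Finset.card_insert_of_notMem (by simp)]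
      · rfl
    refine Exec.ite (T₁ := 1) (fun he => ?_) (fun he => ?_) le_rfl
    · have hyes : tag u = 0 ∧ Strict A b L ω u w := by
        by_contra h
        exact he (htest.trans (if_neg h))
      refine Exec.set (Expr.eval_add (a := strictCount A b L ω tag w i) h10'
        (Expr.eval_lit (by omega)) (by omega)) ?_ le_rfl
      refine ⟨⟨hss₂.setReg W _, ?_, ha₂⟩, (Store.setReg_reg_of_ne _ _ _).trans h7'⟩
      rw [Store.setReg_reg_self _ _ _ (by omega), hsucc, if_pos hyes]
    · have hno : ¬ (tag u = 0 ∧ Strict A b L ω u w) := by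
        intro h
        rw [htest.trans (if_pos h)] at he
        exact one_ne_zero he
      refine Exec.skip ⟨⟨hss₂, ?_, ha₂⟩, h7'⟩ le_rfl
      rw [hsucc, if_neg hno]
      exact h10'
  · exact ⟨(Store.Same.refl _ _ _).setReg W _, by
      rw [Store.setReg_reg_self _ _ _ (by omega)]; simp [strictCount], by simp⟩
  · rintro s' ⟨hs, h10, ha⟩
    refine ⟨hs, h10, ?_⟩
    rintro x ⟨i, hi, rfl⟩
    exact ha i hi

open Classical in
theorem tagPass_exec (hp : Params n b L W) {s : Store} {w c : ℕ} {tag : ℕ → ℕ}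
    (hc : Ctx A b L s) (hw : w < n) (h6 : s.reg 6 = w) (h12 : s.reg 12 = c) (hcW : c < W)
    (h5 : s.arr 5 = tag) (ha : ∀ x, A.near w x → s.arr 6 x = missCount A L ω w x) :
    Exec W A tagPass s (A.size w * 10 + 3) (A.size w) fun s' =>
      Store.Same [7, 11] [5] s s' ∧ s'.arr 5 =
        fun x => if A.near w x ∧ tag x = 0 ∧ Loose A b L ω x w then c else tag x := by
  have g1 := hp.n_le
  have g2 := hp.hW
  have g3 := hp.L_le
  have g4 := A.size_le hw
  refine (forNbrs_exec hp (T₀ := 2) (Q₀ := 0) hw (fun i s' =>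
    Store.Same [7, 11] [5] s s' ∧ s'.arr 5 = fun x =>
      if (∃ i' < i, A.entry w i' = x) ∧ tag x = 0 ∧ Loose A b L ω x w then c else tag x)
    ?_ ?_ ?_ ?_ ?_).mono le_rfl (by omega)
      fun s' hs' => ⟨hs'.1, hs'.2.trans (funext fun x => if_congr Iff.rfl rfl rfl)⟩
  · rintro i s' ⟨hs, -⟩
    exact ⟨hc.same hs, (hs.1 6 (by decide)).trans h6⟩
  · rintro i s' v ⟨hs, h⟩
    exact ⟨hs.setReg W v, h⟩
  · rintro i s' v ⟨hs, h⟩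
    exact ⟨hs.setReg W v, h⟩
  · rintro i hi s' ⟨hs, hs5⟩ h7 h11
    have hu := A.entry_lt hw i
    have hc' := hc.same hs
    have hm : (Expr.get 6 (.reg 11)).eval W s' = missCount A L ω w (A.entry w i) := by
      rw [Expr.eval_get (Expr.eval_reg h11), hs.2 6 (by decide)]
      exact ha _ ⟨i, hi, rfl⟩
    have hb : 5 * b ≤ L := by have := hp.hL; omega
    have htest := closeTest_eval (c := 12) hp hc' hw hu ((hs.1 6 (by decide)).trans h6) h11 hm
      (Expr.eval_mul (Expr.eval_lit (c := 5) (by omega)) (e₂ := .reg 1) hc'.r1 (by omega)) hb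
      le_rfl
    -- The entries of the neighborhood are distinct, so the tag read for entry `i` is still the one
    -- from before the pass.
    have hnot : ∀ i' < i, A.entry w i' ≠ A.entry w i := fun i' hi' h =>
      hi'.ne (A.entry_inj hw (hi'.trans hi) hi h)
    have h5u : s'.arr 5 (A.entry w i) = tag (A.entry w i) := by
      rw [hs5]
      exact if_neg fun h => by
        obtain ⟨⟨i', hi', h'⟩, -⟩ := h
        exact hnot i' hi' h'
    rw [h5u] at htest
    have hiff : ∀ x, (∃ i' < i + 1, A.entry w i' = x) ↔
        x = A.entry w i ∨ ∃ i' < i, A.entry w i' = x := by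
      intro x
      constructor
      · rintro ⟨i', hi', rfl⟩
        rcases Nat.lt_succ_iff_lt_or_eq.1 hi' with h | rfl
        · exact Or.inr ⟨i', h, rfl⟩
        · exact Or.inl rfl
      · rintro (rfl | ⟨i', hi', rfl⟩)
        · exact ⟨i, by omega, rfl⟩
        · exact ⟨i', by omega, rfl⟩
    refine Exec.ite (T₁ := 1) (fun he => ?_) (fun he => ?_) le_rfl
    · have hyes : tag (A.entry w i) = 0 ∧ Loose A b L ω (A.entry w i) w := by
        by_contra h
        exact he (htest.trans (if_neg h))
      refine Exec.put h11 ((hs.1 12 (by decide)).trans h12) ⟨⟨hs.setArr W _ _, ?_⟩, h7⟩ le_rfl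
      rw [Store.setArr_arr_self _ _ _ _ hcW, hs5]
      funext x
      simp only [hiff, Function.update_apply]
      by_cases hx : x = A.entry w i
      · subst hx
        simp [hyes]
      · simp [hx]
    · have hno : ¬ (tag (A.entry w i) = 0 ∧ Loose A b L ω (A.entry w i) w) := by
        intro h
        rw [htest.trans (if_pos h)] at he
        exact one_ne_zero he
      refine Exec.skip ⟨⟨hs, ?_⟩, h7⟩ le_rfl
      rw [hs5]
      funext x
      simp only [hiff]
      by_cases hx : x = A.entry w i
      · subst hx
        simp [hno]
      · simp [hx]
  · exact ⟨Store.Same.refl _ _ _, by simpa using h5⟩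

theorem processCenter_exec (hp : Params n b L W) {s : Store} {w : ℕ} {tag : ℕ → ℕ}
    (hc : Ctx A b L s) (hw : w < n) (h6 : s.reg 6 = w)
    (h3 : ∀ j < n * L, s.arr 3 j = A.entry (j / L) (ω j))
    (h4 : ∀ x v, v < n → s.arr 4 x = n + v → A.near v x) (h5 : s.arr 5 = tag) :
    Exec W A processCenter s (A.size w * (5 * L + 60)) (A.size w * 3) fun s' =>
      Store.Same [7, 8, 9, 10, 11, 12] [4, 5, 6] s s' ∧
        (∀ x v, v < n → s'.arr 4 x = n + v → A.near v x) ∧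
        s'.arr 5 = tagStep A b L ω tag w := by
  have g1 := hp.n_le
  have g2 := hp.hW
  have g3 := hp.L_le
  have g4 := A.size_le hw
  have g5 := A.size_pos w
  have g6 := hp.two_le
  refine Exec.seq (T₁ := 1) (T₂ := A.size w * (5 * L + 60) - 2) (Q₁ := 0)
    (Exec.set (Expr.eval_add (e₁ := .reg 0) (e₂ := .reg 6) hc.r0 h6 (by omega)) ?_ le_rfl)
    (by have : 1 * 60 ≤ A.size w * (5 * L + 60) := Nat.mul_le_mul g5 (by omega)
        omega) (zero_add _).le
  have hs₁ : Store.Same [12] [] s (s.setReg W 12 (n + w)) :=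
    (Store.Same.refl _ _ _).setReg W _
  have h12 : (s.setReg W 12 (n + w)).reg 12 = n + w := Store.setReg_reg_self _ _ _ (by omega)
  generalize s.setReg W 12 (n + w) = s₁ at hs₁ h12
  have hT : A.size w * (5 * L + 60) =
      (A.size w * 9 + 3) + (A.size w * (5 * L + 20) + 5) + (A.size w * 10 + 3) +
        (A.size w * 21 - 11) := by
    have : A.size w * (5 * L + 60) = A.size w * 9 + A.size w * (5 * L + 20) + A.size w * 10 +
      A.size w * 21 := by ring
    omega
  refine Exec.seq (T₁ := A.size w * 9 + 3)
    (T₂ := A.size w * (5 * L + 20) + 5 + (A.size w * 10 + 4) + 1)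
    (Q₁ := A.size w) (Q₂ := A.size w * 2)
    ((markPass_exec hp (hc.same hs₁) hw ((hs₁.1 6 (by decide)).trans h6) h12 (by omega)).mono
      le_rfl le_rfl ?_) (by omega) (by omega)
  rintro s₂ ⟨hs₂', hm1, hm2⟩
  have hs₂ : Store.Same [7, 11, 12] [4] s s₂ :=
    (hs₁.mono (by decide) (by decide)).trans (hs₂'.mono (by decide) (by decide))
  have h12₂ : s₂.reg 12 = n + w := (hs₂'.1 12 (by decide)).trans h12
  -- Marks are never cleared. A mark `n + w` left from before comes from the same center, whose
  -- neighborhood has not changed, and is therefore correct.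
  have hmark : ∀ x, s₂.arr 4 x = n + w ↔ A.near w x := by
    intro x
    refine ⟨fun h => ?_, hm1 x⟩
    by_contra hx
    rw [hm2 x hx, hs₁.2 4 (by simp)] at h
    exact hx (h4 x w hw h)
  have hmark' : ∀ x v, v < n → s₂.arr 4 x = n + v → A.near v x := by
    intro x v hv h
    by_cases hx : A.near w x
    · rw [hm1 x hx] at h
      obtain rfl : w = v := by omega
      exact hx
    · rw [hm2 x hx, hs₁.2 4 (by simp)] at h
      exact h4 x v hv h
  refine Exec.seq (T₁ := A.size w * (5 * L + 20) + 5) (T₂ := A.size w * 10 + 4)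
    (Q₁ := A.size w) (Q₂ := A.size w) ((countPass_exec (tag := tag) (ω := ω) hp (hc.same hs₂) hw
      ((hs₂.1 6 (by decide)).trans h6) h12₂ (fun j hj => by rw [hs₂.2 3 (by decide), h3 j hj])
      hmark ((hs₂.2 5 (by decide)).trans h5)).mono le_rfl le_rfl ?_) (by omega) (by omega)
  rintro s₃ ⟨hs₃', h10, hcount⟩
  have hs₃ : Store.Same [7, 8, 9, 10, 11, 12] [4, 6] s s₃ :=
    (hs₂.mono (by decide) (by decide)).trans (hs₃'.mono (by decide) (by decide))
  have hc₃ := hc.same hs₃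
  have h6₃ : s₃.reg 6 = w := (hs₃.1 6 (by decide)).trans h6
  have h12₃ : s₃.reg 12 = n + w := (hs₃'.1 12 (by decide)).trans h12₂
  have h5₃ : s₃.arr 5 = tag := (hs₃.2 5 (by decide)).trans h5
  have h4₃ : s₃.arr 4 = s₂.arr 4 := hs₃'.2 4 (by decide)
  have hle := strictCount_le (A := A) (b := b) (L := L) (ω := ω) tag w (A.size w)
  have e1 : (Expr.bin .mul (.lit 10) (.reg 10)).eval W s₃ =
      10 * strictCount A b L ω tag w (A.size w) :=
    Expr.eval_mul (Expr.eval_lit (by omega)) (Expr.eval_reg h10) (by omega)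
  have e2 : (Expr.bin .mul (.lit 9) (.get 1 (.reg 6))).eval W s₃ = 9 * A.size w :=
    Expr.eval_mul (Expr.eval_lit (by omega))
      ((Expr.eval_get (Expr.eval_reg h6₃)).trans (hc₃.d w hw)) (by omega)
  have e3 := Expr.eval_lt e1 e2 (show 1 < W by omega)
  refine Exec.ite (T₁ := A.size w * 10 + 3) (fun he => Exec.skip ?_ (by omega)) (fun he => ?_)
    le_rfl
  · have hlt : 10 * strictCount A b L ω tag w (A.size w) < 9 * A.size w := by
      by_contra h
      exact he (e3.trans (if_neg h))
    refine ⟨hs₃.mono (by decide) (by decide), fun x v hv h => ?_, ?_⟩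
    · rw [h4₃] at h
      exact hmark' x v hv h
    · rw [h5₃, tagStep, if_neg (by omega)]
  · have hge : 9 * A.size w ≤ 10 * strictCount A b L ω tag w (A.size w) := by
      by_contra h
      rw [e3.trans (if_pos (by omega))] at he
      exact one_ne_zero he
    refine (tagPass_exec (ω := ω) hp hc₃ hw h6₃ h12₃ (by omega) h5₃ hcount).mono le_rfl le_rfl ?_
    rintro s₄ ⟨hs₄, h5₄⟩
    refine ⟨(hs₃.mono (by decide) (by decide)).trans (hs₄.mono (by decide) (by decide)),
      fun x v hv h => ?_, ?_⟩
    · rw [hs₄.2 4 (by decide), h4₃] at h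
      exact hmark' x v hv h
    · rw [h5₄, tagStep, if_pos hge]

end Verify

/-! ### The main loops -/

section Program

/-- Compute the parameters. -/
def setup (c : ℕ) : Prog :=
  .seq (.set 4 (.reg 0)) <| .seq
    (.loop (.reg 4) <| .seq (.set 4 (.bin .div (.reg 4) (.lit 2)))
      (.set 1 (.bin .add (.reg 1) (.lit 1)))) <|
    .seq (.set 1 (.bin .mul (.lit c) (.reg 1))) <|
      .seq (.set 2 (.bin .mul (.lit 20) (.reg 1))) <| .set 3 (.bin .mul (.reg 0) (.reg 2))

/-- Query all degrees, and put every vertex into a cluster of its own. -/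
def degreeLoop : Prog :=
  .seq (.set 11 (.lit 0)) <| .loop (.bin .lt (.reg 11) (.reg 0)) <|
    .seq (.deg 12 (.reg 11)) <| .seq (.put 1 (.reg 11) (.bin .add (.reg 12) (.lit 1))) <|
      .seq (.put 0 (.reg 11) (.reg 11)) <| .set 11 (.bin .add (.reg 11) (.lit 1))

/-- Record a random number. -/
def record : Prog := .seq (.put 2 (.reg 4) (.reg 12)) <| .set 4 (.bin .add (.reg 4) (.lit 1))

/-- The bound for the random number with index `reg 4`. -/
def randBound : Expr :=
  .bin .sub (.get 1 (.bin .mod (.bin .div (.reg 4) (.reg 2)) (.reg 0))) (.lit 1)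

/-- Draw all random numbers. -/
def randomLoop : Prog :=
  .loop (.bin .lt (.reg 4) (.bin .add (.reg 3) (.reg 3))) <| .seq (.rand 12 randBound) record

/-- Query the sampled neighbors. -/
def sampleLoop : Prog :=
  .seq (.set 4 (.lit 0)) <| .loop (.bin .lt (.reg 4) (.reg 3)) <|
    .seq (.set 6 (.bin .div (.reg 4) (.reg 2))) <| .seq (.set 7 (.get 2 (.reg 4))) <|
      .seq fetch <| .seq (.put 3 (.reg 4) (.reg 11)) <| .set 4 (.bin .add (.reg 4) (.lit 1))

/-- The test that `reg 6` is a center and that the budget suffices for it. -/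
def centerTest : Expr :=
  .bin .mul (.bin .eq (.get 2 (.bin .add (.reg 3) (.reg 4))) (.lit 0))
    (.bin .lt (.get 1 (.reg 6)) (.bin .add (.reg 5) (.lit 1)))

/-- Process the centers. -/
def centerLoop : Prog :=
  .seq (.set 5 (.bin .mul (.lit 3) (.reg 3))) <| .seq (.set 4 (.lit 0)) <|
    .loop (.bin .lt (.reg 4) (.reg 3)) <| .seq (.set 6 (.bin .div (.reg 4) (.reg 2))) <|
      .seq (.ite centerTest
        (.seq (.set 5 (.bin .sub (.reg 5) (.get 1 (.reg 6)))) processCenter) .skip) <|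
        .set 4 (.bin .add (.reg 4) (.lit 1))

/-- The test that few failures have been counted and that the center of the tag `reg 12` has a
neighborhood that is not much larger than that of `reg 11`. -/
def joinTest : Expr :=
  .bin .mul (.bin .lt (.reg 9) (.bin .add (.bin .mul (.lit 5) (.reg 1)) (.lit 1)))
    (.bin .lt (.bin .mul (.lit 10) (.get 1 (.bin .sub (.reg 12) (.reg 0))))
      (.bin .add (.bin .mul (.lit 12) (.get 1 (.reg 11))) (.lit 1)))

/-- Form the clusters. -/
def joinLoop : Prog :=
  .seq (.set 4 (.lit 0)) <| .loop (.bin .lt (.reg 4) (.reg 3)) <|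
    .seq (.set 11 (.bin .div (.reg 4) (.reg 2))) <| .seq (.set 12 (.get 5 (.get 3 (.reg 4)))) <|
      .seq (.ite (.reg 12)
        (.seq (countLoop 5) (.ite joinTest (.put 0 (.reg 11) (.reg 12)) .skip)) .skip) <|
        .set 4 (.bin .add (.reg 4) (.lit 1))

/-- The deterministic part of the program. -/
def mainPart : Prog := .seq sampleLoop <| .seq centerLoop joinLoop

/-- The program. -/
def clusterProg (c : ℕ) : Prog :=
  .seq (setup c) <| .seq degreeLoop <| .seq (.set 4 (.lit 0)) <| .seq randomLoop mainPart

end Program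

/-! ### Sampling, and processing the centers within the budget -/

section Verify

variable {n : ℕ} {H : SimpleGraph (Fin n)} {W : ℕ} {A : AdjList H} {b L : ℕ} {ω : ℕ → ℕ}

/-- Entry `i` of the tape is uniform on `{0, …, tapeBound i}`. -/
def tapeBound (A : AdjList H) (L i : ℕ) : ℕ := A.size (i / L % n) - 1

theorem tagRun_snd_le (j : ℕ) : (tagRun A b L ω j).2 ≤ 3 * (n * L) := by
  induction j with
  | zero => exact le_rfl
  | succ j ih =>
    rw [tagRun]
    split_ifs
    · exact (Nat.sub_le _ _).trans ih
    · exact ih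

theorem div_lt_of_lt_mul {n L j : ℕ} (h : j < n * L) : j / L < n := by
  rw [mul_comm] at h
  exact Nat.div_lt_of_lt_mul h

theorem tagStep_range {tag : ℕ → ℕ} {w : ℕ} (hw : w < n)
    (h : ∀ x, tag x = 0 ∨ ∃ v < n, tag x = n + v) (x : ℕ) :
    tagStep A b L ω tag w x = 0 ∨ ∃ v < n, tagStep A b L ω tag w x = n + v := by
  unfold tagStep
  split_ifs
  · dsimp only
    split_ifs
    · exact Or.inr ⟨w, hw, rfl⟩
    · exact h x
  · exact h x

theorem tagRun_range {j : ℕ} (hj : j ≤ n * L) (x : ℕ) :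
    (tagRun A b L ω j).1 x = 0 ∨ ∃ v < n, (tagRun A b L ω j).1 x = n + v := by
  induction j generalizing x with
  | zero => exact Or.inl rfl
  | succ j ih =>
    rw [tagRun]
    split_ifs
    · exact tagStep_range (div_lt_of_lt_mul (by omega)) (ih (by omega)) x
    · exact ih (by omega) x

theorem sampleLoop_exec (hp : Params n b L W) {s : Store} (hc : Ctx A b L s)
    (h2 : ∀ j < n * L, s.arr 2 j = ω j) (hω : ∀ j < n * L, ω j < n) :
    Exec W A sampleLoop s (n * L * 15 + 3) (n * L) fun s' =>
      Store.Same [4, 6, 7, 11] [3] s s' ∧ ∀ j < n * L, s'.arr 3 j = A.entry (j / L) (ω j) := by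
  have g1 := hp.n_le
  have g2 := hp.hW
  have g3 := hp.L_le
  have g6 := hp.two_le
  refine Exec.seq (T₁ := 1) (T₂ := n * L * 15 + 1) (Q₁ := 0)
    (Exec.set (Expr.eval_lit (by omega)) ?_ le_rfl) (by omega) (zero_add _).le
  refine Exec.for (n * L) 14 1 (fun i s' => Store.Same [4, 6, 7, 11] [3] s s' ∧ s'.reg 4 = i ∧
    ∀ j < i, s'.arr 3 j = A.entry (j / L) (ω j)) ?_ ?_ ?_ le_rfl (by omega)
  · rintro i hi s' ⟨hs, h4, h3⟩
    have hc' := hc.same hs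
    have hv := div_lt_of_lt_mul hi
    refine ⟨Expr.lt_ne_zero h4 hc'.r3 (by omega) hi, ?_⟩
    refine Exec.seq (T₁ := 1) (T₂ := 12) (Q₁ := 0) (Q₂ := 1) (Exec.set (Expr.eval_div
      (Expr.eval_reg h4) (Expr.eval_reg hc'.r2) (by omega)) ?_ le_rfl) le_rfl le_rfl
    refine Exec.seq (T₁ := 1) (T₂ := 9) (Q₁ := 0) (Q₂ := 1) (Exec.set (v := ω i) ?_ ?_ le_rfl)
      (by omega) le_rfl
    · rw [Expr.eval_get (i := i), Store.setReg_arr, hs.2 2 (by decide), h2 i hi]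
      exact (Store.setReg_reg_of_ne _ _ _).trans h4
    have hs₁ : Store.Same [4, 6, 7, 11] [3] s ((s'.setReg W 6 (i / L)).setReg W 7 (ω i)) :=
      (hs.setReg W _).setReg W _
    have h6 : ((s'.setReg W 6 (i / L)).setReg W 7 (ω i)).reg 6 = i / L :=
      (Store.setReg_reg_of_ne _ _ _).trans (Store.setReg_reg_self _ _ _ (by omega))
    have h7 : ((s'.setReg W 6 (i / L)).setReg W 7 (ω i)).reg 7 = ω i :=
      Store.setReg_reg_self _ _ _ (by have := hω i hi; omega)
    have h4' : ((s'.setReg W 6 (i / L)).setReg W 7 (ω i)).reg 4 = i :=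
      (Store.setReg_reg_of_ne _ _ _).trans ((Store.setReg_reg_of_ne _ _ _).trans h4)
    have ha : ((s'.setReg W 6 (i / L)).setReg W 7 (ω i)).arr = s'.arr := rfl
    generalize (s'.setReg W 6 (i / L)).setReg W 7 (ω i) = s₁ at hs₁ h6 h7 h4' ha
    refine Exec.seq (T₁ := 4) (T₂ := 3) (Q₁ := 1) (Q₂ := 0)
      (Exec.simple rfl ?_ (by decide) (by decide)) (by omega) le_rfl
    have hω' := hω i hi
    have he := A.entry_lt hv (ω i)
    rw [fetch_den hp (hc.same hs₁) (by omega) (by omega), h6, h7]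
    have h4'' : (s₁.setReg W 11 (A.entry (i / L) (ω i))).reg 4 = i :=
      (Store.setReg_reg_of_ne _ _ _).trans h4'
    refine Exec.seq (T₁ := 1) (T₂ := 1) (Q₁ := 0) (Q₂ := 0) (Exec.put (Expr.eval_reg h4'') (Expr.eval_reg (Store.setReg_reg_self _ _ _
      (by omega))) ?_ le_rfl) le_rfl le_rfl
    refine Exec.set (Expr.eval_add (a := i) h4'' (Expr.eval_lit (by omega)) (by omega))
      ⟨?_, ?_, ?_⟩ le_rfl
    · exact ((hs₁.setReg W _).setArr W _ _).setReg W _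
    · exact Store.setReg_reg_self _ _ _ (by omega)
    · intro j hj
      rw [Store.setReg_arr, Store.setArr_arr_self _ _ _ _ (by omega), Store.setReg_arr, ha,
        Function.update_apply]
      split_ifs with h
      · rw [h]
      · exact h3 j (by omega)
  · rintro s' ⟨hs, h4, h3⟩
    exact ⟨Expr.lt_eq_zero h4 (hc.same hs).r3 (by omega) le_rfl, hs, h3⟩
  · exact ⟨(Store.Same.refl _ _ _).setReg W _, Store.setReg_reg_self _ _ _ (by omega), by simp⟩

theorem centerLoop_exec (hp : Params n b L W) {s : Store} (hc : Ctx A b L s)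
    (h2 : ∀ j < n * L, s.arr 2 (n * L + j) = ω (n * L + j))
    (h3 : ∀ j < n * L, s.arr 3 j = A.entry (j / L) (ω j)) (h4 : ∀ x, s.arr 4 x = 0)
    (h5 : ∀ x, s.arr 5 x = 0) :
    Exec W A centerLoop s (n * L * (15 * L + 200)) (9 * (n * L)) fun s' =>
      Store.Same [4, 5, 6, 7, 8, 9, 10, 11, 12] [4, 5, 6] s s' ∧
        s'.arr 5 = finalTag A b L ω := by
  have g1 := hp.n_le
  have g2 := hp.hW
  have g3 := hp.L_le
  have g6 := hp.two_le
  have hT : n * L * (15 * L + 200) = n * L * 10 + 3 * (n * L) * (5 * L + 60) + n * L * 10 := by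
    ring
  refine Exec.seq (T₁ := 1) (T₂ := n * L * 10 + 3 * (n * L) * (5 * L + 60) + 3) (Q₁ := 0)
    (Exec.set (Expr.eval_mul (Expr.eval_lit (by omega)) (Expr.eval_reg hc.r3) (by omega)) ?_
      le_rfl) (by omega) (zero_add _).le
  refine Exec.seq (T₁ := 1) (T₂ := n * L * 10 + 3 * (n * L) * (5 * L + 60) + 1) (Q₁ := 0)
    (Exec.set (Expr.eval_lit (by omega)) ?_ le_rfl) (by omega) (zero_add _).le
  -- The remaining budget is a potential: a center of size d costs at most d(5L + 60) steps and 3d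
  -- queries, paid by lowering the budget by d. The bounds thus hold on every tape. Each iteration
  -- adds at most 10 steps of its own.
  refine Exec.loop (n * L) (fun j t q s' =>
    Store.Same [4, 5, 6, 7, 8, 9, 10, 11, 12] [4, 5, 6] s s' ∧ s'.reg 4 = j ∧
      s'.reg 5 = (tagRun A b L ω j).2 ∧ (∀ x v, v < n → s'.arr 4 x = n + v → A.near v x) ∧
      s'.arr 5 = (tagRun A b L ω j).1 ∧
      t + (tagRun A b L ω j).2 * (5 * L + 60) ≤ j * 10 + 3 * (n * L) * (5 * L + 60) ∧
      q + 3 * (tagRun A b L ω j).2 ≤ 9 * (n * L)) ?_ ?_ ?_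
  · rintro j hj t q s' ⟨hs, hr4, hr5, hm, ha5, ht, hq⟩
    have hc' := hc.same hs
    have hv := div_lt_of_lt_mul hj
    have hbud := tagRun_snd_le (A := A) (b := b) (L := L) (ω := ω) j
    have hsz := A.size_le hv
    refine ⟨Expr.lt_ne_zero hr4 hc'.r3 (by omega) hj, ?_⟩
    have hs₁ : Store.Same [4, 5, 6, 7, 8, 9, 10, 11, 12] [4, 5, 6] s (s'.setReg W 6 (j / L)) :=
      hs.setReg W _
    have h6 : (s'.setReg W 6 (j / L)).reg 6 = j / L := Store.setReg_reg_self _ _ _ (by omega)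
    have h4₁ : (s'.setReg W 6 (j / L)).reg 4 = j := (Store.setReg_reg_of_ne _ _ _).trans hr4
    have h5₁ : (s'.setReg W 6 (j / L)).reg 5 = (tagRun A b L ω j).2 :=
      (Store.setReg_reg_of_ne _ _ _).trans hr5
    have ha₁ : (s'.setReg W 6 (j / L)).arr = s'.arr := rfl
    have hset : (Expr.bin .div (.reg 4) (.reg 2)).eval W s' = j / L :=
      Expr.eval_div (Expr.eval_reg hr4) (Expr.eval_reg hc'.r2) (by omega)
    generalize hs₁e : s'.setReg W 6 (j / L) = s₁ at hs₁ h6 h4₁ h5₁ ha₁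
    have hc₁ := hc.same hs₁
    have hd : (Expr.get 1 (.reg 6)).eval W s₁ = A.size (j / L) :=
      (Expr.eval_get (Expr.eval_reg h6)).trans (hc₁.d _ hv)
    have hW1 : 1 < W := by omega
    have htest : centerTest.eval W s₁ =
        if ω (n * L + j) = 0 ∧ A.size (j / L) < (tagRun A b L ω j).2 + 1 then 1 else 0 := by
      refine Expr.eval_and (Expr.eval_eq ?_ (Expr.eval_lit (by omega)) hW1) (Expr.eval_lt hd
        (Expr.eval_add (Expr.eval_reg h5₁) (Expr.eval_lit (by omega)) (by omega)) hW1) hW1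
      rw [Expr.eval_get (Expr.eval_add (Expr.eval_reg hc₁.r3) (Expr.eval_reg h4₁) (by omega)),
        hs₁.2 2 (by decide), h2 j hj]
    by_cases hyes : ω (n * L + j) = 0 ∧ A.size (j / L) ≤ (tagRun A b L ω j).2
    · refine ⟨A.size (j / L) * (5 * L + 60) + 8, A.size (j / L) * 3, ?_⟩
      have hrun : tagRun A b L ω (j + 1) = (tagStep A b L ω (tagRun A b L ω j).1 (j / L),
          (tagRun A b L ω j).2 - A.size (j / L)) := by rw [tagRun, if_pos hyes]
      refine Exec.seq (T₁ := 1) (T₂ := A.size (j / L) * (5 * L + 60) + 5) (Q₁ := 0)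
        (Exec.set hset ?_ le_rfl) (by omega) (zero_add _).le
      rw [hs₁e]
      refine Exec.seq (T₁ := A.size (j / L) * (5 * L + 60) + 3) (T₂ := 1) (Q₂ := 0)
        (Exec.ite (T₁ := A.size (j / L) * (5 * L + 60) + 2) (fun _ => ?_) (fun he => ?_) le_rfl)
        (by omega) le_rfl
      swap
      · rw [htest, if_pos ⟨hyes.1, by omega⟩] at he
        exact absurd he one_ne_zero
      refine Exec.seq (T₁ := 1) (T₂ := A.size (j / L) * (5 * L + 60)) (Q₁ := 0)
        (Exec.set (Expr.eval_sub (Expr.eval_reg h5₁) hd (by omega)) ?_ le_rfl) (by omega)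
        (zero_add _).le
      have hs₂ : Store.Same [4, 5, 6, 7, 8, 9, 10, 11, 12] [4, 5, 6] s
          (s₁.setReg W 5 ((tagRun A b L ω j).2 - A.size (j / L))) := hs₁.setReg W _
      refine (processCenter_exec (ω := ω) (w := j / L) hp (hc.same hs₂) hv
        ((Store.setReg_reg_of_ne _ _ _).trans h6)
        (fun i hi => by rw [hs₂.2 3 (by decide), h3 i hi])
        (fun x v hv' hx => by
          rw [Store.setReg_arr, ha₁] at hx
          exact hm x v hv' hx)
        (show _ = (tagRun A b L ω j).1 by rw [Store.setReg_arr, ha₁, ha5])).mono le_rfl le_rfl ?_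
      rintro s₃ ⟨hs₃, hm₃, ha₃⟩
      have h4₃ : s₃.reg 4 = j :=
        (hs₃.1 4 (by decide)).trans ((Store.setReg_reg_of_ne _ _ _).trans h4₁)
      have h5₃ : s₃.reg 5 = (tagRun A b L ω j).2 - A.size (j / L) :=
        (hs₃.1 5 (by decide)).trans (Store.setReg_reg_self _ _ _ (by omega))
      refine Exec.set (Expr.eval_add (Expr.eval_reg h4₃) (Expr.eval_lit (by omega)) (by omega))
        ⟨?_, ?_, ?_, hm₃, ?_, ?_, ?_⟩ le_rfl
      · exact (hs₂.trans (hs₃.mono (by decide) (by decide))).setReg W _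
      · exact Store.setReg_reg_self _ _ _ (by omega)
      · rw [hrun]
        exact (Store.setReg_reg_of_ne _ _ _).trans h5₃
      · rw [hrun]
        exact ha₃
      · rw [hrun]
        have e : (tagRun A b L ω j).2 * (5 * L + 60) =
            ((tagRun A b L ω j).2 - A.size (j / L)) * (5 * L + 60)
              + A.size (j / L) * (5 * L + 60) := by
          rw [← Nat.add_mul, Nat.sub_add_cancel hyes.2]
        dsimp only
        omega
      · rw [hrun]
        dsimp only
        omega
    · refine ⟨8, 0, ?_⟩
      have hrun : tagRun A b L ω (j + 1) = tagRun A b L ω j := by rw [tagRun, if_neg hyes]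
      refine Exec.seq (T₁ := 1) (T₂ := 6) (Q₁ := 0) (Q₂ := 0)
        (Exec.set hset ?_ le_rfl) le_rfl le_rfl
      rw [hs₁e]
      refine Exec.seq (T₁ := 2) (T₂ := 1) (Q₁ := 0) (Q₂ := 0)
        (Exec.ite (T₁ := 1) (fun he => ?_) (fun he => Exec.skip ?_ le_rfl) le_rfl)
        (by omega) le_rfl
      · exact absurd (htest.trans (if_neg fun h => hyes ⟨h.1, by omega⟩)) he
      refine Exec.set (Expr.eval_add (Expr.eval_reg h4₁) (Expr.eval_lit (by omega)) (by omega))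
        ⟨hs₁.setReg W _, Store.setReg_reg_self _ _ _ (by omega), ?_, ?_, ?_, ?_, ?_⟩ le_rfl
      · rw [hrun]
        exact (Store.setReg_reg_of_ne _ _ _).trans h5₁
      · intro x v hv' hx
        rw [Store.setReg_arr, ha₁] at hx
        exact hm x v hv' hx
      · rw [hrun, Store.setReg_arr, ha₁, ha5]
      · rw [hrun]
        omega
      · rw [hrun]
        omega
  · rintro t q s' ⟨hs, hr4, hr5, hm, ha5, ht, hq⟩
    exact ⟨Expr.lt_eq_zero hr4 (hc.same hs).r3 (by omega) le_rfl, by omega, by omega, hs, ha5⟩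
  · refine ⟨((Store.Same.refl _ _ _).setReg W _).setReg W _,
      Store.setReg_reg_self _ _ _ (by omega), (Store.setReg_reg_of_ne _ _ _).trans
        (Store.setReg_reg_self _ _ _ (by omega)), ?_, funext h5, ?_, ?_⟩
    · intro x v _ hx
      have := h4 x
      simp only [Store.setReg_arr] at hx
      omega
    · simp [tagRun]
    · simp only [tagRun]
      omega

end Verify

/-! ### Forming the clusters, and the whole program -/

section Verify

variable {n : ℕ} {H : SimpleGraph (Fin n)} {W : ℕ} {A : AdjList H} {b L : ℕ} {ω : ℕ → ℕ}

theorem failures_eq_count {v c : ℕ} {f g : ℕ → ℕ} (hL : 0 < L) (hv : v < n)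
    (hg : ∀ j < n * L, g j = A.entry (j / L) (ω j)) :
    {t ∈ Finset.range L | ¬ f (g (v * L + t)) = c}.card =
      failures (fun r => f (A.entry v r) = c) (v * L) L ω := by
  classical
  unfold failures
  refine congrArg Finset.card (Finset.ext fun t => ?_)
  simp only [Finset.mem_filter, Finset.mem_range]
  refine and_congr_right fun h2 => not_congr ?_
  have h1 := mul_add_le L hv
  have h3 : (v * L + t) / L = v := by
    rw [mul_comm, Nat.mul_add_div hL, Nat.div_eq_of_lt h2, add_zero]
  rw [hg _ (by omega), h3]

/-- At most 5b of the 20b samples of `v` miss the tag `c`, so some sample carries it. This is why it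
suffices to try the tags of the samples. -/
theorem exists_of_joins (hp : Params n b L W) {v c : ℕ} (h : Joins A b L ω v c) :
    ∃ t < L, finalTag A b L ω (A.entry v (ω (v * L + t))) = c := by
  classical
  by_contra! hno
  have h1 : failures (fun r => finalTag A b L ω (A.entry v r) = c) (v * L) L ω = L := by
    unfold failures
    refine (congrArg Finset.card (Finset.ext fun t => ?_)).trans (Finset.card_range L)
    simp only [Finset.mem_filter, Finset.mem_range]
    exact and_iff_left_of_imp (hno t)
  have h2 := h.2.1
  have h3 := hp.hL
  have h4 := hp.one_le
  omega

theorem joinLoop_exec (hp : Params n b L W) {s : Store} (hc : Ctx A b L s)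
    (h3 : ∀ j < n * L, s.arr 3 j = A.entry (j / L) (ω j)) (h5 : s.arr 5 = finalTag A b L ω)
    (h0 : ∀ v < n, s.arr 0 v = v) :
    Exec W A joinLoop s (n * L * (5 * L + 25) + 3) 0 fun s' => OutputSpec A b L ω (s'.arr 0) := by
  classical
  have g1 := hp.n_le
  have g2 := hp.hW
  have g3 := hp.L_le
  have g6 := hp.two_le
  have hW1 : 1 < W := by omega
  refine Exec.seq (T₁ := 1) (T₂ := n * L * (5 * L + 25) + 1) (Q₁ := 0) (Q₂ := 0)
    (Exec.set (Expr.eval_lit (by omega)) ?_ le_rfl) (by omega) le_rfl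
  refine Exec.for (n * L) (5 * L + 24) 0 (fun j s' =>
    Store.Same [4, 8, 9, 11, 12] [0] s s' ∧ s'.reg 4 = j ∧ ∀ v < n,
      (s'.arr 0 v = v ∧ ∀ j' < j, j' / L = v →
        ¬ Joins A b L ω v (finalTag A b L ω (A.entry (j' / L) (ω j')))) ∨
      Joins A b L ω v (s'.arr 0 v)) ?_ ?_ ?_ le_rfl (by omega)
  · rintro j hj s' ⟨hs, hr4, hout⟩
    have hc' := hc.same hs
    have hv := div_lt_of_lt_mul hj
    refine ⟨Expr.lt_ne_zero hr4 hc'.r3 hW1 hj, ?_⟩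
    refine Exec.seq (T₁ := 1) (T₂ := 5 * L + 22) (Q₁ := 0) (Q₂ := 0) (Exec.set (Expr.eval_div
      (Expr.eval_reg hr4) (Expr.eval_reg hc'.r2) (by omega)) ?_ le_rfl) (by omega) le_rfl
    have hu := A.entry_lt hv (ω j)
    have hrange := tagRun_range (A := A) (b := b) (ω := ω) (le_refl (n * L))
      (A.entry (j / L) (ω j))
    change finalTag A b L ω _ = 0 ∨ ∃ v < n, finalTag A b L ω _ = n + v at hrange
    set c := finalTag A b L ω (A.entry (j / L) (ω j)) with hcdef
    have hcW : c < W := by rcases hrange with h | ⟨v, hv, h⟩ <;> omega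
    refine Exec.seq (T₁ := 1) (T₂ := 5 * L + 20) (Q₁ := 0) (Q₂ := 0) (Exec.set (v := c) ?_ ?_ le_rfl)
      (by omega) le_rfl
    · have h4 : (s'.setReg W 11 (j / L)).reg 4 = j := (Store.setReg_reg_of_ne _ _ _).trans hr4
      rw [Expr.eval_get (Expr.eval_get (Expr.eval_reg h4)), Store.setReg_arr, hs.2 5 (by decide), hs.2 3 (by decide), h3 j hj, h5]
    have hs₁ : Store.Same [4, 8, 9, 11, 12] [0] s ((s'.setReg W 11 (j / L)).setReg W 12 c) :=
      (hs.setReg W _).setReg W _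
    have h11 : ((s'.setReg W 11 (j / L)).setReg W 12 c).reg 11 = j / L :=
      (Store.setReg_reg_of_ne _ _ _).trans (Store.setReg_reg_self _ _ _ (by omega))
    have h12 : ((s'.setReg W 11 (j / L)).setReg W 12 c).reg 12 = c :=
      Store.setReg_reg_self _ _ _ (by omega)
    have h4 : ((s'.setReg W 11 (j / L)).setReg W 12 c).reg 4 = j :=
      (Store.setReg_reg_of_ne _ _ _).trans ((Store.setReg_reg_of_ne _ _ _).trans hr4)
    have ha : ((s'.setReg W 11 (j / L)).setReg W 12 c).arr = s'.arr := rfl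
    generalize (s'.setReg W 11 (j / L)).setReg W 12 c = s₁ at hs₁ h11 h12 h4 ha
    have hc₁ := hc.same hs₁
    have hstay : ¬ Joins A b L ω (j / L) c → ∀ v < n,
        (s'.arr 0 v = v ∧ ∀ j' < j + 1, j' / L = v →
          ¬ Joins A b L ω v (finalTag A b L ω (A.entry (j' / L) (ω j')))) ∨
        Joins A b L ω v (s'.arr 0 v) := by
      intro hno v hvn
      rcases hout v hvn with ⟨h, h'⟩ | h
      · refine Or.inl ⟨h, fun j' hj' he => ?_⟩
        rcases Nat.lt_succ_iff_lt_or_eq.1 hj' with hlt | rfl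
        · exact h' j' hlt he
        · rw [← he]
          exact hno
      · exact Or.inr h
    refine Exec.seq (T₁ := 5 * L + 15) (T₂ := 1) (Q₁ := 0) (Q₂ := 0)
      (Exec.ite (T₁ := 5 * L + 14) (fun he => ?_) (fun he => Exec.skip ?_ (by omega)) (by omega))
      (by omega) le_rfl
    swap
    · have hc0 : c = 0 := h12.symm.trans he
      refine Exec.set (Expr.eval_add (Expr.eval_reg h4) (Expr.eval_lit (by omega)) (by omega))
        ⟨hs₁.setReg W _, Store.setReg_reg_self _ _ _ (by omega), ?_⟩ le_rfl
      rw [Store.setReg_arr, ha]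
      exact hstay fun h => h.1 hc0
    have hc0 : c ≠ 0 := fun h => he ((Expr.eval_reg h12).trans h)
    obtain ⟨w, hw, hcw⟩ := hrange.resolve_left hc0
    refine Exec.seq (T₁ := 5 * L + 5) (T₂ := 2) (Q₁ := 0) (Q₂ := 0)
      ((countLoop_exec hp 5 hc₁ (by omega)).mono le_rfl le_rfl ?_) (by omega) le_rfl
    rintro s₂ ⟨hs₂', h9⟩
    have hs₂ : Store.Same [4, 8, 9, 11, 12] [0] s s₂ :=
      hs₁.trans (hs₂'.mono (by decide) (by decide))
    have hc₂ := hc.same hs₂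
    have h11₂ : s₂.reg 11 = j / L := (hs₂'.1 11 (by decide)).trans h11
    have h12₂ : s₂.reg 12 = c := (hs₂'.1 12 (by decide)).trans h12
    have h4₂ : s₂.reg 4 = j := (hs₂'.1 4 (by decide)).trans h4
    have ha₂ : s₂.arr 0 = s'.arr 0 := (hs₂'.2 0 (by simp)).trans (by rw [ha])
    have hf : s₂.reg 9 =
        failures (fun r => finalTag A b L ω (A.entry (j / L) r) = c) (j / L * L) L ω := by
      rw [h9, h11, h12, hs₁.2 5 (by decide), hs₁.2 3 (by decide), h5]
      exact failures_eq_count hp.L_pos hv h3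
    have hfL := failures_le (fun r => finalTag A b L ω (A.entry (j / L) r) = c) (j / L * L) L ω
    have hsz := A.size_le hv
    have hszw := A.size_le hw
    have hbL := hp.hL
    have e1 : (Expr.bin .add (.bin .mul (.lit 5) (.reg 1)) (.lit 1)).eval W s₂ = 5 * b + 1 :=
      Expr.eval_add (Expr.eval_mul (Expr.eval_lit (by omega)) (Expr.eval_reg hc₂.r1) (by omega))
        (Expr.eval_lit (by omega)) (by omega)
    have e2 : (Expr.bin .sub (.reg 12) (.reg 0)).eval W s₂ = c - n :=
      Expr.eval_sub (Expr.eval_reg h12₂) (Expr.eval_reg hc₂.r0) (by omega)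
    have hcn : c - n = w := by omega
    have e3 : (Expr.bin .mul (.lit 10) (.get 1 (.bin .sub (.reg 12) (.reg 0)))).eval W s₂ =
        10 * A.size (c - n) := by
      refine Expr.eval_mul (Expr.eval_lit (by omega)) ?_ (by rw [hcn]; omega)
      rw [Expr.eval_get e2, hcn, hc₂.d w hw]
    have e4 : (Expr.bin .add (.bin .mul (.lit 12) (.get 1 (.reg 11))) (.lit 1)).eval W s₂ =
        12 * A.size (j / L) + 1 :=
      Expr.eval_add (Expr.eval_mul (Expr.eval_lit (by omega)) ((Expr.eval_get
        (Expr.eval_reg h11₂)).trans (hc₂.d _ hv)) (by omega)) (Expr.eval_lit (by omega)) (by omega)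
    have htest : joinTest.eval W s₂ = if failures (fun r => finalTag A b L ω (A.entry (j / L) r)
        = c) (j / L * L) L ω < 5 * b + 1 ∧ 10 * A.size (c - n) < 12 * A.size (j / L) + 1
        then 1 else 0 :=
      Expr.eval_and (Expr.eval_lt (Expr.eval_reg hf) e1 hW1) (Expr.eval_lt e3 e4 hW1) hW1
    simp only [Nat.lt_succ_iff] at htest
    refine Exec.ite (T₁ := 1) (fun he => ?_) (fun he => Exec.skip ?_ le_rfl) le_rfl
    · have hyes : Joins A b L ω (j / L) c := by
        refine ⟨hc0, ?_⟩
        by_contra h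
        exact he (htest.trans (if_neg h))
      refine Exec.put (Expr.eval_reg h11₂) (Expr.eval_reg h12₂) ?_ le_rfl
      refine Exec.set (Expr.eval_add (a := j) h4₂ (Expr.eval_lit (by omega)) (by omega))
        ⟨(hs₂.setArr W _ _).setReg W _, Store.setReg_reg_self _ _ _ (by omega), ?_⟩ le_rfl
      intro v hvn
      rw [Store.setReg_arr, Store.setArr_arr_self _ _ _ _ hcW, Function.update_apply, ha₂]
      by_cases hvj : v = j / L
      · rw [if_pos hvj, hvj]
        exact Or.inr hyes
      · rw [if_neg hvj]
        rcases hout v hvn with ⟨h, h'⟩ | h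
        · refine Or.inl ⟨h, fun j' hj' he => ?_⟩
          rcases Nat.lt_succ_iff_lt_or_eq.1 hj' with hlt | rfl
          · exact h' j' hlt he
          · exact absurd he.symm hvj
        · exact Or.inr h
    · have hno : ¬ Joins A b L ω (j / L) c := by
        intro h
        rw [htest.trans (if_pos h.2)] at he
        exact one_ne_zero he
      refine Exec.set (Expr.eval_add (Expr.eval_reg h4₂) (Expr.eval_lit (by omega)) (by omega))
        ⟨hs₂.setReg W _, Store.setReg_reg_self _ _ _ (by omega), ?_⟩ le_rfl
      rw [Store.setReg_arr, ha₂]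
      exact hstay hno
  · rintro s' ⟨hs, hr4, hout⟩
    refine ⟨Expr.lt_eq_zero hr4 (hc.same hs).r3 hW1 le_rfl, fun v hv => ?_⟩
    rcases hout v hv with ⟨h, h'⟩ | h
    · refine Or.inl ⟨h, fun c hj => ?_⟩
      obtain ⟨t, ht, hct⟩ := exists_of_joins hp hj
      have g := mul_add_le L hv
      have hdiv : (v * L + t) / L = v := by
        rw [mul_comm, Nat.mul_add_div hp.L_pos, Nat.div_eq_of_lt ht, add_zero]
      refine h' (v * L + t) (by omega) hdiv ?_
      rw [hdiv, hct]
      exact hj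
    · exact Or.inr h
  · exact ⟨(Store.Same.refl _ _ _).setReg W _, Store.setReg_reg_self _ _ _ (by omega),
      fun v hv => Or.inl ⟨h0 v hv, by simp⟩⟩

theorem mainPart_exec (hp : Params n b L W) {s : Store} (hc : Ctx A b L s)
    (h2 : ∀ j < n * L + n * L, s.arr 2 j = ω j) (hω : ∀ j < n * L, ω j < n)
    (h4 : ∀ x, s.arr 4 x = 0) (h5 : ∀ x, s.arr 5 x = 0) (h0 : ∀ v < n, s.arr 0 v = v) :
    Exec W A mainPart s (n * L * (20 * L + 250)) (10 * (n * L)) fun s' =>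
      OutputSpec A b L ω (s'.arr 0) := by
  have g1 := hp.n_le
  have g6 := hp.two_le
  have hT : n * L * (20 * L + 250) = n * L * 15 + n * L * (15 * L + 200) +
      n * L * (5 * L + 25) + n * L * 10 := by ring
  refine Exec.seq (T₁ := n * L * 15 + 3) (T₂ := n * L * (15 * L + 200) +
      n * L * (5 * L + 25) + 4) (Q₁ := n * L) (Q₂ := 9 * (n * L))
    ((sampleLoop_exec hp hc (fun j hj => h2 j (by omega)) hω).mono le_rfl le_rfl ?_) (by omega)
    (by omega)
  rintro s₁ ⟨hs₁, h3₁⟩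
  refine Exec.seq (T₁ := n * L * (15 * L + 200)) (T₂ := n * L * (5 * L + 25) + 3)
    (Q₁ := 9 * (n * L)) (Q₂ := 0) ((centerLoop_exec (ω := ω) hp (hc.same hs₁)
      (fun j hj => by rw [hs₁.2 2 (by decide)]; exact h2 _ (by omega)) h3₁
      (fun x => by rw [hs₁.2 4 (by decide)]; exact h4 x)
      (fun x => by rw [hs₁.2 5 (by decide)]; exact h5 x)).mono le_rfl le_rfl ?_) (by omega) le_rfl
  rintro s₂ ⟨hs₂, h5₂⟩
  exact joinLoop_exec hp ((hc.same hs₁).same hs₂)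
    (fun j hj => by rw [hs₂.2 3 (by decide), h3₁ j hj]) h5₂
    (fun v hv => by rw [hs₂.2 0 (by decide), hs₁.2 0 (by decide), h0 v hv])

theorem setup_exec {c : ℕ} {s : Store} (hp : Params n (c * Nat.size n) (20 * (c * Nat.size n)) W)
    (hr0 : s.reg 0 = n) (hr1 : s.reg 1 = 0) (hcW : c < W) :
    Exec W A (setup c) s (5 * Nat.size n + 20) 0 fun s' =>
      s'.arr = s.arr ∧ s'.reg 0 = n ∧ s'.reg 1 = c * Nat.size n ∧
        s'.reg 2 = 20 * (c * Nat.size n) ∧ s'.reg 3 = n * (20 * (c * Nat.size n)) := by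
  have g1 := hp.n_le
  have g2 := hp.hW
  have g3 := hp.L_le
  have g6 := hp.two_le
  have g7 := hp.one_le
  have hc1 : 1 ≤ c := by
    rcases Nat.eq_zero_or_pos c with rfl | h
    · simp at g7
    · exact h
  have hsz : Nat.size n ≤ c * Nat.size n := Nat.le_mul_of_pos_left _ hc1
  refine Exec.seq (T₁ := 1) (T₂ := 5 * Nat.size n + 18) (Q₁ := 0) (Q₂ := 0)
    (Exec.set (Expr.eval_reg hr0) ?_ le_rfl) (by omega) le_rfl
  -- Repeated halving counts the binary digits of `n`.
  refine Exec.seq (T₁ := 5 * Nat.size n + 1) (T₂ := 5) (Q₁ := 0) (Q₂ := 0)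
    (Exec.for (Nat.size n) 3 0 (fun i s' => Store.Same [1, 4] [] s s' ∧ s'.reg 4 = n / 2 ^ i ∧
      s'.reg 1 = i) ?_ ?_ ?_ (by omega) (by omega)) (by omega) le_rfl
  · rintro i hi s' ⟨hs, hr4, hr1⟩
    have h1 : 2 ^ i ≤ n := Nat.lt_size.1 hi
    have h2 : n / 2 ^ i ≠ 0 := (Nat.div_pos h1 (by positivity)).ne'
    have h3 : n / 2 ^ i ≤ n := Nat.div_le_self _ _
    have h4 : n / 2 ^ i / 2 ≤ n / 2 ^ i := Nat.div_le_self _ _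
    refine ⟨fun h => h2 (hr4.symm.trans h), ?_⟩
    refine Exec.seq (T₁ := 1) (T₂ := 1) (Q₁ := 0) (Q₂ := 0) (Exec.set (Expr.eval_div
      (Expr.eval_reg hr4) (Expr.eval_lit (by omega)) (by omega)) ?_ le_rfl) le_rfl le_rfl
    refine Exec.set (Expr.eval_add (a := i) ((Store.setReg_reg_of_ne _ _ _).trans hr1)
      (Expr.eval_lit (by omega)) (by omega)) ⟨(hs.setReg W _).setReg W _, ?_,
        Store.setReg_reg_self _ _ _ (by omega)⟩ le_rfl
    rw [Store.setReg_reg_of_ne _ _ _, Store.setReg_reg_self _ _ _ (by omega), Nat.div_div_eq_div_mul,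
      pow_succ]
  · rintro s' ⟨hs, hr4, hr1⟩
    have h1 : n / 2 ^ Nat.size n = 0 := Nat.div_eq_of_lt (Nat.lt_size_self n)
    refine ⟨hr4.trans h1, ?_⟩
    have hr0' : s'.reg 0 = n := (hs.1 0 (by decide)).trans hr0
    have ha : s'.arr = s.arr := funext fun x => hs.2 x (by simp)
    refine Exec.seq (T₁ := 1) (T₂ := 3) (Q₁ := 0) (Q₂ := 0) (Exec.set (Expr.eval_mul
      (Expr.eval_lit hcW) (Expr.eval_reg hr1) (by omega)) ?_ le_rfl) le_rfl le_rfl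
    have e1 : (s'.setReg W 1 (c * Nat.size n)).reg 1 = c * Nat.size n :=
      Store.setReg_reg_self _ _ _ (by omega)
    have e0 : (s'.setReg W 1 (c * Nat.size n)).reg 0 = n :=
      (Store.setReg_reg_of_ne _ _ _).trans hr0'
    have ea : (s'.setReg W 1 (c * Nat.size n)).arr = s.arr := ha
    generalize s'.setReg W 1 (c * Nat.size n) = s₁ at e1 e0 ea
    refine Exec.seq (T₁ := 1) (T₂ := 1) (Q₁ := 0) (Q₂ := 0) (Exec.set (Expr.eval_mul
      (Expr.eval_lit (by omega)) (Expr.eval_reg e1) (by omega)) ?_ le_rfl) le_rfl le_rfl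
    have f2 : (s₁.setReg W 2 (20 * (c * Nat.size n))).reg 2 = 20 * (c * Nat.size n) :=
      Store.setReg_reg_self _ _ _ (by omega)
    have f1 : (s₁.setReg W 2 (20 * (c * Nat.size n))).reg 1 = c * Nat.size n :=
      (Store.setReg_reg_of_ne _ _ _).trans e1
    have f0 : (s₁.setReg W 2 (20 * (c * Nat.size n))).reg 0 = n :=
      (Store.setReg_reg_of_ne _ _ _).trans e0
    have fa : (s₁.setReg W 2 (20 * (c * Nat.size n))).arr = s.arr := ea
    generalize s₁.setReg W 2 (20 * (c * Nat.size n)) = s₂ at f2 f1 f0 fa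
    refine Exec.set (Expr.eval_mul (Expr.eval_reg f0) (Expr.eval_reg f2) (by omega))
      ⟨fa, ?_, ?_, ?_, Store.setReg_reg_self _ _ _ (by omega)⟩ le_rfl
    · exact (Store.setReg_reg_of_ne _ _ _).trans f0
    · exact (Store.setReg_reg_of_ne _ _ _).trans f1
    · exact (Store.setReg_reg_of_ne _ _ _).trans f2
  · refine ⟨(Store.Same.refl _ _ _).setReg W _, ?_, (Store.setReg_reg_of_ne _ _ _).trans hr1⟩
    rw [Store.setReg_reg_self _ _ _ (by omega), pow_zero, Nat.div_one]

theorem degreeLoop_exec (hp : Params n b L W) {s : Store} (hr0 : s.reg 0 = n) :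
    Exec W A degreeLoop s (n * 10 + 5) n fun s' => Store.Same [11, 12] [0, 1] s s' ∧
      ∀ v < n, s'.arr 0 v = v ∧ s'.arr 1 v = A.size v := by
  have g1 := hp.n_le
  have g2 := hp.hW
  have g3 := hp.L_le
  have g6 := hp.two_le
  refine Exec.seq (T₁ := 1) (T₂ := n * 10 + 1) (Q₁ := 0)
    (Exec.set (Expr.eval_lit (by omega)) ?_ le_rfl) (by omega) (zero_add _).le
  refine Exec.for n 7 1 (fun i s' => Store.Same [11, 12] [0, 1] s s' ∧ s'.reg 11 = i ∧
    ∀ v < i, s'.arr 0 v = v ∧ s'.arr 1 v = A.size v) ?_ ?_ ?_ (by omega) (by omega)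
  · rintro i hi s' ⟨hs, h11, ha⟩
    have hr0' : s'.reg 0 = n := (hs.1 0 (by decide)).trans hr0
    have hsz := A.size_le hi
    refine ⟨Expr.lt_ne_zero h11 hr0' (by omega) hi, ?_⟩
    refine Exec.seq (T₁ := 1) (T₂ := 5) (Q₁ := 1) (Q₂ := 0)
      (Exec.simple rfl ?_ le_rfl le_rfl) le_rfl le_rfl
    have e12 : ((Prog.deg 12 (.reg 11)).den W A s').reg 12 = A.degAnswer i := by
      simp only [Prog.den, Expr.eval, h11]
      exact Store.setReg_reg_self _ _ _ (by unfold AdjList.size at hsz; omega)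
    have e11 : ((Prog.deg 12 (.reg 11)).den W A s').reg 11 = i :=
      (Store.setReg_reg_of_ne _ _ _).trans h11
    have ea : ((Prog.deg 12 (.reg 11)).den W A s').arr = s'.arr := rfl
    have hs₁ : Store.Same [11, 12] [0, 1] s ((Prog.deg 12 (.reg 11)).den W A s') :=
      hs.setReg W _
    generalize (Prog.deg 12 (.reg 11)).den W A s' = s₁ at e12 e11 ea hs₁
    refine Exec.seq (T₁ := 1) (T₂ := 3) (Q₁ := 0) (Q₂ := 0) (Exec.put (Expr.eval_reg e11)
      (v := A.size i) (Expr.eval_add (Expr.eval_reg e12) (Expr.eval_lit (by omega))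
      (by unfold AdjList.size at hsz; omega)) ?_ le_rfl) le_rfl le_rfl
    refine Exec.seq (T₁ := 1) (T₂ := 1) (Q₁ := 0) (Q₂ := 0) (Exec.put (i := i) (v := i) e11 e11
      ?_ le_rfl) le_rfl le_rfl
    refine Exec.set (Expr.eval_add (a := i) e11 (Expr.eval_lit (by omega)) (by omega))
      ⟨((hs₁.setArr W _ _).setArr W _ _).setReg W _, Store.setReg_reg_self _ _ _ (by omega), ?_⟩
      le_rfl
    intro v hv
    rw [Store.setReg_arr, Store.setArr_arr_self _ _ _ _ (by omega), Store.setArr_arr_of_ne _ _ _ _,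
      Store.setArr_arr_of_ne _ _ _ _, Store.setArr_arr_self _ _ _ _ (by omega), ea]
    simp only [Function.update_apply]
    by_cases hvi : v = i
    · simp [hvi]
    · simp only [if_neg hvi]
      exact ha v (by omega)
  · rintro s' ⟨hs, h11, ha⟩
    exact ⟨Expr.lt_eq_zero h11 ((hs.1 0 (by decide)).trans hr0) (by omega) le_rfl, hs, ha⟩
  · exact ⟨(Store.Same.refl _ _ _).setReg W _, Store.setReg_reg_self _ _ _ (by omega), by simp⟩

/-- Every run of the program halts in time, and it fails with at most the average probability that
some output with the right specification is not in `S`. -/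
theorem clusterProg_halts {c : ℕ} (hL : L = 20 * b) (hb : b = c * Nat.size n)
    (hp : Params n b L W) (hcW : c < W) {S : Set Store} {φ : (ℕ → ℕ) → ℝ} (hφ : ∀ ω, 0 ≤ φ ω)
    (hS : ∀ ω s, OutputSpec A b L ω (s.arr 0) → s ∉ S → 1 ≤ φ ω) {s : Store}
    (hr : s.reg = Function.update (fun _ => 0) 0 n) (ha : s.arr = fun _ _ => 0) :
    Halts W A S (11 * (n * L)) ⟨[clusterProg c], s, 0⟩ (n * L * (20 * L + 300) + 50)
      (avg (tapeBound A L) φ (n * L + n * L) 0 fun _ => 0) := by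
  have g1 := hp.n_le
  have g2 := hp.hW
  have g3 := hp.L_le
  have g6 := hp.two_le
  have g8 := hp.L_pos
  have hszn : Nat.size n ≤ L := by
    have g7 := hp.one_le
    have hc1 : 1 ≤ c := by
      rcases Nat.eq_zero_or_pos c with rfl | h
      · simp at hb
        omega
      · exact h
    have : Nat.size n ≤ c * Nat.size n := Nat.le_mul_of_pos_left _ hc1
    omega
  have hT : n * L * (20 * L + 300) = n * L * (20 * L + 250) + n * L * 50 := by ring
  refine Halts.of_pure (t := 0) (B := (n * L * (20 * L + 250) + 1 + (n * L + n * L) * (3 + 3)) +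
    1 + 1 + 1 + (n * 10 + 5) + 1 + (5 * Nat.size n + 20) + 1) rfl (Halts.seq
    (Halts.exec (Q₁ := 0) (setup_exec (A := A) (by rw [← hb, ← hL]; exact hp)
      (by simp [hr]) (by simp [hr]) hcW) ?_ le_rfl)) (by omega)
  rintro s₁ q₁ ⟨ha₁, r0, r1, r2, r3⟩ hq₁
  rw [← hb] at r1 r2 r3
  rw [← hL] at r2 r3
  refine Halts.seq (Halts.exec (degreeLoop_exec hp r0) ?_ le_rfl)
  rintro s₂ q₂ ⟨hs₂, h01⟩ hq₂
  have hc₂ : Ctx A b L s₂ := ⟨(hs₂.1 0 (by decide)).trans r0, (hs₂.1 1 (by decide)).trans r1,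
    (hs₂.1 2 (by decide)).trans r2, (hs₂.1 3 (by decide)).trans r3, fun v hv => (h01 v hv).2⟩
  refine Halts.seq (Halts.exec (T := 1) (Q₁ := 0) (R := fun s' => s' = s₂.setReg W 4 0)
    (Exec.set (Expr.eval_lit (by omega)) rfl le_rfl) ?_ le_rfl)
  rintro s₃ q₃ rfl hq₃
  -- All randomness of the run is consumed in this loop. The bound `q := n` covers the degree
  -- queries made so far, and for each completed tape the rest is deterministic.
  refine Halts.seq (Halts.rand_loop (q := n) hφ (fun j ω s' =>
    Store.Same [4, 12] [2] s₂ s' ∧ s'.reg 4 = j ∧ ∀ i < j, s'.arr 2 i = ω i ∧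
      ω i ≤ tapeBound A L i) ?_ ?_ (n * L + n * L) 0 (zero_add _) _ _ ?_ q₃ (by omega))
  · rintro j hj ω s' ⟨hs, hr4, hω⟩
    have hc' := hc₂.same hs
    have hmod : j / L % n < n := Nat.mod_lt _ (by omega)
    have hsz := A.size_le hmod
    have hdiv : j / L ≤ j := Nat.div_le_self _ _
    refine ⟨Expr.lt_ne_zero hr4 (Expr.eval_add (Expr.eval_reg hc'.r3) (Expr.eval_reg hc'.r3)
      (by omega)) (by omega) hj, ?_, fun r hrm => ?_⟩
    · refine Expr.eval_sub ?_ (Expr.eval_lit (by omega)) (by omega)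
      rw [Expr.eval_get (Expr.eval_mod (Expr.eval_div (Expr.eval_reg hr4) (Expr.eval_reg hc'.r2)
        (by omega)) (Expr.eval_reg hc'.r0) (by omega)), hc'.d _ hmod]
    · have hrn : r < n := by unfold tapeBound at hrm; omega
      have e4 : (s'.setReg W 12 r).reg 4 = j := (Store.setReg_reg_of_ne _ _ _).trans hr4
      refine Exec.seq (T₁ := 1) (T₂ := 1) (Q₁ := 0) (Q₂ := 0) (Exec.put (Expr.eval_reg e4)
        (Expr.eval_reg (Store.setReg_reg_self _ _ _ (by omega))) ?_ le_rfl) le_rfl le_rfl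
      refine Exec.set (Expr.eval_add (a := j) e4 (Expr.eval_lit (by omega)) (by omega))
        ⟨((hs.setReg W _).setArr W _ _).setReg W _, Store.setReg_reg_self _ _ _ (by omega), ?_⟩
        le_rfl
      intro i hi
      rw [Store.setReg_arr, Store.setArr_arr_self _ _ _ _ (by omega), Store.setReg_arr]
      simp only [Function.update_apply]
      by_cases hij : i = j
      · subst hij
        simpa using hrm
      · simp only [if_neg hij]
        exact hω i (by omega)
  · rintro ω s' ⟨hs, hr4, hω⟩
    have hc' := hc₂.same hs
    refine ⟨Expr.lt_eq_zero hr4 (Expr.eval_add (Expr.eval_reg hc'.r3) (Expr.eval_reg hc'.r3)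
      (by omega)) (by omega) le_rfl, fun q' hq' => ?_⟩
    have harr : ∀ a, a ∉ [0, 1, 2] → ∀ x, s'.arr a x = 0 := by
      intro a ha' x
      simp only [List.mem_cons, List.not_mem_nil, or_false, not_or] at ha'
      rw [hs.2 a (by simp [ha']), hs₂.2 a (by simp [ha']), ha₁, ha]
    refine Halts.exec (B := 0) (mainPart_exec (ω := ω) hp hc' (fun j hj => (hω j hj).1)
      (fun j hj => ?_) (harr 4 (by decide)) (harr 5 (by decide))
      (fun v hv => by rw [hs.2 0 (by decide)]; exact (h01 v hv).1)) (fun s₄ q₄ h₄ hq₄ => ?_)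
      (by omega)
    · have h1 := (hω j (by omega)).2
      have h2 : A.size (j / L % n) ≤ n := A.size_le (Nat.mod_lt _ (by omega))
      unfold tapeBound at h1
      omega
    · exact Halts.nil (by omega) (hS ω s₄ h₄)
  · exact ⟨(Store.Same.refl _ _ _).setReg W _, Store.setReg_reg_self _ _ _ (by omega), by simp⟩

end Verify

/-! ### Typical tapes -/

section Typical

variable {n : ℕ} {G : LabeledGraph n} {A : AdjList G.pos} {b L : ℕ} {ω : ℕ → ℕ}

theorem AdjList.near_iff (A : AdjList G.pos) (w x : Fin n) :
    A.near w x ↔ x ∈ closedNbhd G w := by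
  have hsz : A.size w = (A.nbrs w).length + 1 := by
    simp [AdjList.size, AdjList.degAnswer]
  have hentry : ∀ i (h : i < (A.nbrs w).length), A.entry w i = ((A.nbrs w)[i] : ℕ) := by
    intro i h
    have h1 : ¬ i + 1 = A.size w := by omega
    simp only [AdjList.entry, h1, if_false, AdjList.nbrAnswer, w.isLt, dif_pos, Fin.eta]
    rw [List.getD_eq_getElem _ _ (by simpa using h)]
    simp
  rw [mem_closedNbhd]
  constructor
  · rintro ⟨i, hi, he⟩
    by_cases h : i + 1 = A.size w
    · rw [AdjList.entry, if_pos h] at he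
      exact Or.inl (Fin.ext he.symm)
    · rw [hentry i (by omega)] at he
      rw [← Fin.ext he]
      exact Or.inr ((A.mem_nbrs _ _).1 (List.getElem_mem _))
  · rintro (rfl | h)
    · exact ⟨A.size x - 1, by omega, by rw [AdjList.entry, if_pos (by omega)]⟩
    · obtain ⟨i, hi, he⟩ := List.getElem_of_mem ((A.mem_nbrs _ _).2 h)
      exact ⟨i, by omega, by rw [hentry i hi, he]⟩

theorem AdjList.near_iff_exists (A : AdjList G.pos) (w : Fin n) (x : ℕ) :
    A.near w x ↔ ∃ y ∈ closedNbhd G w, (y : ℕ) = x := by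
  constructor
  · intro h
    have hx := A.near_lt w.isLt h
    exact ⟨⟨x, hx⟩, (A.near_iff w ⟨x, hx⟩).1 h, rfl⟩
  · rintro ⟨y, hy, rfl⟩
    exact (A.near_iff w y).2 hy

/-- The entries enumerate the closed neighborhood without repetition, so a uniform index yields a
uniform member, and counts of indices become cardinalities. -/
theorem AdjList.card_filter_entry (A : AdjList G.pos) (v : Fin n) (P : ℕ → Prop)
    [DecidablePred fun r => P (A.entry v r)] [DecidablePred fun u : Fin n => P u] :
    {r ∈ Finset.range (A.size v) | P (A.entry v r)}.card =
      ((closedNbhd G v).filter fun u : Fin n => P u).card := by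
  refine Finset.card_bij (fun r _ => ⟨A.entry v r, A.entry_lt v.isLt r⟩) ?_ ?_ ?_
  · intro r hr
    rw [Finset.mem_filter, Finset.mem_range] at hr
    exact Finset.mem_filter.2 ⟨(A.near_iff v _).1 ⟨r, hr.1, rfl⟩, hr.2⟩
  · intro r hr r' hr' h
    rw [Finset.mem_filter, Finset.mem_range] at hr hr'
    exact A.entry_inj v.isLt hr.1 hr'.1 (congrArg Fin.val h)
  · intro u hu
    rw [Finset.mem_filter] at hu
    obtain ⟨r, hr, he⟩ := (A.near_iff v u).2 hu.1
    refine ⟨r, Finset.mem_filter.2 ⟨Finset.mem_range.2 hr, ?_⟩, Fin.ext he⟩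
    rw [he]
    exact hu.2

theorem AdjList.size_eq (A : AdjList G.pos) (v : Fin n) : A.size v = (closedNbhd G v).card := by
  classical
  have := A.card_filter_entry v fun _ => True
  rwa [Finset.filter_true, Finset.filter_true, Finset.card_range] at this

/-- The entry `r` of the closed neighborhood of `v` belongs to `X`. -/
def hits (A : AdjList G.pos) (v : ℕ) (X : Finset (Fin n)) (r : ℕ) : Prop :=
  ∃ u ∈ X, (u : ℕ) = A.entry v r

open Classical in
theorem card_not_hits (A : AdjList G.pos) (v : Fin n) (X : Finset (Fin n)) :
    {r ∈ Finset.range (A.size v) | ¬ hits A v X r}.card = (closedNbhd G v \ X).card := by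
  have h : {r ∈ Finset.range (A.size v) | ¬ hits A v X r} =
      {r ∈ Finset.range (A.size v) | ¬ ∃ u ∈ X, (u : ℕ) = A.entry v r} := by
    ext r
    rw [Finset.mem_filter, Finset.mem_filter]
    rfl
  rw [h]
  refine (A.card_filter_entry v fun x => ¬ ∃ u ∈ X, (u : ℕ) = x).trans (congrArg _ ?_)
  ext u
  simp only [Finset.mem_filter, Finset.mem_sdiff, and_congr_right_iff]
  refine fun _ => not_congr ⟨?_, fun h => ⟨u, h, rfl⟩⟩
  rintro ⟨y, hy, he⟩
  rwa [← Fin.ext he]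

/-- The number of samples of `v` outside `X`. -/
def misses (A : AdjList G.pos) (L : ℕ) (ω : ℕ → ℕ) (v : Fin n) (X : Finset (Fin n)) : ℕ :=
  failures (hits A v X) (v * L) L ω

theorem missCount_eq_misses (w u : Fin n) :
    missCount A L ω w u = misses A L ω u (closedNbhd G w) := by
  unfold missCount misses
  congr 1
  funext r
  exact propext (A.near_iff_exists w _)

theorem failures_mono {Q Q' : ℕ → Prop} (h : ∀ r, Q r → Q' r) (a L : ℕ) (ω : ℕ → ℕ) :
    failures Q' a L ω ≤ failures Q a L ω := by
  classical
  unfold failures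
  refine Finset.card_le_card fun t ht => ?_
  simp only [Finset.mem_filter] at ht ⊢
  exact ⟨ht.1, fun h' => ht.2 (h _ h')⟩

theorem exists_and_of_failures_lt {Q Q' : ℕ → Prop} {a L : ℕ} {ω : ℕ → ℕ}
    (h : failures Q a L ω + failures Q' a L ω < L) : ∃ t < L, Q (ω (a + t)) ∧ Q' (ω (a + t)) := by
  classical
  by_contra! hno
  have h1 : (Finset.range L).card ≤ failures Q a L ω + failures Q' a L ω := by
    unfold failures
    refine le_trans (Finset.card_le_card fun t ht => ?_) (Finset.card_union_le _ _)
    simp only [Finset.mem_union, Finset.mem_filter]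
    by_cases hq : Q (ω (a + t))
    · exact Or.inr ⟨ht, hno t (Finset.mem_range.1 ht) hq⟩
    · exact Or.inl ⟨ht, hq⟩
  rw [Finset.card_range] at h1
  omega

/-- The properties of the tape that the analysis needs; each of them is very likely. -/
structure TypicalTape (A : AdjList G.pos) (C : Clustering n) (b L : ℕ) (ω : ℕ → ℕ) : Prop where
  strict_complete : ∀ v w, 80 * (closedNbhd G v \ closedNbhd G w).card ≤ (closedNbhd G v).card →
    misses A L ω v (closedNbhd G w) ≤ b
  strict_sound : ∀ v w, misses A L ω v (closedNbhd G w) ≤ b →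
    10 * (closedNbhd G v \ closedNbhd G w).card ≤ (closedNbhd G v).card
  loose_complete : ∀ v w,
    20 * (closedNbhd G v \ closedNbhd G w).card ≤ 3 * (closedNbhd G v).card →
    misses A L ω v (closedNbhd G w) ≤ 5 * b
  loose_sound : ∀ v w, misses A L ω v (closedNbhd G w) ≤ 5 * b →
    5 * (closedNbhd G v \ closedNbhd G w).card ≤ 2 * (closedNbhd G v).card
  join_complete : ∀ v w,
    20 * (closedNbhd G v \ (closedNbhd G w ∩ goodPart (closedNbhd G) C v)).card ≤
      3 * (closedNbhd G v).card →
    misses A L ω v (closedNbhd G w ∩ goodPart (closedNbhd G) C v) ≤ 5 * b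
  cover : ∀ v, Regular (closedNbhd G) C v →
    ∃ w ∈ goodPart (closedNbhd G) C v, ∃ t < L, ω (n * L + (w * L + t)) = 0
  budget : ∑ j ∈ Finset.range (n * L), (if ω (n * L + j) = 0 then A.size (j / L) else 0) ≤
    3 * (n * L)

/-- If all centers together fit into the budget, none is ever refused, so exactly their total size
is spent. -/
theorem budget_invariant (hb : ∑ j ∈ Finset.range (n * L),
      (if ω (n * L + j) = 0 then A.size (j / L) else 0) ≤ 3 * (n * L)) {j : ℕ} (hj : j ≤ n * L) :
    (tagRun A b L ω j).2 +
      ∑ i ∈ Finset.range j, (if ω (n * L + i) = 0 then A.size (i / L) else 0) = 3 * (n * L) := by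
  induction j with
  | zero => simp [tagRun]
  | succ j ih =>
    have h1 := ih (by omega)
    have h2 : ∑ i ∈ Finset.range (j + 1), (if ω (n * L + i) = 0 then A.size (i / L) else 0) ≤
        ∑ j ∈ Finset.range (n * L), (if ω (n * L + j) = 0 then A.size (j / L) else 0) :=
      Finset.sum_le_sum_of_subset (Finset.range_mono hj)
    rw [Finset.sum_range_succ] at h2 ⊢
    rw [tagRun]
    by_cases h0 : ω (n * L + j) = 0
    · simp only [h0, if_true, true_and] at h2 ⊢
      rw [if_pos (by omega)]
      dsimp only
      omega
    · simp only [h0, if_false, false_and]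
      omega

theorem size_le_budget (hb : ∑ j ∈ Finset.range (n * L),
      (if ω (n * L + j) = 0 then A.size (j / L) else 0) ≤ 3 * (n * L)) {j : ℕ} (hj : j < n * L)
    (h0 : ω (n * L + j) = 0) : A.size (j / L) ≤ (tagRun A b L ω j).2 := by
  have h1 := budget_invariant (b := b) hb hj.le
  have h2 : ∑ i ∈ Finset.range (j + 1), (if ω (n * L + i) = 0 then A.size (i / L) else 0) ≤
      ∑ j ∈ Finset.range (n * L), (if ω (n * L + j) = 0 then A.size (j / L) else 0) :=
    Finset.sum_le_sum_of_subset (Finset.range_mono hj)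
  rw [Finset.sum_range_succ, if_pos h0] at h2
  omega

/-- At step `j` a center distributes its tag. -/
def VerifiedAt (A : AdjList G.pos) (b L : ℕ) (ω : ℕ → ℕ) (j : ℕ) : Prop :=
  (ω (n * L + j) = 0 ∧ A.size (j / L) ≤ (tagRun A b L ω j).2) ∧
    9 * A.size (j / L) ≤ 10 * strictCount A b L ω (tagRun A b L ω j).1 (j / L) (A.size (j / L))

open Classical in
theorem tagRun_succ_of_verified {j : ℕ} (h : VerifiedAt A b L ω j) (x : ℕ) :
    (tagRun A b L ω (j + 1)).1 x =
      if A.near (j / L) x ∧ (tagRun A b L ω j).1 x = 0 ∧ Loose A b L ω x (j / L) then n + j / L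
      else (tagRun A b L ω j).1 x := by
  rw [tagRun, if_pos h.1]
  simp only [tagStep, if_pos h.2]

theorem tagRun_succ_of_not_verified {j : ℕ} (h : ¬ VerifiedAt A b L ω j) :
    (tagRun A b L ω (j + 1)).1 = (tagRun A b L ω j).1 := by
  rw [tagRun]
  split_ifs with h1
  · have : ¬ 9 * A.size (j / L) ≤
      10 * strictCount A b L ω (tagRun A b L ω j).1 (j / L) (A.size (j / L)) := fun h2 => h ⟨h1, h2⟩
    simp only [tagStep, if_neg this]
  · rfl

/-- Only untagged vertices are tagged, so a tag is permanent. This links the final tags with those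
seen while a center is processed. -/
theorem tagRun_eq_of_ne_zero {i j x : ℕ} (hij : i ≤ j) (h : (tagRun A b L ω i).1 x ≠ 0) :
    (tagRun A b L ω j).1 x = (tagRun A b L ω i).1 x := by
  induction j, hij using Nat.le_induction with
  | base => rfl
  | succ j hj ih =>
    rw [← ih]
    by_cases hv : VerifiedAt A b L ω j
    · rw [tagRun_succ_of_verified hv, if_neg]
      rintro ⟨-, h0, -⟩
      exact h (ih ▸ h0)
    · rw [tagRun_succ_of_not_verified hv]

theorem exists_verified_of_tag {j x : ℕ} (h : (tagRun A b L ω j).1 x ≠ 0) :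
    ∃ i < j, VerifiedAt A b L ω i ∧ (tagRun A b L ω j).1 x = n + i / L ∧ A.near (i / L) x ∧
      Loose A b L ω x (i / L) := by
  classical
  induction j with
  | zero => exact absurd rfl h
  | succ j ih =>
    by_cases h0 : (tagRun A b L ω j).1 x = 0
    · by_cases hv : VerifiedAt A b L ω j
      · rw [tagRun_succ_of_verified hv] at h ⊢
        by_cases hc : A.near (j / L) x ∧ (tagRun A b L ω j).1 x = 0 ∧ Loose A b L ω x (j / L)
        · exact ⟨j, by omega, hv, if_pos hc, hc.1, hc.2.2⟩
        · rw [if_neg hc] at h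
          exact absurd h0 h
      · rw [tagRun_succ_of_not_verified hv] at h
        exact absurd h0 h
    · obtain ⟨i, hi, h1, h2, h3⟩ := ih h0
      refine ⟨i, by omega, h1, ?_, h3⟩
      rw [tagRun_eq_of_ne_zero (Nat.le_succ j) h0]
      exact h2

theorem strict_loose {u w : ℕ} (h : Strict A b L ω u w) : Loose A b L ω u w := by
  obtain ⟨h1, h2⟩ := h
  exact ⟨by omega, by omega⟩

open Classical in
theorem strictCount_eq (tag : ℕ → ℕ) (w : Fin n) :
    strictCount A b L ω tag w (A.size w) =
      ((closedNbhd G w).filter fun u : Fin n => tag u = 0 ∧ Strict A b L ω u w).card := by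
  unfold strictCount
  exact A.card_filter_entry w fun x => tag x = 0 ∧ Strict A b L ω x w

theorem joins_range {W : ℕ} (hp : Params n b L W) {v c : ℕ} (h : Joins A b L ω v c) :
    ∃ w : Fin n, c = n + w := by
  obtain ⟨t, -, hc⟩ := exists_of_joins hp h
  rcases tagRun_range (A := A) (b := b) (ω := ω) (le_refl (n * L))
    (A.entry v (ω (v * L + t))) with h0 | ⟨w, hw, hw'⟩
  · exact absurd (hc.symm.trans h0) h.1
  · exact ⟨⟨w, hw⟩, hc.symm.trans hw'⟩

/-- Each of the two tags is missed by at most 5b of the 20b samples, so some sample carries both. -/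
theorem joins_unique {W : ℕ} (hp : Params n b L W) {v c c' : ℕ} (h : Joins A b L ω v c)
    (h' : Joins A b L ω v c') : c = c' := by
  have h1 := hp.hL
  have h2 := hp.one_le
  have h3 := h.2.1
  have h4 := h'.2.1
  obtain ⟨t, -, e, e'⟩ := exists_and_of_failures_lt (show _ + _ < L by omega : failures
    (fun r => finalTag A b L ω (A.entry v r) = c) (v * L) L ω + failures
    (fun r => finalTag A b L ω (A.entry v r) = c') (v * L) L ω < L)
  exact e.symm.trans e'

/-- The interface between probability and combinatorics: on a typical tape the sampled tests have
the guarantees assumed in `TagFacts`, and no center is lost to the budget. -/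
theorem TypicalTape.tagFacts {W : ℕ} (hp : Params n b L W) {C : Clustering n}
    (hω : TypicalTape A C b L ω) :
    TagFacts (closedNbhd G) C (fun u w => Strict A b L ω u w) (fun u w => Loose A b L ω u w)
      (fun u w => finalTag A b L ω u = n + w) (fun v w => Joins A b L ω v (n + w))
      (fun w => ∃ t < L, ω (n * L + (w * L + t)) = 0)
      (fun w => ∃ j < n * L, j / L = w ∧ VerifiedAt A b L ω j) where
  strict_sound u w h := by
    rw [← A.size_eq, ← A.size_eq]
    refine ⟨?_, h.2⟩
    rw [A.size_eq]
    exact hω.strict_sound u w (by rw [← missCount_eq_misses]; exact h.1)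
  strict_complete u w h1 h2 := by
    refine ⟨?_, by rw [A.size_eq, A.size_eq]; exact h2⟩
    rw [missCount_eq_misses]
    exact hω.strict_complete u w h1
  loose_sound u w h := by
    rw [← A.size_eq, ← A.size_eq]
    refine ⟨?_, h.2⟩
    rw [A.size_eq]
    exact hω.loose_sound u w (by rw [← missCount_eq_misses]; exact h.1)
  loose_complete u w h1 h2 := by
    refine ⟨?_, by rw [A.size_eq, A.size_eq]; exact h2⟩
    rw [missCount_eq_misses]
    exact hω.loose_complete u w h1
  tag_unique u w w' h h' := by
    have := h.symm.trans h'
    exact Fin.ext (by omega)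
  tag_spec u w h := by
    have hn := hp.two_le
    obtain ⟨j, hj, hv, he, hnear, hl⟩ := exists_verified_of_tag
      (show (tagRun A b L ω (n * L)).1 u ≠ 0 from h.trans_ne (by omega))
    have hjw : j / L = w := by
      have := he.symm.trans h
      omega
    rw [hjw] at hnear hl
    exact ⟨⟨j, hj, hjw, hv⟩, (A.near_iff w u).1 hnear, hl⟩
  tag_total u w hver hu hl := by
    classical
    have hn := hp.two_le
    obtain ⟨j, hj, hjw, hv⟩ := hver
    have h1 : (tagRun A b L ω (j + 1)).1 u ≠ 0 := by
      rw [tagRun_succ_of_verified hv, hjw]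
      split_ifs with h
      · omega
      · exact fun h0 => h ⟨(A.near_iff w u).2 hu, h0, hl⟩
    have h2 : (tagRun A b L ω (n * L)).1 u ≠ 0 := by
      rwa [tagRun_eq_of_ne_zero (by omega : j + 1 ≤ n * L) h1]
    rcases tagRun_range (A := A) (b := b) (ω := ω) (le_refl (n * L)) u with h0 | ⟨v, hv, h0⟩
    · exact absurd h0 h2
    · exact ⟨⟨v, hv⟩, h0⟩
  ver_core w hver := by
    classical
    have hn := hp.two_le
    obtain ⟨j, hj, hjw, hv⟩ := hver
    refine ⟨(closedNbhd G w).filter fun u : Fin n =>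
        (tagRun A b L ω j).1 u = 0 ∧ Strict A b L ω u w,
      Finset.filter_subset _ _, ?_, fun u hu => ?_⟩
    · have h1 := hv.2
      rw [hjw, strictCount_eq, A.size_eq] at h1
      exact h1
    · obtain ⟨h1, h2, h3⟩ := Finset.mem_filter.1 hu
      refine ⟨h3, ?_⟩
      have h4 : (tagRun A b L ω (j + 1)).1 u = n + w := by
        rw [tagRun_succ_of_verified hv, hjw, if_pos ⟨(A.near_iff w u).2 h1, h2, strict_loose h3⟩]
      have h5 := tagRun_eq_of_ne_zero (by omega : j + 1 ≤ n * L) (h4.trans_ne (by omega))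
      exact h5.trans h4
  not_ver w hcen hver K hK hKs := by
    classical
    obtain ⟨t, ht, h0⟩ := hcen
    have hj := mul_add_le L w.isLt
    have hjw : (w * L + t) / L = w := by
      rw [mul_comm, Nat.mul_add_div hp.L_pos, Nat.div_eq_of_lt ht, add_zero]
    have h1 : ¬ VerifiedAt A b L ω (w * L + t) := fun h => hver ⟨_, by omega, hjw, h⟩
    have h2 : ¬ 9 * A.size w ≤ 10 * strictCount A b L ω (tagRun A b L ω (w * L + t)).1 w
        (A.size w) := by
      -- The budget suffices for `w`, so a rejection can only be due to the count of strictly close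
      -- vertices.
      intro h
      refine h1 ⟨⟨h0, size_le_budget hω.budget (by omega) h0⟩, ?_⟩
      rw [hjw]
      exact h
    rw [strictCount_eq, A.size_eq] at h2
    have h3 : K.card ≤ ((closedNbhd G w).filter fun u : Fin n =>
        (tagRun A b L ω (w * L + t)).1 u = 0 ∧ Strict A b L ω u w).card := by
      refine Finset.card_le_card fun u hu => Finset.mem_filter.2 ⟨hK hu, ?_, (hKs u hu).1⟩
      by_contra hne
      have h4 := tagRun_eq_of_ne_zero (by omega : w * L + t ≤ n * L) hne
      rcases tagRun_range (A := A) (b := b) (ω := ω) (le_refl (n * L)) u with h5 | ⟨v, hv, h5⟩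
      · exact hne (h4.symm.trans h5)
      · exact (hKs u hu).2 ⟨v, hv⟩ h5
    omega
  join_sound v w h := by
    have hn := hp.two_le
    have hspec : ∀ x, finalTag A b L ω x = n + w →
        (∃ j < n * L, j / L = w ∧ VerifiedAt A b L ω j) ∧ A.near w x := by
      intro x hx
      obtain ⟨j, hj, hv, he, hnear, -⟩ := exists_verified_of_tag
        (show (tagRun A b L ω (n * L)).1 x ≠ 0 from hx.trans_ne (by omega))
      have hjw : j / L = w := by
        have := he.symm.trans hx
        omega
      rw [hjw] at hnear
      exact ⟨⟨j, hj, hjw, hv⟩, hnear⟩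
    obtain ⟨t, -, ht⟩ := exists_of_joins hp h
    refine ⟨(hspec _ ht).1, hω.loose_sound v w ?_, ?_⟩
    -- A vertex with the tag of `w` lies in `N w`, so the samples of `v` outside `N w` are among the
    -- counted failures.
    · rw [← missCount_eq_misses]
      exact (failures_mono (fun r hr => (hspec _ hr).2) _ _ _).trans h.2.1
    · have := h.2.2
      rw [Nat.add_sub_cancel_left, A.size_eq, A.size_eq] at this
      exact this
  join_complete v w h1 h2 h3 := by
    have hn := hp.two_le
    refine ⟨by omega, ?_, ?_⟩
    -- Conversely, every sample that hits the fixed set `N w ∩ goodPart` carries the tag, so the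
    -- failures are among the misses of that set.
    · refine (failures_mono (fun r hr => ?_) _ _ _).trans (hω.join_complete v w h2)
      obtain ⟨u, hu, he⟩ := hr
      rw [← he]
      exact h1 u hu
    · rw [Nat.add_sub_cancel_left, A.size_eq, A.size_eq]
      exact h3
  join_unique v w w' h h' := by
    have := joins_unique hp h h'
    exact Fin.ext (by omega)
  cover := hω.cover

theorem TypicalTape.isApprox {W : ℕ} (hp : Params n b L W) {C : Clustering n}
    (hC : ∀ C', cost G C ≤ cost G C') (hω : TypicalTape A C b L ω) {out : ℕ → ℕ}
    (hout : OutputSpec A b L ω out) :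
    IsApprox 1000000 G (Setoid.ker fun v : Fin n => out v) := by
  refine isApprox_of_cost_le (by norm_num) hC (cost_le_of_tagFacts (hω.tagFacts hp) ?_)
  have hn := hp.two_le
  intro u v
  rw [Setoid.ker_def]
  constructor
  · intro h
    rcases hout u u.isLt with ⟨hu, -⟩ | hu
    · rcases hout v v.isLt with ⟨hv, -⟩ | hv
      · exact Or.inl (Fin.ext (hu.symm.trans (h.trans hv)))
      -- Names of singletons are below `n`, names of joined clusters are not.
      · obtain ⟨w, hw⟩ := joins_range hp hv
        have := u.isLt
        omega
    · obtain ⟨w, hw⟩ := joins_range hp hu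
      rcases hout v v.isLt with ⟨hv, -⟩ | hv
      · have := v.isLt
        omega
      · rw [← h] at hv
        rw [hw] at hu hv
        exact Or.inr ⟨w, hu, hv⟩
  · rintro (rfl | ⟨w, hu, hv⟩)
    · rfl
    · have key : ∀ x : Fin n, Joins A b L ω x (n + w) → out x = n + w := by
        intro x hx
        rcases hout x x.isLt with ⟨-, h⟩ | h
        · exact absurd hx (h _)
        · exact joins_unique hp h hx
      rw [key u hu, key v hv]

end Typical

/-! ### Atypical tapes are unlikely -/

open Classical in
/-- The probability of `E` when the first `N` entries of the tape are random. -/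
def prob (m : ℕ → ℕ) (N : ℕ) (E : (ℕ → ℕ) → Prop) : ℝ :=
  avg m (fun ω => if E ω then 1 else 0) N 0 fun _ => 0

section Prob

variable {m : ℕ → ℕ} {N : ℕ}

theorem prob_eq_avg (E : (ℕ → ℕ) → Prop) [DecidablePred E] :
    prob m N E = avg m (fun ω => if E ω then 1 else 0) N 0 fun _ => 0 := by
  unfold prob
  congr! 3

theorem prob_mono {E F : (ℕ → ℕ) → Prop} (h : ∀ ω, E ω → F ω) : prob m N E ≤ prob m N F := by
  classical
  refine avg_mono (fun ω => ?_) _ _ _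
  split_ifs with h1 h2 h2
  · rfl
  · exact absurd (h ω h1) h2
  · exact zero_le_one
  · rfl

theorem prob_false : prob m N (fun _ => False) = 0 := by
  classical
  have h := avg_mul_const (m := m) (fun _ => (1 : ℝ)) 0 N 0 fun _ => 0
  unfold prob
  simpa using h

theorem prob_not_and_le (E F : (ℕ → ℕ) → Prop) :
    prob m N (fun ω => ¬ (E ω ∧ F ω)) ≤ prob m N (fun ω => ¬ E ω) + prob m N (fun ω => ¬ F ω) := by
  classical
  unfold prob
  rw [← avg_add]
  refine avg_mono (fun ω => ?_) _ _ _
  by_cases h1 : E ω <;> by_cases h2 : F ω <;> simp [h1, h2]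

theorem prob_not_forall_le {ι : Type*} [Fintype ι] (E : ι → (ℕ → ℕ) → Prop) {δ : ℝ}
    (h : ∀ i, prob m N (fun ω => ¬ E i ω) ≤ δ) :
    prob m N (fun ω => ¬ ∀ i, E i ω) ≤ Fintype.card ι * δ := by
  classical
  calc prob m N (fun ω => ¬ ∀ i, E i ω)
      ≤ avg m (fun ω => ∑ i, if ¬ E i ω then 1 else 0) N 0 fun _ => 0 := by
        refine avg_mono (fun ω => ?_) _ _ _
        split_ifs with h1
        · push Not at h1
          obtain ⟨i, hi⟩ := h1
          have h2 := Finset.single_le_sum (f := fun i => if ¬ E i ω then (1 : ℝ) else 0)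
            (fun i _ => by split_ifs <;> norm_num) (Finset.mem_univ i)
          simpa [hi] using h2
        · exact Finset.sum_nonneg fun i _ => by split_ifs <;> norm_num
    _ = ∑ i, prob m N (fun ω => ¬ E i ω) := by
        rw [avg_sum]
        exact Finset.sum_congr rfl fun i _ => (prob_eq_avg _).symm
    _ ≤ ∑ _i : ι, δ := Finset.sum_le_sum fun i _ => h i
    _ = Fintype.card ι * δ := by rw [Finset.sum_const, nsmul_eq_mul, Finset.card_univ]

theorem prob_not_imp_le {P : Prop} {E : (ℕ → ℕ) → Prop} {δ : ℝ} (hδ : 0 ≤ δ)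
    (h : P → prob m N (fun ω => ¬ E ω) ≤ δ) : prob m N (fun ω => ¬ (P → E ω)) ≤ δ := by
  by_cases hP : P
  · exact (prob_mono fun ω h' hE => h' fun _ => hE).trans (h hP)
  · refine (prob_mono (F := fun _ => False) fun ω h' => h' fun hP' => absurd hP' hP).trans ?_
    rw [prob_false]
    exact hδ

end Prob

/-! ### Tail bounds for the single events, and their union -/

section Atypical

variable {n : ℕ} {G : LabeledGraph n} (A : AdjList G.pos) {b L : ℕ}

theorem tapeBound_sample (v : Fin n) {t : ℕ} (ht : t < L) :
    tapeBound A L (v * L + t) + 1 = A.size v := by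
  have h1 : (v * L + t) / L = v := by
    rw [mul_comm, Nat.mul_add_div (by omega), Nat.div_eq_of_lt ht, add_zero]
  have h2 := A.size_pos v
  rw [tapeBound, h1, Nat.mod_eq_of_lt v.isLt]
  omega

theorem tapeBound_center {j : ℕ} (hj : j < n * L) :
    tapeBound A L (n * L + j) + 1 = A.size (j / L) := by
  have hL : 0 < L := Nat.pos_of_ne_zero fun h => by simp [h] at hj
  have h1 : (n * L + j) / L = n + j / L := by
    rw [mul_comm, Nat.mul_add_div hL]
  have h2 := A.size_pos (j / L)
  rw [tapeBound, h1, Nat.add_mod_left, Nat.mod_eq_of_lt (div_lt_of_lt_mul hj)]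
  omega

theorem prob_misses_gt_le {b' : ℕ} {z p : ℝ} (hz : 1 ≤ z) (v : Fin n) (X : Finset (Fin n))
    (h : ((closedNbhd G v \ X).card : ℝ) ≤ p * (closedNbhd G v).card) :
    prob (tapeBound A L) (n * L + n * L) (fun ω => ¬ misses A L ω v X ≤ b') ≤
      (1 + (z - 1) * p) ^ L * (z ^ b')⁻¹ := by
  have h1 := mul_add_le L v.isLt
  simp only [not_le]
  rw [prob_eq_avg]
  refine avg_failures_gt_le (hits A v X) (D := A.size v) hz (fun t ht => tapeBound_sample A v ht)
    (by omega) (A.size_pos v) ?_ _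
  rw [card_not_hits, A.size_eq]
  exact h

theorem prob_misses_le_le {b' : ℕ} {p : ℝ} (v : Fin n) (X : Finset (Fin n))
    (h : p * (closedNbhd G v).card ≤ ((closedNbhd G v \ X).card : ℝ)) :
    prob (tapeBound A L) (n * L + n * L) (fun ω => misses A L ω v X ≤ b') ≤
      (1 - p / 2) ^ L * 2 ^ b' := by
  have h1 := mul_add_le L v.isLt
  rw [prob_eq_avg]
  refine avg_failures_le_le (hits A v X) (D := A.size v) (fun t ht => tapeBound_sample A v ht)
    (by omega) (A.size_pos v) ?_ _
  rw [card_not_hits, A.size_eq]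
  exact h

/-- The thresholds b and 5b are 1/20 and 1/4 of the samples, strictly between the accepted and the
guaranteed fractions. Per unit of b the four tail bounds, for strict and loose completeness and
strict and loose soundness, are (83/80)^20/4, (23/20)^20/2^5, 2(19/20)^20 and 2^5(4/5)^20, each at
most 3/4. -/
theorem prob_strict_complete (hL : L = 20 * b) (v : Fin n) (X : Finset (Fin n)) :
    prob (tapeBound A L) (n * L + n * L) (fun ω => ¬ (80 * (closedNbhd G v \ X).card ≤
      (closedNbhd G v).card → misses A L ω v X ≤ b)) ≤ (3 / 4) ^ b := by
  refine prob_not_imp_le (by positivity) fun h => ?_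
  have h' : (80 : ℝ) * (closedNbhd G v \ X).card ≤ (closedNbhd G v).card := by exact_mod_cast h
  refine (prob_misses_gt_le A (z := 4) (p := 1 / 80) (by norm_num) v X (by linarith)).trans ?_
  rw [hL, pow_mul, ← inv_pow, ← mul_pow]
  exact pow_le_pow_left₀ (by norm_num) (by norm_num) _

theorem prob_loose_complete (hL : L = 20 * b) (v : Fin n) (X : Finset (Fin n)) :
    prob (tapeBound A L) (n * L + n * L) (fun ω => ¬ (20 * (closedNbhd G v \ X).card ≤
      3 * (closedNbhd G v).card → misses A L ω v X ≤ 5 * b)) ≤ (3 / 4) ^ b := by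
  refine prob_not_imp_le (by positivity) fun h => ?_
  have h' : (20 : ℝ) * (closedNbhd G v \ X).card ≤ 3 * (closedNbhd G v).card := by
    exact_mod_cast h
  refine (prob_misses_gt_le A (z := 2) (p := 3 / 20) (by norm_num) v X (by linarith)).trans ?_
  rw [hL, pow_mul, pow_mul, ← inv_pow, ← mul_pow]
  exact pow_le_pow_left₀ (by norm_num) (by norm_num) _

theorem prob_strict_sound (hL : L = 20 * b) (v : Fin n) (X : Finset (Fin n)) :
    prob (tapeBound A L) (n * L + n * L) (fun ω => ¬ (misses A L ω v X ≤ b →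
      10 * (closedNbhd G v \ X).card ≤ (closedNbhd G v).card)) ≤ (3 / 4) ^ b := by
  refine (prob_mono (F := fun ω => ¬ (¬ 10 * (closedNbhd G v \ X).card ≤ (closedNbhd G v).card →
    ¬ misses A L ω v X ≤ b)) fun ω h h' => h (not_imp_not.1 h')).trans ?_
  refine prob_not_imp_le (by positivity) fun h => ?_
  have h' : ((closedNbhd G v).card : ℝ) < 10 * (closedNbhd G v \ X).card := by
    exact_mod_cast not_le.1 h
  simp only [not_not]
  refine (prob_misses_le_le A (p := 1 / 10) v X (by linarith)).trans ?_
  rw [hL, pow_mul, ← mul_pow]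
  exact pow_le_pow_left₀ (by norm_num) (by norm_num) _

theorem prob_loose_sound (hL : L = 20 * b) (v : Fin n) (X : Finset (Fin n)) :
    prob (tapeBound A L) (n * L + n * L) (fun ω => ¬ (misses A L ω v X ≤ 5 * b →
      5 * (closedNbhd G v \ X).card ≤ 2 * (closedNbhd G v).card)) ≤ (3 / 4) ^ b := by
  refine (prob_mono (F := fun ω => ¬ (¬ 5 * (closedNbhd G v \ X).card ≤
    2 * (closedNbhd G v).card → ¬ misses A L ω v X ≤ 5 * b))
    fun ω h h' => h (not_imp_not.1 h')).trans ?_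
  refine prob_not_imp_le (by positivity) fun h => ?_
  have h' : (2 : ℝ) * (closedNbhd G v).card < 5 * (closedNbhd G v \ X).card := by
    exact_mod_cast not_le.1 h
  simp only [not_not]
  refine (prob_misses_le_le A (p := 2 / 5) v X (by linarith)).trans ?_
  rw [hL, pow_mul, pow_mul, ← mul_pow]
  exact pow_le_pow_left₀ (by norm_num) (by norm_num) _

/-- Both `N w` and the good part nearly coincide with the class. -/
theorem card_nbhd_le_of_mem_goodPart {N : Fin n → Finset (Fin n)} {C : Clustering n} {v w : Fin n}
    (hv : Regular N C v) (hw : w ∈ goodPart N C v) : (N w).card ≤ 2 * (goodPart N C v).card := by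
  obtain ⟨h1, h2⟩ := mem_goodPart.1 hw
  have h3 := TagFacts.card_le_cls h2
  have h4 := hv.2
  have h5 : (cls C v).card ≤ (badPart N C v).card + (goodPart N C v).card := by
    rw [← cls_sdiff_goodPart]
    exact Finset.card_le_card_sdiff_add_card
  rw [← cls_congr h1] at h3
  omega

/-- With `S` the good part, the L|S| trials of its members each succeed with probability at least
1/(2|S|). All of them fail with probability at most exp(−L/2) = exp(−10b), however large the class
is. -/
theorem prob_cover (hL : L = 20 * b) (C : Clustering n) (v : Fin n) :
    prob (tapeBound A L) (n * L + n * L) (fun ω => ¬ (Regular (closedNbhd G) C v →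
      ∃ w ∈ goodPart (closedNbhd G) C v, ∃ t < L, ω (n * L + (w * L + t)) = 0)) ≤
      (3 / 4) ^ b := by
  classical
  refine prob_not_imp_le (by positivity) fun hv => ?_
  set S := goodPart (closedNbhd G) C v with hS
  set I := (S ×ˢ Finset.range L).image fun x : Fin n × ℕ => n * L + (x.1 * L + x.2) with hI
  have hmem : ∀ i ∈ I, ∃ w ∈ S, ∃ t < L, n * L + (w * L + t) = i := by
    intro i hi
    obtain ⟨⟨w, t⟩, h1, h2⟩ := Finset.mem_image.1 hi
    rw [Finset.mem_product, Finset.mem_range] at h1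
    exact ⟨w, h1.1, t, h1.2, h2⟩
  have hcard : I.card = S.card * L := by
    rw [Finset.card_image_of_injOn, Finset.card_product, Finset.card_range]
    rintro ⟨w, t⟩ h1 ⟨w', t'⟩ h2 h
    simp only [Finset.coe_product, Set.mem_prod, Finset.mem_coe, Finset.mem_range] at h1 h2
    have h3 : (w : ℕ) * L + t = w' * L + t' := Nat.add_left_cancel h
    have h4 : ((w : ℕ) * L + t) / L = (w' * L + t') / L := by rw [h3]
    rw [mul_comm, Nat.mul_add_div (by omega), Nat.div_eq_of_lt h1.2, mul_comm,
      Nat.mul_add_div (by omega), Nat.div_eq_of_lt h2.2] at h4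
    have h5 : w = w' := Fin.ext h4
    subst h5
    exact Prod.ext rfl (Nat.add_left_cancel h3)
  have hvS : v ∈ S := mem_goodPart.2 ⟨C.refl v, hv.1⟩
  have hpos : 0 < S.card := Finset.card_pos.2 ⟨v, hvS⟩
  refine (prob_mono (F := fun ω => ∀ i ∈ I, ω i ≠ 0) fun ω h i hi h0 => ?_).trans ?_
  · obtain ⟨w, hw, t, ht, rfl⟩ := hmem i hi
    exact h ⟨w, hw, t, ht, h0⟩
  rw [prob_eq_avg]
  refine (avg_forall_ne_zero_le (c := L) (D := 2 * S.card) (fun i hi => ?_) (by omega)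
    (fun i hi => ?_) ?_ _).trans ?_
  · obtain ⟨w, hw, t, ht, rfl⟩ := hmem i hi
    have := mul_add_le L w.isLt
    exact Finset.mem_range.2 (by omega)
  · obtain ⟨w, hw, t, ht, rfl⟩ := hmem i hi
    have h1 := mul_add_le L w.isLt
    have h2 : (w * L + t) / L = w := by
      rw [mul_comm, Nat.mul_add_div (by omega), Nat.div_eq_of_lt ht, add_zero]
    rw [tapeBound_center A (by omega), h2, A.size_eq]
    exact card_nbhd_le_of_mem_goodPart hv hw
  · rw [hcard]
    exact le_of_eq (by ring)
  · have h1 : Real.exp (-((L : ℝ) / 2)) = ((Real.exp 10)⁻¹) ^ b := by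
      rw [← Real.exp_neg, ← Real.exp_nat_mul, hL]
      congr 1
      push_cast
      ring
    rw [h1]
    refine pow_le_pow_left₀ (by positivity) ?_ _
    refine inv_le_of_inv_le₀ (by norm_num) ?_
    have := Real.add_one_le_exp (10 : ℝ)
    linarith

theorem prob_budget (hn : 0 < n) (hL : L = 20 * b) :
    prob (tapeBound A L) (n * L + n * L) (fun ω => ¬ ∑ j ∈ Finset.range (n * L),
      (if ω (n * L + j) = 0 then A.size (j / L) else 0) ≤ 3 * (n * L)) ≤ (3 / 4) ^ b := by
  have h1 : ∀ ω : ℕ → ℕ, ∑ j ∈ Finset.range (n * L),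
      (if ω (n * L + j) = 0 then A.size (j / L) else 0) = ∑ j ∈ Finset.range (n * L),
      (if ω (n * L + j) = 0 then tapeBound A L (n * L + j) + 1 else 0) := fun ω =>
    Finset.sum_congr rfl fun j hj => by rw [tapeBound_center A (Finset.mem_range.1 hj)]
  simp only [h1, not_le]
  rw [prob_eq_avg]
  refine (avg_sum_gt_le (n := n) (c := L) (b := n * L) hn le_rfl (fun j hj => ?_) _).trans ?_
  · rw [tapeBound_center A hj]
    exact A.size_le (div_lt_of_lt_mul hj)
  · rw [hL, pow_mul]
    exact pow_le_pow_left₀ (by norm_num) (by norm_num) _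

/-- Union bound over five families indexed by pairs of vertices, one indexed by vertices, and the
budget. -/
theorem prob_not_typicalTape_le (hn : 0 < n) (hL : L = 20 * b) (C : Clustering n) :
    prob (tapeBound A L) (n * L + n * L) (fun ω => ¬ TypicalTape A C b L ω) ≤
      (5 * n ^ 2 + n + 1) * (3 / 4) ^ b := by
  refine (prob_mono (F := fun ω => ¬ (_ ∧ _ ∧ _ ∧ _ ∧ _ ∧ _ ∧ _)) fun ω h h' => h ⟨h'.1, h'.2.1, h'.2.2.1, h'.2.2.2.1, h'.2.2.2.2.1,
    h'.2.2.2.2.2.1, h'.2.2.2.2.2.2⟩).trans ?_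
  have two : ∀ E : Fin n → Fin n → (ℕ → ℕ) → Prop,
      (∀ v w, prob (tapeBound A L) (n * L + n * L) (fun ω => ¬ E v w ω) ≤ (3 / 4) ^ b) →
      prob (tapeBound A L) (n * L + n * L) (fun ω => ¬ ∀ v w, E v w ω) ≤
        n * (n * (3 / 4) ^ b) := by
    intro E hE
    have h := prob_not_forall_le (fun v ω => ∀ w, E v w ω) fun v => prob_not_forall_le _ (hE v)
    rwa [Fintype.card_fin] at h
  have h1 := two _ fun v w => prob_strict_complete A hL v (closedNbhd G w)
  have h2 := two _ fun v w => prob_strict_sound A hL v (closedNbhd G w)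
  have h3 := two _ fun v w => prob_loose_complete A hL v (closedNbhd G w)
  have h4 := two _ fun v w => prob_loose_sound A hL v (closedNbhd G w)
  have h5 := two _ fun v w =>
    prob_loose_complete A hL v (closedNbhd G w ∩ goodPart (closedNbhd G) C v)
  have h6 := prob_not_forall_le _ (prob_cover A hL C)
  rw [Fintype.card_fin] at h6
  refine (prob_not_and_le _ _).trans ((add_le_add h1 <| (prob_not_and_le _ _).trans <|
    add_le_add h2 <| (prob_not_and_le _ _).trans <| add_le_add h3 <| (prob_not_and_le _ _).trans <|
    add_le_add h4 <| (prob_not_and_le _ _).trans <| add_le_add h5 <| (prob_not_and_le _ _).trans <|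
    add_le_add h6 <| prob_budget A hn hL).trans (le_of_eq ?_))
  ring

end Atypical

/-! ### Parameters -/

/-- The number of digits is at most log n/log 2 + 1 ≤ 2 log n/log 2, and 2/log 2 < 3. -/
theorem size_le_three_mul_log {n : ℕ} (hn : 2 ≤ n) : (Nat.size n : ℝ) ≤ 3 * Real.log n := by
  have h1 : 0 < Nat.size n := Nat.size_pos.2 (by omega)
  have h2 : 2 ^ (Nat.size n - 1) ≤ n := Nat.lt_size.1 (by omega)
  have h3 : ((Nat.size n - 1 : ℕ) : ℝ) * Real.log 2 ≤ Real.log n := by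
    rw [← Real.log_pow]
    exact Real.log_le_log (by positivity) (by exact_mod_cast h2)
  have h4 : Real.log 2 ≤ Real.log n := Real.log_le_log (by norm_num) (by exact_mod_cast hn)
  have h5 := Real.log_two_gt_d9
  rw [Nat.cast_sub h1, Nat.cast_one] at h3
  nlinarith [(Nat.cast_nonneg (Nat.size n) : (0 : ℝ) ≤ Nat.size n)]

theorem params_wordBound {n c : ℕ} (hn : 2 ≤ n) (hc : 1 ≤ c) :
    Params n (c * Nat.size n) (20 * (c * Nat.size n)) (wordBound (c + 13) n) where
  two_le := hn
  one_le := Nat.mul_pos hc (Nat.size_pos.2 (by omega))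
  hL := rfl
  hW := by
    have h1 : 0 < Nat.size n := Nat.size_pos.2 (by omega)
    have h2 : n < 2 ^ Nat.size n := Nat.lt_size_self n
    have h3 : Nat.size n < 2 ^ Nat.size n := Nat.lt_two_pow_self
    have h4 : c < 2 ^ (c * Nat.size n) :=
      (Nat.lt_two_pow_self (n := c)).trans_le (Nat.pow_le_pow_right (by norm_num)
        (Nat.le_mul_of_pos_right _ h1))
    have h5 : 2000 < 2 ^ (11 * Nat.size n) := by
      refine lt_of_lt_of_le (by norm_num : 2000 < 2 ^ (11 * 1)) ?_
      exact Nat.pow_le_pow_right (by norm_num) (Nat.mul_le_mul_left _ h1)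
    -- The c + 13 words' worth of digits split as 11 for the constant 2000, one for `n`, c for the
    -- factor c, and one for the number of digits.
    calc 100 * (n * (20 * (c * Nat.size n))) = 2000 * (n * (c * Nat.size n)) := by ring
      _ < 2 ^ (11 * Nat.size n) *
          (2 ^ Nat.size n * (2 ^ (c * Nat.size n) * 2 ^ Nat.size n)) :=
        Nat.mul_lt_mul'' h5 (Nat.mul_lt_mul'' h2 (Nat.mul_lt_mul'' h4 h3))
      _ = wordBound (c + 13) n := by
        rw [wordBound, ← pow_add, ← pow_add, ← pow_add]
        congr 1
        ring

theorem failure_le {n : ℕ} (hn : 2 ≤ n) (k : ℕ) :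
    (5 * (n : ℝ) ^ 2 + n + 1) * (3 / 4) ^ (3 * (k + 5) * Nat.size n) ≤ ((n : ℝ) ^ k)⁻¹ := by
  have hn' : (2 : ℝ) ≤ n := by exact_mod_cast hn
  -- Since (3/4)³ < 1/2, three units of the exponent for each binary digit gain a factor `n`. Five
  -- of the k + 5 such factors absorb the size of the union bound.
  have h1 : (3 / 4 : ℝ) ^ (3 * (k + 5) * Nat.size n) ≤ ((n : ℝ) ^ (k + 5))⁻¹ := by
    have h2 : (n : ℝ) ≤ 2 ^ Nat.size n := by exact_mod_cast (Nat.lt_size_self n).le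
    calc (3 / 4 : ℝ) ^ (3 * (k + 5) * Nat.size n)
        = (((3 / 4) ^ 3) ^ Nat.size n) ^ (k + 5) := by
          rw [← pow_mul, ← pow_mul]
          congr 1
          ring
      _ ≤ ((2⁻¹ : ℝ) ^ Nat.size n) ^ (k + 5) := by
          refine pow_le_pow_left₀ (by positivity) (pow_le_pow_left₀ (by positivity) ?_ _) _
          norm_num
      _ ≤ ((n : ℝ)⁻¹) ^ (k + 5) := by
          refine pow_le_pow_left₀ (by positivity) ?_ _
          rw [inv_pow]
          exact inv_anti₀ (by positivity) h2
      _ = ((n : ℝ) ^ (k + 5))⁻¹ := inv_pow _ _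
  have h3 : 5 * (n : ℝ) ^ 2 + n + 1 ≤ n ^ 5 := by
    have h4 : (2 : ℝ) ^ 3 ≤ n ^ 3 := pow_le_pow_left₀ (by norm_num) hn' 3
    nlinarith [sq_nonneg (n : ℝ)]
  calc (5 * (n : ℝ) ^ 2 + n + 1) * (3 / 4) ^ (3 * (k + 5) * Nat.size n)
      ≤ n ^ 5 * ((n : ℝ) ^ (k + 5))⁻¹ := mul_le_mul h3 h1 (by positivity) (by positivity)
    _ = ((n : ℝ) ^ k)⁻¹ := by
      rw [pow_add]
      field_simp

theorem clusterProg_isApprox (k : ℕ) {n : ℕ} (hn : 2 ≤ n) (G : LabeledGraph n)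
    (A : AdjList G.pos) {L : ℕ} (hL : L = 20 * (3 * (k + 5) * Nat.size n)) :
    Halts (wordBound (3 * (k + 5) + 13) n) A
      {s | IsApprox 1000000 G (Setoid.ker fun v : Fin n => s.arr 0 v)} (11 * (n * L))
      (initial (3 * (k + 5) + 13) n (clusterProg (3 * (k + 5)))) (n * L * (20 * L + 300) + 50)
      ((n : ℝ) ^ k)⁻¹ := by
  classical
  have hp := params_wordBound hn (show 1 ≤ 3 * (k + 5) by omega)
  rw [← hL] at hp
  set c := 3 * (k + 5) with hc
  have hs : 0 < Nat.size n := Nat.size_pos.2 (by omega)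
  have hcW : c < wordBound (c + 13) n :=
    Nat.lt_two_pow_self.trans_le (Nat.pow_le_pow_right (by norm_num)
      ((Nat.le_add_right c 13).trans (Nat.le_mul_of_pos_right _ hs)))
  have hnW : n < wordBound (c + 13) n :=
    (Nat.lt_size_self n).trans_le (Nat.pow_le_pow_right (by norm_num)
      (Nat.le_mul_of_pos_left _ (by omega)))
  -- The optimal clustering serves as the reference in the analysis; the program does not depend on
  -- it.
  obtain ⟨C, hC⟩ := exists_min_cost G
  have h := clusterProg_halts (A := A) (c := c) hL rfl hp hcW
    (S := {s | IsApprox 1000000 G (Setoid.ker fun v : Fin n => s.arr 0 v)})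
    (φ := fun ω => if ¬ TypicalTape A C (c * Nat.size n) L ω then 1 else 0)
    (fun ω => by split_ifs <;> norm_num)
    (fun ω s hout hS => by
      rw [if_pos fun hω => hS (hω.isApprox hp hC hout)])
    (s := (initial (c + 13) n (clusterProg c)).store)
    (by rw [initial, Nat.mod_eq_of_lt hnW]) rfl
  intro T hT
  refine ⟨(h T hT).1, (h T hT).2.trans (ENNReal.ofReal_le_ofReal ?_)⟩
  rw [← prob_eq_avg]
  exact (prob_not_typicalTape_le A (by omega) hL C).trans (failure_le hn k)

/-- Expanding the product gives coefficients 8000, 6000 and 50; the factor 9 comes from squaring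
`size_le_three_mul_log`. -/
theorem step_bound_le {n c : ℕ} (hn : 2 ≤ n) :
    n * (20 * (c * Nat.size n)) * (20 * (20 * (c * Nat.size n)) + 300) + 50 ≤
      ⌊((72000 * c ^ 2 + 54000 * c + 450 : ℕ) : ℝ) * (n * Real.log n ^ 2)⌋₊ := by
  refine Nat.le_floor ?_
  have h1 := size_le_three_mul_log hn
  have h2 : 1 ≤ Nat.size n := Nat.size_pos.2 (by omega)
  have h3 : n * (20 * (c * Nat.size n)) * (20 * (20 * (c * Nat.size n)) + 300) + 50 ≤
      (8000 * c ^ 2 + 6000 * c + 50) * (n * Nat.size n ^ 2) := by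
    set s := Nat.size n
    have h4 : c * n * s ≤ c * n * s ^ 2 := Nat.mul_le_mul_left _ (Nat.le_self_pow (by norm_num) s)
    have h5 : 1 ≤ n * s ^ 2 := Nat.mul_pos (by omega) (pow_pos h2 2)
    nlinarith
  calc ((n * (20 * (c * Nat.size n)) * (20 * (20 * (c * Nat.size n)) + 300) + 50 : ℕ) : ℝ)
      ≤ (((8000 * c ^ 2 + 6000 * c + 50) * (n * Nat.size n ^ 2) : ℕ) : ℝ) := by exact_mod_cast h3
    _ = (8000 * c ^ 2 + 6000 * c + 50) * (n * (Nat.size n : ℝ) ^ 2) := by push_cast; ring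
    _ ≤ (8000 * c ^ 2 + 6000 * c + 50) * (n * (3 * Real.log n) ^ 2) := by gcongr
    _ = ((72000 * c ^ 2 + 54000 * c + 450 : ℕ) : ℝ) * (n * Real.log n ^ 2) := by push_cast; ring

theorem query_bound_le {n c : ℕ} (hn : 2 ≤ n) :
    ((11 * (n * (20 * (c * Nat.size n))) : ℕ) : ℝ) ≤
      ((72000 * c ^ 2 + 54000 * c + 450 : ℕ) : ℝ) * (n * Real.log n) := by
  have h1 := size_le_three_mul_log hn
  have h2 : 0 ≤ Real.log n := Real.log_natCast_nonneg n
  calc ((11 * (n * (20 * (c * Nat.size n))) : ℕ) : ℝ) = 220 * c * (n * (Nat.size n : ℝ)) := by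
        push_cast; ring
    _ ≤ 220 * c * (n * (3 * Real.log n)) := by gcongr
    _ = ((660 * c : ℕ) : ℝ) * (n * Real.log n) := by push_cast; ring
    _ ≤ ((72000 * c ^ 2 + 54000 * c + 450 : ℕ) : ℝ) * (n * Real.log n) := by
        refine mul_le_mul_of_nonneg_right ?_ (by positivity)
        exact_mod_cast (by nlinarith : 660 * c ≤ 72000 * c ^ 2 + 54000 * c + 450)

theorem one_sub_le_toOuterMeasure {α : Type*} (p : PMF α) {s : Set α} {ε : ℝ≥0∞}
    (h : p.toOuterMeasure sᶜ ≤ ε) : 1 - ε ≤ p.toOuterMeasure s := by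
  rw [tsub_le_iff_right]
  calc (1 : ℝ≥0∞) = p.toOuterMeasure (s ∪ sᶜ) := by
        rw [Set.union_compl_self]
        exact ((p.toOuterMeasure_apply_eq_one_iff _).2 (Set.subset_univ _)).symm
    _ ≤ p.toOuterMeasure s + p.toOuterMeasure sᶜ := MeasureTheory.measure_union_le _ _
    _ ≤ p.toOuterMeasure s + ε := by gcongr

end CorrClust

end

theorem mainTheorem1 :
    ∃ α : ℝ, ∀ k : ℕ, ∃ (κ : ℕ) (P : CorrClust.Prog) (C : ℝ),
      ∀ n : ℕ, 2 ≤ n → ∀ (G : CorrClust.LabeledGraph n) (A : CorrClust.AdjList G.pos),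
        (∀ c ∈ (CorrClust.run κ P A ⌊C * (n * Real.log n ^ 2)⌋₊).support,
          c.Halted ∧ (c.queries : ℝ) ≤ C * (n * Real.log n)) ∧
        1 - ((n : ℝ≥0∞) ^ k)⁻¹ ≤
          (CorrClust.run κ P A ⌊C * (n * Real.log n ^ 2)⌋₊).toOuterMeasure
            {c | CorrClust.IsApprox α G (c.output n)} := by
  -- The threshold is b = c · (number of digits of n) with c = 3(k + 5), as needed in `failure_le`.
  -- One constant, taken from the step bound, also covers the queries.
  refine ⟨1000000, fun k => ⟨3 * (k + 5) + 13, CorrClust.clusterProg (3 * (k + 5)),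
    ((72000 * (3 * (k + 5)) ^ 2 + 54000 * (3 * (k + 5)) + 450 : ℕ) : ℝ), fun n hn G A => ?_⟩⟩
  obtain ⟨h1, h2⟩ := CorrClust.clusterProg_isApprox k hn G A rfl _
    (CorrClust.step_bound_le (c := 3 * (k + 5)) hn)
  refine ⟨fun c hc => ⟨(h1 c hc).1, ?_⟩, CorrClust.one_sub_le_toOuterMeasure _ ?_⟩
  · refine le_trans ?_ (CorrClust.query_bound_le (c := 3 * (k + 5)) hn)
    exact_mod_cast (h1 c hc).2
  · refine h2.trans (le_of_eq ?_)
    have hn' : (0 : ℝ) < n := by exact_mod_cast (by omega : 0 < n)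
    rw [ENNReal.ofReal_inv_of_pos (by positivity), ENNReal.ofReal_pow hn'.le,
      ENNReal.ofReal_natCast]
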